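/- **Setting.** Let $\beta,\gamma,\lambda$ be reals with $0\le\beta\le\gamma$, $\gamma>0$, $\lambda>0$, $\beta\gamma<1$. For an integer $d\ge1$ let $F_d(x)=\lambda\left(\frac{\beta x+1}{x+\gamma}\right)^d$ and let $\hat x_d$ be its unique positive fixed point; $(\beta,\gamma,\lambda)$ is *$d$-unique with gap $\delta$* if $|F_d'(\hat x_d)|\le 1-\delta$, and *up-to-$\Delta$ unique with gap $\delta$* if it is $d$-unique with gap $\delta$ for all integers $1\le d<\Delta$. Let $G=(V,E)$ be a finite simple graph on $n$ vertices, $\Delta_v$ the degree of $v$, and $\Delta=\max_v\Delta_v$. The anti-ferromagnetic two-spin system on $G$ has the Gibbs distribution $\mu(\sigma)\propto\beta^{m_{+1}(\sigma)}\gamma^{m_{-1}(\sigma)}\lambda^{n_{+1}(\sigma)}$ on $\{-1,+1\}^V$ (with $0^0=1$), where $m_i(\sigma)$ is the number of edges whose two endpoints have spin $i$ and $n_{+1}(\sigma)$ is the number of vertices of spin $+1$. The good direction $\chi\in\{-1,+1\}^V$ is $\chi_v=+1$ if $\beta=0$ or $\lambda\le(\gamma/\beta)^{\Delta_v/2}$,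 and $\chi_v=-1$ otherwise. Let $\nu(\sigma)=\mu(\sigma\odot\chi)$ be the flipped distribution, where $\odot$ is the coordinatewise product. For a distribution $\rho$ on $\{-1,+1\}^V$: - $\Omega(\rho)$ is its support, $\rho_\Lambda$ its marginal on $\Lambda\subseteq V$, and $\rho^{\sigma}$, for $\sigma\in\Omega(\rho_\Lambda)$, is the distribution on $\{-1,+1\}^V$ obtained by conditioning on the configuration $\sigma$ on $\Lambda$. - For $\phi\in(0,\infty)^V$, $\rho^{(\phi)}$ is the distribution with $\rho^{(\phi)}(\sigma)\propto\rho(\sigma)\prod_{v:\sigma_v=+1}\phi_v$; for a scalar $\theta>0$, $\rho^{(\theta)}$ is the case of all $\phi_v=\theta$. - For $\Lambda\subseteq V$ and $\sigma\in\Omega(\rho_\Lambda)$, the influence matrix $\Psi_\rho^\sigma$ is indexed by $V\setminus\Lambda$, has zero diagonal, and for $u\ne v$ has $\Psi_\rho^\sigma(u,v)=\max_{c,c'\in\Omega(\rho_u^\sigma)}d_{\mathrm{TV}}\left(\rho_v^{\sigma,u\leftarrow c},\rho_v^{\sigma,u\leftarrow c'}\right)$. The distribution $\rho$ is *$\eta$-spectrally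 independent* if every $\Psi_\rho^\sigma$ ($\Lambda\subseteq V$, $\sigma\in\Omega(\rho_\Lambda)$) has spectral radius at most $\eta$, and *completely $\eta$-spectrally independent* if $\rho^{(\phi)}$ is $\eta$-spectrally independent for every $\phi\in(0,1]^V$. - The Glauber dynamics for $\rho$ is the Markov chain on $\Omega(\rho)$ that picks $v\in V$ uniformly at random and resamples the spin at $v$ from $\rho$ conditioned on the spins of all other vertices. Its spectral gap $\mathrm{gap}(\rho)$ is $1-\lambda_2$, with $\lambda_2$ the second largest eigenvalue (with multiplicity) of its transition matrix, and is $1$ if $|\Omega(\rho)|=1$. Set $\mathrm{min\text{-}gap}(\rho)=\min_{\Lambda\subseteq V,\ \sigma\in\Omega(\rho_\Lambda)}\mathrm{gap}(\rho^\sigma)$. **Theorem.** Let $\delta\in(0,1)$, suppose $\Delta\ge3$ and that $(\beta,\gamma,\lambda)$ is up-to-$\Delta$ unique with gap $\delta$. Then: 1. $\nu$ is completely $\frac{144}{\delta}$-spectrally independent. 2. If no connected component of $G$ is a single edge (in particular, if $G$ is connected), then for $\theta=\frac{\delta^2}{64}$ and $C=\frac8\delta$, $\mathrm{min\text{-}gap}\left(\nu^{(\theta)}\right)\ge\frac1{Cn}$.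 -/

import Mathlib

noncomputable section

namespace TwoSpin

/-! ### Parameters, tree recursion and uniqueness -/

/-- Parameters `(β, γ, lam)` of an anti-ferromagnetic two-spin system. -/
structure AntiFerro (β γ lam : ℝ) : Prop where
  beta_nonneg : 0 ≤ β
  beta_le_gamma : β ≤ γ
  gamma_pos : 0 < γ
  lam_pos : 0 < lam
  beta_mul_gamma_lt_one : β * γ < 1

/-- The univariate tree recursion `F_d(x) = lam * ((β x + 1) / (x + γ)) ^ d`. -/
def treeRec (β γ lam : ℝ) (d : ℕ) (x : ℝ) : ℝ :=
  lam * ((β * x + 1) / (x + γ)) ^ d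

/-- The tree recursion has exactly one positive fixed point. -/
theorem existsUnique_treeRec_fixedPoint {β γ lam : ℝ} (h : AntiFerro β γ lam) {d : ℕ}
    (hd : 1 ≤ d) : ∃! x : ℝ, 0 < x ∧ treeRec β γ lam d x = x := by
  have hβ := h.beta_nonneg
  have hγ := h.gamma_pos
  have hl := h.lam_pos
  have hβγ := h.beta_mul_gamma_lt_one
  have hanti : ∀ x y : ℝ, 0 ≤ x → x < y → treeRec β γ lam d y < treeRec β γ lam d x := by
    intro x y hx hxy
    unfold treeRec
    have hx' : 0 < x + γ := by linarith
    have hy' : 0 < y + γ := by linarith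
    have hb : (β * y + 1) / (y + γ) < (β * x + 1) / (x + γ) := by
      rw [div_lt_div_iff₀ hy' hx']
      nlinarith
    have h0 : 0 ≤ (β * y + 1) / (y + γ) := by
      have : 0 ≤ y := by linarith
      positivity
    exact mul_lt_mul_of_pos_left (pow_lt_pow_left₀ hb h0 (by omega)) hl
  have hF0 : 0 < treeRec β γ lam d 0 := by
    unfold treeRec
    simp only [mul_zero, zero_add]
    positivity
  set M := treeRec β γ lam d 0 with hM
  have hcont : ContinuousOn (fun x => treeRec β γ lam d x - x) (Set.Icc 0 M) := by
    unfold treeRec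
    refine ContinuousOn.sub (ContinuousOn.mul continuousOn_const (ContinuousOn.pow
      (ContinuousOn.div (by fun_prop) (by fun_prop) ?_) d)) continuousOn_id
    intro x hx
    have := hx.1
    linarith
  have hmem : (0 : ℝ) ∈ Set.Icc (treeRec β γ lam d M - M) (treeRec β γ lam d 0 - 0) := by
    refine ⟨?_, by linarith⟩
    have := hanti 0 M le_rfl hF0
    linarith
  obtain ⟨x, hx, hx0⟩ := intermediate_value_Icc' hF0.le hcont hmem
  have hfix : treeRec β γ lam d x = x := by
    have : treeRec β γ lam d x - x = 0 := hx0
    linarith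
  have hxpos : 0 < x := by
    rcases hx.1.lt_or_eq with h1 | h1
    · exact h1
    · rw [← h1] at hfix
      linarith
  refine ⟨x, ⟨hxpos, hfix⟩, ?_⟩
  rintro y ⟨hy, hyfix⟩
  rcases lt_trichotomy x y with h1 | h1 | h1
  · have := hanti x y hxpos.le h1
    linarith
  · exact h1.symm
  · have := hanti y x hy.le h1
    linarith

/-- `(β, γ, lam)` is `d`-unique with gap `δ`: at the unique positive fixed point `x` of `F_d`,
`|F_d'(x)| ≤ 1 - δ`. -/
def DUnique (β γ lam : ℝ) (d : ℕ) (δ : ℝ) : Prop :=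
  ∃ x : ℝ, 0 < x ∧ treeRec β γ lam d x = x ∧ |deriv (treeRec β γ lam d) x| ≤ 1 - δ

/-- `(β, γ, lam)` is up-to-`Δ` unique with gap `δ`. -/
def UpToUnique (β γ lam : ℝ) (Δ : ℕ) (δ : ℝ) : Prop :=
  ∀ d : ℕ, 1 ≤ d → d < Δ → DUnique β γ lam d δ

/-! ### Distributions on `{-1, +1}^V`, given by their mass functions -/

/-- Configurations: `ℤˣ = {1, -1}` is the set of spins. -/
abbrev Config (V : Type*) := V → ℤˣ

variable {V : Type*} [Fintype V] [DecidableEq V]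

/-- The mass function proportional to the weight `w`. -/
def normalize (w : Config V → ℝ) : Config V → ℝ :=
  fun σ => w σ / ∑ τ, w τ

/-- `m_i(σ)`: the number of edges with both endpoints of spin `i`. -/
def monoEdges (G : SimpleGraph V) [DecidableRel G.Adj] (σ : Config V) (i : ℤˣ) : ℕ :=
  (G.edgeFinset.filter (fun e => ∀ v ∈ e, σ v = i)).card

/-- `n_{+1}(σ)`: the number of vertices of spin `+1`. -/
def numPlus (σ : Config V) : ℕ :=
  (Finset.univ.filter (fun v => σ v = 1)).card

/-- The weight `β ^ m_{+1}(σ) * γ ^ m_{-1}(σ) * lam ^ n_{+1}(σ)` (with `0 ^ 0 = 1`). -/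
def weight (G : SimpleGraph V) [DecidableRel G.Adj] (β γ lam : ℝ) (σ : Config V) : ℝ :=
  β ^ monoEdges G σ 1 * γ ^ monoEdges G σ (-1) * lam ^ numPlus σ

/-- The Gibbs distribution of the two-spin system on `G`. -/
def gibbs (G : SimpleGraph V) [DecidableRel G.Adj] (β γ lam : ℝ) : Config V → ℝ :=
  normalize (weight G β γ lam)

/-- `flip(μ, χ)(σ) = μ(σ ⊙ χ)`. -/
def flip (μ : Config V → ℝ) (χ : Config V) : Config V → ℝ :=
  fun σ => μ (σ * χ)

/-- `μ^(φ)`: the distribution `μ` magnetized with the local fields `φ`. -/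
def magnetize (μ : Config V → ℝ) (φ : V → ℝ) : Config V → ℝ :=
  normalize (fun σ => μ σ * ∏ v ∈ Finset.univ.filter (fun v => σ v = 1), φ v)

/-- `μ_Λ(σ)`: the marginal probability of the partial configuration `σ` on `Λ`. -/
def marginal (μ : Config V → ℝ) (Λ : Finset V) (σ : Λ → ℤˣ) : ℝ :=
  ∑ τ ∈ Finset.univ.filter (fun τ : Config V => ∀ v : Λ, τ v = σ v), μ τ

/-- `σ ∈ Ω(μ_Λ)`. -/
def Feasible (μ : Config V → ℝ) (Λ : Finset V) (σ : Λ → ℤˣ) : Prop :=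
  marginal μ Λ σ ≠ 0

/-- `μ^σ`: the distribution `μ` on `{-1, +1}^V` conditioned on the configuration `σ` on `Λ`. -/
def pin (μ : Config V → ℝ) (Λ : Finset V) (σ : Λ → ℤˣ) : Config V → ℝ :=
  fun τ => (if ∀ v : Λ, τ v = σ v then μ τ else 0) / marginal μ Λ σ

/-- `μ_v(c)`: the marginal probability of the spin `c` at `v`. -/
def vertexMarginal (μ : Config V → ℝ) (v : V) (c : ℤˣ) : ℝ :=
  ∑ τ ∈ Finset.univ.filter (fun τ : Config V => τ v = c), μ τ

/-- `μ^{u ← c}`: the distribution `μ` conditioned on the spin of `u` being `c`. -/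
def pinVertex (μ : Config V → ℝ) (u : V) (c : ℤˣ) : Config V → ℝ :=
  fun τ => (if τ u = c then μ τ else 0) / vertexMarginal μ u c

/-- Total variation distance of two mass functions on spins. -/
def dTV (p q : ℤˣ → ℝ) : ℝ := (1 / 2) * ∑ c, |p c - q c|

/-! ### Spectral independence -/

/-- The (absolute) influence matrix `Ψ_μ^σ`, indexed by `V ∖ Λ`. The supremum is the maximum over
the finitely many pairs of spins `c, c'` in the support of the marginal of `μ^σ` at `u`. -/
def influence (μ : Config V → ℝ) (Λ : Finset V) (σ : Λ → ℤˣ) :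
    Matrix {v // v ∉ Λ} {v // v ∉ Λ} ℝ :=
  fun u v =>
    if u = v then 0
    else ⨆ p : {p : ℤˣ × ℤˣ // vertexMarginal (pin μ Λ σ) u p.1 ≠ 0 ∧
        vertexMarginal (pin μ Λ σ) u p.2 ≠ 0},
      dTV (vertexMarginal (pinVertex (pin μ Λ σ) u p.1.1) v)
        (vertexMarginal (pinVertex (pin μ Λ σ) u p.1.2) v)

/-- `η`-spectral independence: the spectral radius (over `ℂ`) of every influence matrix is at
most `η`. -/
def SpectrallyIndependent (η : ℝ) (μ : Config V → ℝ) : Prop :=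
  ∀ (Λ : Finset V) (σ : Λ → ℤˣ), Feasible μ Λ σ →
    spectralRadius ℂ ((influence μ Λ σ).map Complex.ofReal) ≤ ENNReal.ofReal η

/-- Complete `η`-spectral independence. -/
def CompletelySpectrallyIndependent (η : ℝ) (μ : Config V → ℝ) : Prop :=
  ∀ φ : V → ℝ, (∀ v, 0 < φ v ∧ φ v ≤ 1) → SpectrallyIndependent η (magnetize μ φ)

/-! ### Glauber dynamics and its spectral gap -/

/-- The support `Ω(μ)`. -/
abbrev Supp (μ : Config V → ℝ) := {σ : Config V // μ σ ≠ 0}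

/-- Transition matrix of the Glauber dynamics on `Ω(μ)`: pick `v ∈ V` uniformly at random (among
all vertices, pinned or not), and resample the spin at `v` from `μ` conditioned on the spins of all
other vertices. -/
def glauber (μ : Config V → ℝ) : Matrix (Supp μ) (Supp μ) ℝ :=
  fun σ τ => (1 / (Fintype.card V : ℝ)) *
    ∑ v : V, if ∀ w, w ≠ v → τ.1 w = σ.1 w
      then μ τ.1 / ∑ c : ℤˣ, μ (Function.update σ.1 v c) else 0

open Classical in
/-- The spectral gap `1 - λ₂`, where `λ₁ ≥ λ₂ ≥ …` are the eigenvalues of the Glauber dynamics of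
`μ`, listed with multiplicity. If `|Ω(μ)| = 1` then `λ₂ = 0` by convention, so that the gap
is `1`. -/
def glauberGap (μ : Config V → ℝ) : ℝ :=
  1 - ((glauber μ).charpoly.roots.sort (· ≥ ·)).getD 1 0

/-- The smallest spectral gap over all feasible pinnings (a minimum over a finite set). -/
def minGap (μ : Config V → ℝ) : ℝ :=
  ⨅ p : (Λ : Finset V) × {σ : Λ → ℤˣ // Feasible μ Λ σ}, glauberGap (pin μ p.1 p.2.1)

/-! ### The good direction -/

/-- The good direction: `χ_v = +1` iff `lam ≤ (γ / β) ^ (Δ_v / 2)`, where `γ / 0 = +∞`. -/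
def goodDirection (G : SimpleGraph V) [DecidableRel G.Adj] (β γ lam : ℝ) : Config V :=
  fun v => if β = 0 ∨ lam ≤ (γ / β) ^ ((G.degree v : ℝ) / 2) then 1 else -1

/-! ### The mass functions above are probability distributions -/

theorem normalize_mem_stdSimplex {w : Config V → ℝ} (h0 : ∀ σ, 0 ≤ w σ) {σ : Config V}
    (hσ : w σ ≠ 0) : normalize w ∈ stdSimplex ℝ (Config V) := by
  have hpos : 0 < ∑ τ, w τ :=
    Finset.sum_pos' (fun τ _ => h0 τ) ⟨σ, Finset.mem_univ _, lt_of_le_of_ne (h0 σ) hσ.symm⟩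
  refine ⟨fun τ => div_nonneg (h0 τ) hpos.le, ?_⟩
  simp only [normalize]
  rw [← Finset.sum_div, div_self hpos.ne']

theorem gibbs_mem_stdSimplex (G : SimpleGraph V) [DecidableRel G.Adj] {β γ lam : ℝ}
    (h : AntiFerro β γ lam) : gibbs G β γ lam ∈ stdSimplex ℝ (Config V) := by
  have hβ := h.beta_nonneg
  have hγ := h.gamma_pos
  have hl := h.lam_pos
  refine normalize_mem_stdSimplex (fun σ => ?_) (σ := fun _ => -1) ?_
  · unfold weight
    positivity
  · have hm : monoEdges G (fun _ => -1) 1 = 0 := by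
      unfold monoEdges
      rw [Finset.card_eq_zero, Finset.filter_eq_empty_iff]
      intro e _
      induction e with
      | _ a b =>
        intro hab
        exact absurd (hab a (by simp)) (show ¬ ((-1 : ℤˣ) = 1) by decide)
    unfold weight
    rw [hm, pow_zero, one_mul]
    positivity

theorem flip_mem_stdSimplex {μ : Config V → ℝ} (hμ : μ ∈ stdSimplex ℝ (Config V))
    (χ : Config V) : flip μ χ ∈ stdSimplex ℝ (Config V) :=
  ⟨fun σ => hμ.1 _, by rw [← hμ.2]; exact Equiv.sum_comp (Equiv.mulRight χ) μ⟩

theorem magnetize_mem_stdSimplex {μ : Config V → ℝ} (hμ : μ ∈ stdSimplex ℝ (Config V))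
    {φ : V → ℝ} (hφ : ∀ v, 0 < φ v) : magnetize μ φ ∈ stdSimplex ℝ (Config V) := by
  obtain ⟨σ, hσ⟩ : ∃ σ, μ σ ≠ 0 := by
    by_contra hcon
    push Not at hcon
    have := hμ.2
    simp [hcon] at this
  refine normalize_mem_stdSimplex (fun τ => mul_nonneg (hμ.1 τ)
    (Finset.prod_nonneg fun v _ => (hφ v).le)) (σ := σ) ?_
  exact mul_ne_zero hσ (Finset.prod_pos fun v _ => hφ v).ne'

end TwoSpin

end

/-! Dividing all weights by γ^|E| turns the system into a soft hard-core model: with p = βγ, every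
edge inside the set of +1 spins costs p, and a vertex v carries the field λ/γ^(deg v). A vertex with
marginal ratio y sends its parent the message (1 + py)/(1 + y), with absolute logarithmic derivative
`sens p y`; at the fixed point z of the recursion, |F_d'| is d * sens p z. Exchanging the two spins
is y ↦ 1/(py), which preserves `sens`.

Contraction. With the potential √sens, a vertex with d children needs sens(its ratio) * (∑
√sens(children))² ≤ 1 - δ. Passing to the geometric mean of the messages reduces this to equal
children, where `univariate_contraction` bounds the product of sensitivities at consecutive levels
through d * sens p z. The threshold in the good direction decides on which side of pz² = 1 the fixed
point lies. Moving the field in the good direction moves the fixed point away from the peak √p y = 1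
of `sens`, so the bound survives every φ ≤ 1 (`contraction_of_field_le`, `contraction_of_le_field`).

Influence. Switching the spin of u multiplies the fields of its neighbors by p. Doing so one
neighbor at a time gives the self-avoiding-walk recursion without building a tree (`damp_many`), and
contraction sums the influences as a geometric series (`totalInfl_mul_sqrt_le`). Row sums are taken
with weight deg v; `cap_mul_cap_le` then makes the bound independent of Δ.

Spectral gap. Shrinking the fields by δ²/64 forces D * sens ≤ 9/16 at every vertex of degree D ≥ 2
(`sens_small_field`). This is a weighted Dobrushin condition, and a path-coupling argument on
eigenfunctions (`glauber_eigenfunction_const`) converts it into a gap for every pinning. -/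

noncomputable section

namespace TwoSpin

/-! ### The normalized tree recursion

After rescaling, a two-spin system with `p = β γ` becomes a soft hard-core model in which an edge
contributes `p` if both endpoints have spin `+1` and `1` otherwise. -/

/-- The message sent to its parent by a vertex with marginal ratio `y`. -/
def msg (p y : ℝ) : ℝ := (1 + p * y) / (1 + y)

/-- The absolute logarithmic derivative of the message. -/
def sens (p y : ℝ) : ℝ := (1 - p) * y / ((1 + p * y) * (1 + y))

/-- The sensitivity as a function of the message. -/
def msgSens (p b : ℝ) : ℝ := (1 + p - b - p / b) / (1 - p)

section basic

variable {p y : ℝ}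

theorem msg_pos (hp : 0 ≤ p) (hy : 0 ≤ y) : 0 < msg p y := by
  unfold msg; positivity

theorem msg_le_one (hp1 : p < 1) (hy : 0 ≤ y) : msg p y ≤ 1 := by
  unfold msg
  rw [div_le_one (by positivity)]
  nlinarith

theorem le_msg (hp1 : p < 1) (hy : 0 ≤ y) : p ≤ msg p y := by
  unfold msg
  rw [le_div_iff₀ (by positivity)]
  nlinarith

theorem sens_nonneg (hp : 0 ≤ p) (hp1 : p < 1) (hy : 0 ≤ y) : 0 ≤ sens p y := by
  unfold sens
  have : 0 ≤ 1 - p := by linarith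
  positivity

theorem sens_zero : sens p 0 = 0 := by simp [sens]

theorem sens_le (hp : 0 ≤ p) (hp1 : p < 1) (hy : 0 ≤ y) : sens p y ≤ (1 - p) * y := by
  unfold sens
  have : 0 ≤ 1 - p := by linarith
  apply div_le_self (by positivity)
  nlinarith [mul_nonneg hp hy, mul_nonneg (mul_nonneg hp hy) hy]

theorem sens_le_one (hp : 0 ≤ p) (hy : 0 ≤ y) : sens p y ≤ 1 := by
  unfold sens
  rw [div_le_one (by positivity)]
  nlinarith [mul_nonneg hp hy, mul_nonneg (mul_nonneg hp hy) hy]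

theorem msgSens_msg (hp : 0 ≤ p) (hp1 : p < 1) (hy : 0 ≤ y) :
    msgSens p (msg p y) = sens p y := by
  unfold msgSens msg sens
  have h1 : 1 - p ≠ 0 := by linarith
  have h2 : 1 + p * y ≠ 0 := by positivity
  have h3 : 1 + y ≠ 0 := by positivity
  field_simp
  ring

theorem msgSens_nonneg (hp : 0 ≤ p) (hp1 : p < 1) {b : ℝ} (hb : p ≤ b) (hb1 : b ≤ 1) :
    0 ≤ msgSens p b := by
  unfold msgSens
  have h1 : 0 < 1 - p := by linarith
  rcases (hp.trans hb).eq_or_lt with h | h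
  · rw [← h]
    simp
    positivity
  · have : 1 + p - b - p / b = (1 - b) * (b - p) / b := by field_simp; ring
    rw [this]
    have h2 : 0 ≤ 1 - b := by linarith
    have h3 : 0 ≤ b - p := by linarith
    positivity

/-- The maximum is attained at √p y = 1; the difference is a multiple of (1 - √p y)². -/
theorem sens_le_sqrt (hp : 0 ≤ p) (hp1 : p < 1) (hy : 0 ≤ y) :
    sens p y ≤ (1 - √p) / (1 + √p) := by
  obtain ⟨q, hq, hqp⟩ : ∃ q : ℝ, q = √p ∧ p = q ^ 2 := ⟨√p, rfl, (Real.sq_sqrt hp).symm⟩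
  have hq0 : 0 ≤ q := hq ▸ Real.sqrt_nonneg p
  have hq1 : q < 1 := by nlinarith
  rw [← hq]
  unfold sens
  rw [div_le_div_iff₀ (by positivity) (by positivity), hqp]
  have : 0 ≤ (1 - q) * (1 - q * y) ^ 2 := mul_nonneg (by linarith) (sq_nonneg _)
  nlinarith

/-- The symmetry exchanging the two spins. -/
theorem sens_inv (hp : 0 < p) (hy : 0 < y) : sens p (1 / (p * y)) = sens p y := by
  unfold sens
  field_simp
  ring

theorem msg_inv (hp : 0 < p) (hy : 0 < y) : msg p (1 / (p * y)) = p / msg p y := by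
  unfold msg
  field_simp
  ring

theorem msgSens_inv (hp : 0 < p) {b : ℝ} (hb : 0 < b) : msgSens p (p / b) = msgSens p b := by
  unfold msgSens
  have : p / (p / b) = b := by field_simp
  rw [this]
  ring

theorem sens_le_inv (hp : 0 < p) (hp1 : p < 1) (hy : 0 < y) : sens p y ≤ (1 - p) / (p * y) := by
  rw [← sens_inv hp hy]
  refine (sens_le hp.le hp1 (by positivity)).trans (le_of_eq ?_)
  ring

theorem msg_anti (hp1 : p < 1) {x : ℝ} (hx : 0 ≤ x) (hxy : x ≤ y) : msg p y ≤ msg p x := by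
  unfold msg
  rw [div_le_div_iff₀ (by linarith) (by linarith)]
  nlinarith

/-- After clearing denominators the difference is (1 - p)(y - x)(1 - pxy), nonnegative up to the
peak. -/
theorem sens_mono (hp : 0 ≤ p) (hp1 : p < 1) {x : ℝ} (hx : 0 ≤ x) (hxy : x ≤ y)
    (hy : p * y ^ 2 ≤ 1) : sens p x ≤ sens p y := by
  unfold sens
  have hy0 : 0 ≤ y := hx.trans hxy
  rw [div_le_div_iff₀ (by positivity) (by positivity)]
  have h1 : p * (x * y) ≤ 1 := by
    refine le_trans ?_ hy
    apply mul_le_mul_of_nonneg_left _ hp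
    nlinarith
  have : 0 ≤ (1 - p) * ((y - x) * (1 - p * (x * y))) :=
    mul_nonneg (by linarith) (mul_nonneg (by linarith) (by linarith))
  nlinarith

end basic

/-! ### Univariate contraction -/

section univariate

variable {p : ℝ}

/-- The logarithmic derivative of `sens`. -/
def sensLogDeriv (p y : ℝ) : ℝ := (1 - p * y ^ 2) / ((1 + p * y) * (1 + y))

/-- The function equals 1/(1 + y) - py/(1 + py), and both terms are antitone. -/
theorem sensLogDeriv_anti (hp : 0 ≤ p) {x y : ℝ} (hx : 0 ≤ x) (hxy : x ≤ y) :
    sensLogDeriv p y ≤ sensLogDeriv p x := by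
  have hy0 : 0 ≤ y := hx.trans hxy
  unfold sensLogDeriv
  rw [div_le_div_iff₀ (by positivity) (by positivity)]
  have h1 : 0 ≤ p * (y - x) := mul_nonneg hp (by linarith)
  have h2 : 0 ≤ y - x := by linarith
  have h3 : 0 ≤ x * y := by positivity
  nlinarith [mul_nonneg h1 h3, mul_nonneg h1 hx, mul_nonneg h1 hy0, mul_nonneg (mul_nonneg hp h1) h3,
    mul_nonneg (mul_nonneg h1 h3) hp]

/-- This identity lets a factor `sens p y` be pulled out of the logarithmic derivative of the
two-level product in `univariate_contraction`, leaving a monotone function. -/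
theorem sens_mul_eq {y : ℝ} (hp : 0 ≤ p) (hy : 0 < y) :
    sens p y * (1 / y - p * y) = (1 - p) * sensLogDeriv p y := by
  unfold sens sensLogDeriv
  field_simp

theorem hasDerivAt_sens (hp : 0 ≤ p) {y : ℝ} (hy : 0 < y) :
    HasDerivAt (sens p) (sens p y * sensLogDeriv p y / y) y := by
  have h1 : HasDerivAt (fun y : ℝ => (1 - p) * y) ((1 - p) * 1) y :=
    (hasDerivAt_id y).const_mul _
  have h2 : HasDerivAt (fun y : ℝ => (1 + p * y) * (1 + y))
      ((p * 1) * (1 + y) + (1 + p * y) * 1) y :=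
    (((hasDerivAt_id y).const_mul p).const_add 1).mul ((hasDerivAt_id y).const_add 1)
  have h3 := h1.div h2 (by positivity)
  refine h3.congr_deriv ?_
  unfold sens sensLogDeriv
  field_simp
  ring

theorem hasDerivAt_msg_pow (hp : 0 ≤ p) (m : ℝ) (d : ℕ) {y : ℝ} (hy : 0 < y) :
    HasDerivAt (fun y => m * msg p y ^ d) (-(m * msg p y ^ d * (d * sens p y) / y)) y := by
  have h1 : HasDerivAt (msg p) (-((1 - p) / (1 + y) ^ 2)) y := by
    have := (((hasDerivAt_id y).const_mul p).const_add 1).div ((hasDerivAt_id y).const_add 1)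
      (by simp; positivity)
    refine this.congr_deriv ?_
    simp
    field_simp
    ring
  refine ((h1.pow d).const_mul m).congr_deriv ?_
  rcases d with _ | d
  · simp
  · unfold msg sens
    simp only [Nat.add_sub_cancel, pow_succ]
    have : 1 + p * y ≠ 0 := by positivity
    field_simp

/-- The product of the sensitivities at two consecutive levels of the regular tree. -/
theorem univariate_contraction (hp : 0 ≤ p) (hp1 : p < 1) {d : ℕ} {m z : ℝ}
    (hm : 0 < m) (hz : 0 < z) (hfix : m * msg p z ^ d = z) (hz1 : p * z ^ 2 ≤ 1)
    (hu : d * sens p z ≤ 1) {y : ℝ} (hy : 0 < y) :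
    (d : ℝ) ^ 2 * (sens p y * sens p (m * msg p y ^ d)) ≤ d * sens p z := by
  set F : ℝ → ℝ := fun y => m * msg p y ^ d with hF
  have hFpos : ∀ y, 0 < y → 0 < F y := fun y hy => mul_pos hm (pow_pos (msg_pos hp hy.le) d)
  have hFanti : ∀ x y, 0 < x → x ≤ y → F y ≤ F x := fun x y hx hxy =>
    mul_le_mul_of_nonneg_left (pow_le_pow_left₀ (msg_pos hp (hx.le.trans hxy)).le
      (msg_anti hp1 hx.le hxy) d) hm.le
  have hFz : F z = z := hfix
  -- Up to the factor sens p y / (1 - p), S is the derivative of log Q with respect to log y, for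
  -- the product Q defined below. Uniqueness gives S z ≥ 0, because S z = (1/z - pz)(1 - d * sens p
  -- z).
  set S : ℝ → ℝ := fun y => 1 / y - p * y - d * (1 - p) * sensLogDeriv p (F y) with hS
  have hSanti : ∀ x y, 0 < x → x ≤ y → S y ≤ S x := by
    intro x y hx hxy
    have h1 : 1 / y ≤ 1 / x := one_div_le_one_div_of_le hx hxy
    have h2 : p * x ≤ p * y := mul_le_mul_of_nonneg_left hxy hp
    have h3 : sensLogDeriv p (F x) ≤ sensLogDeriv p (F y) :=
      sensLogDeriv_anti hp (hFpos y (hx.trans_le hxy)).le (hFanti x y hx hxy)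
    have h4 : d * (1 - p) * sensLogDeriv p (F x) ≤ d * (1 - p) * sensLogDeriv p (F y) :=
      mul_le_mul_of_nonneg_left h3 (mul_nonneg (Nat.cast_nonneg d) (by linarith))
    simp only [hS]
    linarith
  have hsz : 0 ≤ sens p z := sens_nonneg hp hp1 hz.le
  have hez : 0 ≤ 1 / z - p * z := by
    have : 1 / z - p * z = (1 - p * z ^ 2) / z := by field_simp
    rw [this]
    exact div_nonneg (by linarith) hz.le
  have hSz : 0 ≤ S z := by
    simp only [hS, hFz]
    have := sens_mul_eq hp hz
    have h2 : d * (1 - p) * sensLogDeriv p z = d * sens p z * (1 / z - p * z) := by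
      rw [mul_assoc, ← this]; ring
    rw [h2]
    nlinarith
  set Q : ℝ → ℝ := fun y => sens p y * sens p (F y) with hQ
  have hd0 : (0 : ℝ) ≤ d := Nat.cast_nonneg d
  have hQz : d ^ 2 * Q z ≤ d * sens p z := by
    simp only [hQ, hFz]
    have : 0 ≤ d * sens p z := by positivity
    nlinarith
  -- the bound where `S` is nonnegative
  have hdirect : ∀ y, z ≤ y → 0 ≤ S y → d ^ 2 * Q y ≤ d * sens p z := by
    intro y hzy hSy
    rcases hzy.eq_or_lt with h | h
    · rw [← h]; exact hQz
    have hy : 0 < y := hz.trans h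
    have hFy := hFpos y hy
    have hFle : F y ≤ z := hFz ▸ hFanti z y hz hzy
    rcases hd0.eq_or_lt with hd | hd
    · rw [← hd]; simp
    have hFlt : F y < z := by
      rw [← hFz]
      have hb : msg p y < msg p z := by
        unfold msg
        rw [div_lt_div_iff₀ (by linarith) (by linarith)]
        nlinarith
      exact mul_lt_mul_of_pos_left (pow_lt_pow_left₀ hb (msg_pos hp hy.le).le
        (by rintro rfl; simp at hd)) hm
    have heF : 1 / z - p * z < 1 / F y - p * F y := by
      have h1 : 1 / z < 1 / F y := one_div_lt_one_div_of_lt hFy hFlt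
      have h2 : p * F y ≤ p * z := mul_le_mul_of_nonneg_left hFle hp
      linarith
    have heF0 : 0 < 1 / F y - p * F y := lt_of_le_of_lt hez heF
    have h1 : d * (sens p (F y) * (1 / F y - p * F y)) ≤ 1 / y - p * y := by
      rw [sens_mul_eq hp hFy]
      simp only [hS] at hSy
      linarith
    have hsy := sens_nonneg hp hp1 hy.le
    -- S y ≥ 0 trades the second-level sensitivity for 1/y - py, which `sens_mul_eq` absorbs. Both
    -- ends then carry the factor 1/F y - p F y, positive because F y < z, and it cancels.
    have h2 : sens p y * (d * (sens p (F y) * (1 / F y - p * F y))) ≤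
        sens p z * (1 / F y - p * F y) := by
      calc _ ≤ sens p y * (1 / y - p * y) := mul_le_mul_of_nonneg_left h1 hsy
        _ = (1 - p) * sensLogDeriv p y := sens_mul_eq hp hy
        _ ≤ (1 - p) * sensLogDeriv p z :=
          mul_le_mul_of_nonneg_left (sensLogDeriv_anti hp hz.le hzy) (by linarith)
        _ = sens p z * (1 / z - p * z) := (sens_mul_eq hp hz).symm
        _ ≤ _ := mul_le_mul_of_nonneg_left heF.le hsz
    have h3 : d * Q y ≤ sens p z := by
      have : (d * Q y) * (1 / F y - p * F y) ≤ sens p z * (1 / F y - p * F y) := by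
        simp only [hQ]; linarith
      exact le_of_mul_le_mul_right this heF0
    nlinarith
  have hQderiv : ∀ y, 0 < y → HasDerivAt Q (Q y * (S y * sens p y / (1 - p)) / y) y := by
    intro y hy
    have hFy := hFpos y hy
    have h1 := hasDerivAt_sens hp hy
    have h2 := (hasDerivAt_sens hp hFy).comp y (hasDerivAt_msg_pow hp m d hy)
    refine (h1.mul h2).congr_deriv ?_
    have h3 : sensLogDeriv p y = sens p y * (1 / y - p * y) / (1 - p) := by
      rw [sens_mul_eq hp hy, mul_div_cancel_left₀ _ (by linarith)]
    have h4 : F y = m * msg p y ^ d := rfl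
    have h5 : 1 - p ≠ 0 := by linarith
    simp only [hQ, hS, Function.comp, ← h4]
    rw [h3]
    field_simp
    ring
  have hQcont : ∀ a b, 0 < a → ContinuousOn Q (Set.Icc a b) := fun a b ha x hx =>
    (hQderiv x (ha.trans_le hx.1)).continuousAt.continuousWithinAt
  have hQnn : ∀ y, 0 < y → 0 ≤ Q y := fun y hy =>
    mul_nonneg (sens_nonneg hp hp1 hy.le) (sens_nonneg hp hp1 (hFpos y hy).le)
  have hderivsign : ∀ y, 0 < y → 0 ≤ Q y * sens p y / (1 - p) / y := fun y hy =>
    div_nonneg (div_nonneg (mul_nonneg (hQnn y hy) (sens_nonneg hp hp1 hy.le)) (by linarith)) hy.le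
  -- As S is antitone with S z ≥ 0, Q increases up to z. If S y < 0, then Q y is at most the value
  -- of Q at a zero of S beyond z, where the direct bound applies.
  rcases le_or_gt y z with hyz | hyz
  · have hmono : MonotoneOn Q (Set.Icc y z) := by
      refine monotoneOn_of_deriv_nonneg (convex_Icc y z) (hQcont y z hy) ?_ ?_
      · intro x hx
        rw [interior_Icc] at hx
        exact (hQderiv x (hy.trans hx.1)).differentiableAt.differentiableWithinAt
      · intro x hx
        rw [interior_Icc] at hx
        have hx0 := hy.trans hx.1
        rw [(hQderiv x hx0).deriv]
        have h1 := hSanti x z hx0 hx.2.le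
        have := mul_nonneg (hderivsign x hx0) (hSz.trans h1)
        refine this.trans (le_of_eq ?_)
        ring
    have := hmono (Set.left_mem_Icc.2 hyz) (Set.right_mem_Icc.2 hyz) hyz
    exact (mul_le_mul_of_nonneg_left this (by positivity)).trans hQz
  · rcases le_or_gt 0 (S y) with hSy | hSy
    · exact hdirect y hyz.le hSy
    have hScont : ContinuousOn S (Set.Icc z y) := by
      intro x hx
      have hx0 : 0 < x := hz.trans_le hx.1
      have hFx := hFpos x hx0
      have hFc : ContinuousAt F x := (hasDerivAt_msg_pow hp m d hx0).continuousAt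
      have : ContinuousAt (sensLogDeriv p) (F x) := by
        unfold sensLogDeriv
        exact ContinuousAt.div (by fun_prop) (by fun_prop) (by positivity)
      have h2 : ContinuousAt (fun x => sensLogDeriv p (F x)) x :=
        ContinuousAt.comp (f := F) (g := sensLogDeriv p) this hFc
      have h3 : ContinuousAt (fun x : ℝ => 1 / x) x :=
        continuousAt_const.div continuousAt_id hx0.ne'
      exact ((h3.sub (by fun_prop)).sub (continuousAt_const.mul h2)).continuousWithinAt
    obtain ⟨x, hx, hSx⟩ := intermediate_value_Icc' hyz.le hScont
      (show (0 : ℝ) ∈ Set.Icc (S y) (S z) from ⟨hSy.le, hSz⟩)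
    have hx0 : 0 < x := hz.trans_le hx.1
    have hanti : AntitoneOn Q (Set.Icc x y) := by
      refine antitoneOn_of_deriv_nonpos (convex_Icc x y) (hQcont x y hx0) ?_ ?_
      · intro t ht
        rw [interior_Icc] at ht
        exact (hQderiv t (hx0.trans ht.1)).differentiableAt.differentiableWithinAt
      · intro t ht
        rw [interior_Icc] at ht
        have ht0 := hx0.trans ht.1
        rw [(hQderiv t ht0).deriv]
        have h1 := hSanti x t hx0 ht.1.le
        rw [hSx] at h1
        have := mul_nonneg (hderivsign t ht0) (neg_nonneg.2 h1)
        have h2 : Q t * (S t * sens p t / (1 - p)) / t =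
          -(Q t * sens p t / (1 - p) / t * -S t) := by ring
        rw [h2]
        linarith
    have := hanti (Set.left_mem_Icc.2 hx.2) (Set.right_mem_Icc.2 hx.2) hx.2
    exact (mul_le_mul_of_nonneg_left this (by positivity)).trans (hdirect x hx.1 hSx.ge)

end univariate

/-! ### Multivariate contraction -/

section multivariate

variable {p : ℝ}

/-- Lowering the field lowers the fixed point, so it stays in the range where `sens` is monotone and
the uniqueness bound is inherited. -/
theorem exists_fixedPoint_le (hp : 0 ≤ p) {d : ℕ} {m₀ m z : ℝ} (hm : 0 < m)
    (hm₀ : m ≤ m₀) (hz : 0 < z) (hfix : m₀ * msg p z ^ d = z) :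
    ∃ x, 0 < x ∧ x ≤ z ∧ m * msg p x ^ d = x := by
  have hcont : ContinuousOn (fun x => x - m * msg p x ^ d) (Set.Icc 0 z) := by
    unfold msg
    refine continuousOn_id.sub (continuousOn_const.mul (ContinuousOn.pow
      (ContinuousOn.div (by fun_prop) (by fun_prop) ?_) d))
    intro x hx
    have := hx.1
    linarith
  have hmem : (0 : ℝ) ∈ Set.Icc (0 - m * msg p 0 ^ d) (z - m * msg p z ^ d) := by
    constructor
    · simp [msg, hm.le]
    · have : m * msg p z ^ d ≤ m₀ * msg p z ^ d :=
        mul_le_mul_of_nonneg_right hm₀ (pow_nonneg (msg_pos hp hz.le).le d)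
      linarith
  obtain ⟨x, hx, hx0⟩ := intermediate_value_Icc hz.le hcont hmem
  have h0 : x - m * msg p x ^ d = 0 := hx0
  have hpos : 0 < m * msg p x ^ d := mul_pos hm (pow_pos (msg_pos hp hx.1) d)
  exact ⟨x, by linarith, hx.2, by linarith⟩

/-- The witness is the geometric mean: AM-GM for b gives the first inequality, AM-GM for 1/b the
second. -/
theorem exists_geomMean {ι : Type*} (s : Finset ι) (hs : s.Nonempty) (b : ι → ℝ)
    (hb : ∀ i ∈ s, 0 < b i) :
    ∃ B : ℝ, 0 < B ∧ B ^ s.card = ∏ i ∈ s, b i ∧ s.card * B ≤ ∑ i ∈ s, b i ∧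
      s.card / B ≤ ∑ i ∈ s, 1 / b i := by
  have hc : (0 : ℝ) < s.card := Nat.cast_pos.2 hs.card_pos
  have hprod : 0 < ∏ i ∈ s, b i := Finset.prod_pos hb
  have amgm : ∀ c : ι → ℝ, (∀ i ∈ s, 0 < c i) →
      s.card * (∏ i ∈ s, c i) ^ (1 / (s.card : ℝ)) ≤ ∑ i ∈ s, c i := by
    intro c hcpos
    have := Real.geom_mean_le_arith_mean_weighted s (fun _ => 1 / (s.card : ℝ)) c
      (fun i _ => by positivity) (by simp [hc.ne']) (fun i hi => (hcpos i hi).le)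
    rw [Real.finsetProd_rpow s c (fun i hi => (hcpos i hi).le), ← Finset.mul_sum] at this
    calc _ ≤ s.card * (1 / (s.card : ℝ) * ∑ i ∈ s, c i) := mul_le_mul_of_nonneg_left this hc.le
      _ = _ := by field_simp
  refine ⟨(∏ i ∈ s, b i) ^ (1 / (s.card : ℝ)), Real.rpow_pos_of_pos hprod _, ?_, amgm b hb, ?_⟩
  · rw [← Real.rpow_natCast, ← Real.rpow_mul hprod.le]
    simp [hc.ne']
  · have := amgm (fun i => 1 / b i) (fun i hi => one_div_pos.2 (hb i hi))
    refine le_trans (le_of_eq ?_) this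
    have h1 : ∏ i ∈ s, 1 / b i = (∏ i ∈ s, b i)⁻¹ := by simp
    rw [h1, Real.inv_rpow hprod.le, div_eq_mul_inv]

/-- Cauchy-Schwarz removes the square roots. The remaining sum is affine in ∑ b and ∑ 1/b and
nonincreasing in both, so equal messages B are the worst case. -/
theorem sum_sqrt_msgSens_le (hp : 0 ≤ p) (hp1 : p < 1) {ι : Type*} (s : Finset ι) (b : ι → ℝ)
    (hb : ∀ i ∈ s, p ≤ b i ∧ b i ≤ 1) {B : ℝ} (hB : s.card * B ≤ ∑ i ∈ s, b i)
    (hB' : s.card / B ≤ ∑ i ∈ s, 1 / b i) :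
    (∑ i ∈ s, √(msgSens p (b i))) ^ 2 ≤ (s.card : ℝ) ^ 2 * msgSens p B := by
  have h1 : (∑ i ∈ s, √(msgSens p (b i))) ^ 2 ≤ s.card * ∑ i ∈ s, msgSens p (b i) := by
    have := sq_sum_le_card_mul_sum_sq (s := s) (f := fun i => √(msgSens p (b i)))
    refine this.trans (le_of_eq ?_)
    congr 1
    exact Finset.sum_congr rfl fun i hi =>
      Real.sq_sqrt (msgSens_nonneg hp hp1 (hb i hi).1 (hb i hi).2)
  refine h1.trans ?_
  rw [pow_two, mul_assoc]
  refine mul_le_mul_of_nonneg_left ?_ (Nat.cast_nonneg _)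
  unfold msgSens
  rw [← Finset.sum_div, ← mul_div_assoc]
  refine div_le_div_of_nonneg_right ?_ (by linarith)
  rw [Finset.sum_sub_distrib, Finset.sum_sub_distrib, Finset.sum_const, nsmul_eq_mul]
  have h2 : ∑ i ∈ s, p / b i = p * ∑ i ∈ s, 1 / b i := by
    rw [Finset.mul_sum]
    exact Finset.sum_congr rfl fun i _ => by ring
  rw [h2]
  have h3 := mul_le_mul_of_nonneg_left hB' hp
  have h4 : s.card * (1 + p - B - p / B) = s.card * (1 + p) - s.card * B - p * (s.card / B) := by
    ring
  rw [h4]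
  linarith

/-- One-step contraction of the sensitivities in a system with decreased fields. -/
theorem contraction_of_field_le (hp : 0 ≤ p) (hp1 : p < 1) {ι : Type*} (s : Finset ι) (b : ι → ℝ)
    (hb : ∀ i ∈ s, p ≤ b i ∧ b i ≤ 1) {m₀ m z κ : ℝ} (hm : 0 ≤ m) (hm₀ : m ≤ m₀) (hz : 0 < z)
    (hfix : m₀ * msg p z ^ s.card = z) (hz1 : p * z ^ 2 ≤ 1) (hu : s.card * sens p z ≤ κ)
    (hκ : κ ≤ 1) :
    sens p (m * ∏ i ∈ s, b i) * (∑ i ∈ s, √(msgSens p (b i))) ^ 2 ≤ κ := by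
  have hκ0 : 0 ≤ κ := (mul_nonneg (Nat.cast_nonneg _) (sens_nonneg hp hp1 hz.le)).trans hu
  rcases s.eq_empty_or_nonempty with rfl | hs
  · simpa using hκ0
  -- A vanishing ratio, possible when m = 0 or p = 0, has sensitivity zero. Otherwise all messages
  -- are positive and have a geometric mean.
  by_cases hz0 : m * ∏ i ∈ s, b i = 0
  · rw [hz0, sens_zero, zero_mul]
    exact hκ0
  have hmpos : 0 < m := lt_of_le_of_ne hm (fun h => hz0 (by rw [← h, zero_mul]))
  have hbpos : ∀ i ∈ s, 0 < b i := fun i hi => lt_of_le_of_ne (hp.trans (hb i hi).1)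
    (fun h => hz0 (by rw [Finset.prod_eq_zero hi h.symm, mul_zero]))
  obtain ⟨B, hB0, hBprod, hBsum, hBinv⟩ := exists_geomMean s hs b hbpos
  have hc : (0 : ℝ) < s.card := Nat.cast_pos.2 hs.card_pos
  have hBp : p ≤ B := by
    have : p ^ s.card ≤ B ^ s.card := by
      rw [hBprod, ← Finset.prod_const]
      exact Finset.prod_le_prod (fun _ _ => hp) fun i hi => (hb i hi).1
    exact le_of_pow_le_pow_left₀ hs.card_pos.ne' hB0.le this
  have hB1 : B ≤ 1 := by
    have h := hBsum.trans (Finset.sum_le_sum fun i hi => (hb i hi).2)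
    simp only [Finset.sum_const, nsmul_eq_mul, mul_one] at h
    exact (mul_le_iff_le_one_right hc).1 h
  have hsum := sum_sqrt_msgSens_le hp hp1 s b hb hBsum hBinv
  rw [← hBprod]
  have hR : 0 ≤ sens p (m * B ^ s.card) := sens_nonneg hp hp1 (by positivity)
  refine (mul_le_mul_of_nonneg_left hsum hR).trans ?_
  obtain ⟨x, hx, hxz, hxfix⟩ := exists_fixedPoint_le hp hmpos hm₀ hz hfix
  have hxu : s.card * sens p x ≤ κ :=
    (mul_le_mul_of_nonneg_left (sens_mono hp hp1 hx.le hxz hz1) hc.le).trans hu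
  have hx1 : p * x ^ 2 ≤ 1 :=
    (mul_le_mul_of_nonneg_left (pow_le_pow_left₀ hx.le hxz 2) hp).trans hz1
  -- B = p and B = 1 are the messages of an infinite and of a zero ratio, where `msgSens` vanishes.
  -- Strictly in between, B is the message of (1 - B)/(B - p).
  rcases hBp.eq_or_lt with h | h
  · have : msgSens p B = 0 := by
      unfold msgSens
      rw [← h, div_self (h ▸ hB0.ne')]
      simp
    rw [this]
    simpa using hκ0
  rcases hB1.eq_or_lt with h1 | h1
  · have : msgSens p B = 0 := by
      unfold msgSens
      rw [h1]
      simp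
    rw [this]
    simpa using hκ0
  have hy : 0 < (1 - B) / (B - p) := div_pos (by linarith) (by linarith)
  have hyB : msg p ((1 - B) / (B - p)) = B := by
    have h2 : B - p ≠ 0 := by linarith
    have h3 : 1 - p ≠ 0 := by linarith
    unfold msg
    have h4 : 1 + (1 - B) / (B - p) = (1 - p) / (B - p) := by field_simp; ring
    have h5 : 1 + p * ((1 - B) / (B - p)) = B * (1 - p) / (B - p) := by field_simp; ring
    rw [h4, h5]
    field_simp
  have := univariate_contraction hp hp1 hmpos hx hxfix hx1 (hxu.trans hκ) hy
  rw [hyB, ← msgSens_msg hp hp1 hy.le, hyB] at this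
  linarith

/-- One-step contraction of the sensitivities in a system with increased fields. -/
theorem contraction_of_le_field (hp : 0 < p) (hp1 : p < 1) {ι : Type*} (s : Finset ι) (b : ι → ℝ)
    (hb : ∀ i ∈ s, p ≤ b i ∧ b i ≤ 1) {m₀ m z κ : ℝ} (hm₀0 : 0 < m₀) (hm₀ : m₀ ≤ m) (hz : 0 < z)
    (hfix : m₀ * msg p z ^ s.card = z) (hz1 : 1 ≤ p * z ^ 2) (hu : s.card * sens p z ≤ κ)
    (hκ : κ ≤ 1) :
    sens p (m * ∏ i ∈ s, b i) * (∑ i ∈ s, √(msgSens p (b i))) ^ 2 ≤ κ := by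
  have hm : 0 < m := hm₀0.trans_le hm₀
  have hbpos : ∀ i ∈ s, 0 < b i := fun i hi => hp.trans_le (hb i hi).1
  have hprod : 0 < ∏ i ∈ s, b i := Finset.prod_pos hbpos
  have hmsg := msg_pos hp.le hz.le
  -- Exchanging the spins sends a message b to p/b and a ratio y to 1/(py), hence the field m to
  -- 1/(m p^(d+1)) with d = #s. A lower bound on the field becomes an upper bound.
  have key := contraction_of_field_le hp.le hp1 s (fun i => p / b i)
    (fun i hi => ⟨by rw [le_div_iff₀ (hbpos i hi)]; nlinarith [(hb i hi).2],
      by rw [div_le_one (hbpos i hi)]; exact (hb i hi).1⟩)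
    (m₀ := 1 / (m₀ * p ^ (s.card + 1))) (m := 1 / (m * p ^ (s.card + 1)))
    (z := 1 / (p * z)) (κ := κ) (by positivity)
    (one_div_le_one_div_of_le (by positivity)
      (mul_le_mul_of_nonneg_right hm₀ (by positivity))) (by positivity)
    (by
      rw [msg_inv hp hz, div_pow]
      have : p * z = p * (m₀ * msg p z ^ s.card) := by rw [hfix]
      rw [this]
      field_simp
      ring)
    (by
      have : p * (1 / (p * z)) ^ 2 = 1 / (p * z ^ 2) := by field_simp
      rw [this]
      exact (div_le_one (by positivity)).2 hz1)
    (by rw [sens_inv hp hz]; exact hu) hκ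
  have h1 : 1 / (m * p ^ (s.card + 1)) * ∏ i ∈ s, p / b i = 1 / (p * (m * ∏ i ∈ s, b i)) := by
    rw [Finset.prod_div_distrib, Finset.prod_const]
    field_simp
    ring
  rw [h1, sens_inv hp (by positivity)] at key
  have h2 : ∑ i ∈ s, √(msgSens p (p / b i)) = ∑ i ∈ s, √(msgSens p (b i)) :=
    Finset.sum_congr rfl fun i hi => by rw [msgSens_inv hp (hbpos i hi)]
  rwa [h2] at key

end multivariate

/-! ### Consequences of uniqueness for the field -/

section field

variable {p : ℝ}

theorem field_eq (hp : 0 ≤ p) {d : ℕ} {m z : ℝ} (hz : 0 < z) (hfix : m * msg p z ^ d = z) :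
    m = z * ((1 + z) / (1 + p * z)) ^ d := by
  have h := msg_pos hp hz.le
  have h1 : (1 + z) / (1 + p * z) = (msg p z)⁻¹ := by
    unfold msg
    rw [inv_div]
  rw [h1, inv_pow, ← div_eq_mul_inv, eq_div_iff (pow_pos h d).ne']
  exact hfix

theorem mul_le_one_of_sq (hp : 0 ≤ p) (hp1 : p < 1) {z : ℝ} (hz : 0 < z) (hz1 : p * z ^ 2 ≤ 1) :
    p * z ≤ 1 := by
  have h : (p * z) ^ 2 ≤ 1 := by
    have : (p * z) ^ 2 = p * (p * z ^ 2) := by ring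
    rw [this]
    nlinarith
  nlinarith [mul_nonneg hp hz.le]

/-- An upper bound on the field in terms of the fixed point. -/
theorem field_mul_le (hp : 0 ≤ p) (hp1 : p < 1) {d : ℕ} (hd : 1 ≤ d) {m z A : ℝ} (hz : 0 < z)
    (hfix : m * msg p z ^ d = z) (hz1 : p * z ^ 2 ≤ 1) (hA : d * sens p z = A) :
    (1 - p) * m ≤ A / d * (2 * (1 + z) * Real.exp (A * (1 + z))) := by
  have hd0 : (0 : ℝ) < d := by exact_mod_cast hd
  have hpz := mul_le_one_of_sq hp hp1 hz hz1
  have hpz0 : 0 ≤ p * z := mul_nonneg hp hz.le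
  have hs := sens_nonneg hp hp1 hz.le
  have hA' : sens p z = A / d := by rw [← hA]; field_simp
  have hsz : (1 - p) * z = A / d * ((1 + p * z) * (1 + z)) := by
    rw [← hA']
    unfold sens
    field_simp
  -- The excess over 1 is sens p z * (1 + z), so the d-th power is at most exp (A (1 + z)).
  have h1 : (1 + z) / (1 + p * z) = 1 + A * (1 + z) / d := by
    have : A * (1 + z) / d = sens p z * (1 + z) := by rw [hA']; ring
    rw [this]
    unfold sens
    field_simp
    ring
  have hA0 : 0 ≤ A := hA ▸ mul_nonneg hd0.le hs
  have h2 : ((1 + z) / (1 + p * z)) ^ d ≤ Real.exp (A * (1 + z)) := by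
    rw [h1]
    have h3 : 1 + A * (1 + z) / d ≤ Real.exp (A * (1 + z) / d) := by
      rw [add_comm]; exact Real.add_one_le_exp _
    calc _ ≤ Real.exp (A * (1 + z) / d) ^ d := pow_le_pow_left₀ (by positivity) h3 d
      _ = _ := by rw [← Real.exp_nat_mul]; congr 1; field_simp
  rw [field_eq hp hz hfix, ← mul_assoc, hsz]
  have h4 : A / d * ((1 + p * z) * (1 + z)) ≤ A / d * (2 * (1 + z)) := by
    refine mul_le_mul_of_nonneg_left ?_ (by positivity)
    nlinarith
  calc _ ≤ A / d * (2 * (1 + z)) * Real.exp (A * (1 + z)) :=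
        mul_le_mul h4 h2 (by positivity) (by positivity)
    _ = _ := by ring

/-- From √p z ≤ 1 follows 1 + pz ≤ 1 + √p, and 1 - p factors as (1 - √p)(1 + √p). -/
theorem sens_ge_of_sq (hp : 0 ≤ p) (hp1 : p < 1) {z : ℝ} (hz : 0 < z) (hz1 : p * z ^ 2 ≤ 1) :
    (1 - √p) * z / (1 + z) ≤ sens p z ∧ √p * z ≤ 1 := by
  obtain ⟨q, hq, hqp⟩ : ∃ q : ℝ, q = √p ∧ p = q ^ 2 := ⟨√p, rfl, (Real.sq_sqrt hp).symm⟩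
  have hq0 : 0 ≤ q := hq ▸ Real.sqrt_nonneg p
  rw [← hq]
  have hqz : q * z ≤ 1 := by
    have h : (q * z) ^ 2 ≤ 1 := by rw [mul_pow, ← hqp]; exact hz1
    nlinarith [mul_nonneg hq0 hz.le]
  refine ⟨?_, hqz⟩
  unfold sens
  rw [hqp, div_le_div_iff₀ (by positivity) (by positivity)]
  have h1 : q ^ 2 * z ≤ q := by nlinarith
  have hq1 : q < 1 := by nlinarith
  have : 0 ≤ (1 - q) * z * (1 + z) * (q - q ^ 2 * z) :=
    mul_nonneg (mul_nonneg (mul_nonneg (by linarith) hz.le) (by linarith)) (by linarith)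
  nlinarith

/-- Uniqueness forces a small field, unless all sensitivities are small. -/
theorem field_bound (hp : 0 ≤ p) (hp1 : p < 1) {d : ℕ} (hd : 1 ≤ d) {m z : ℝ} (hz : 0 < z)
    (hfix : m * msg p z ^ d = z) (hz1 : p * z ^ 2 ≤ 1) (hu : d * sens p z ≤ 1) :
    (1 - √p) / (1 + √p) ≤ 2 / d ∨ (1 - p) * m ≤ 30 / d := by
  have hd0 : (0 : ℝ) < d := by exact_mod_cast hd
  -- For z ≤ 1 the exponent in `field_mul_le` is at most 2, and 4 * 7.5 = 30. For z > 1, sens p z ≥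
  -- (1 - √p)/2, so uniqueness forces 1 - √p ≤ 2/d.
  rcases le_or_gt z 1 with h | h
  · right
    have := field_mul_le hp hp1 hd hz hfix hz1 rfl
    refine this.trans ?_
    have hA0 : 0 ≤ d * sens p z := mul_nonneg hd0.le (sens_nonneg hp hp1 hz.le)
    have h1 : Real.exp (d * sens p z * (1 + z)) ≤ 7.5 := by
      calc _ ≤ Real.exp (2 : ℕ) := Real.exp_le_exp.2 (by push_cast; nlinarith)
        _ = Real.exp 1 ^ 2 := by rw [← Real.exp_nat_mul]; simp
        _ ≤ 2.7182818286 ^ 2 := pow_le_pow_left₀ (Real.exp_pos _).le Real.exp_one_lt_d9.le 2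
        _ ≤ 7.5 := by norm_num
    calc _ ≤ 1 / (d : ℝ) * (2 * (1 + 1) * 7.5) := by gcongr
      _ = _ := by ring
  · left
    obtain ⟨h1, -⟩ := sens_ge_of_sq hp hp1 hz hz1
    have hq0 := Real.sqrt_nonneg p
    have hq1 : √p < 1 := by rw [Real.sqrt_lt' one_pos]; simpa using hp1
    have h2 : (1 - √p) / (1 + √p) ≤ 1 - √p := div_le_self (by linarith) (by linarith)
    have h3 : (1 - √p) / 2 ≤ (1 - √p) * z / (1 + z) := by
      rw [div_le_div_iff₀ two_pos (by linarith)]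
      nlinarith
    refine h2.trans ?_
    rw [le_div_iff₀ hd0]
    nlinarith

/-- Under uniqueness with gap `δ`, the field shrunk by `δ ^ 2 / 64` has small sensitivities. -/
theorem sens_small_field (hp : 0 ≤ p) (hp1 : p < 1) {d : ℕ} (hd : 1 ≤ d) {m z δ r : ℝ}
    (hδ0 : 0 < δ) (hz : 0 < z)
    (hfix : m * msg p z ^ d = z) (hz1 : p * z ^ 2 ≤ 1) (hu : d * sens p z ≤ 1 - δ)
    (hr : 0 ≤ r) (hrm : r ≤ δ ^ 2 / 64 * m) :
    (d + 1) * sens p r ≤ 9 / 16 := by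
  have hd0 : (1 : ℝ) ≤ d := by exact_mod_cast hd
  have hs := sens_nonneg hp hp1 hz.le
  have hsr : sens p r ≤ (1 - p) * r := sens_le hp hp1 hr
  have hpz0 : 0 ≤ p * z := mul_nonneg hp hz.le
  obtain ⟨h1, h2⟩ := sens_ge_of_sq hp hp1 hz hz1
  have hq0 := Real.sqrt_nonneg p
  have hδ1 : δ ≤ 1 := by nlinarith
  have hratio : (1 + z) / (1 + p * z) ≤ 1 + z := div_le_self (by linarith) (by linarith)
  have hsr' : sens p r ≤ r := by nlinarith
  have hm := field_eq hp hz hfix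
  -- The three regimes d = 1; d ≥ 2 with z ≤ 2; and d ≥ 2 with z > 2 give bounds 3/16, about 0.42
  -- and about 0.52, all below 9/16.
  rcases hd.eq_or_lt with h | h
  · have hd1 : (d : ℝ) = 1 := by exact_mod_cast h.symm
    rw [hd1] at hu ⊢
    have hzδ : z ≤ 2 / δ := by
      rw [le_div_iff₀ hδ0]
      rw [div_le_iff₀ (by linarith)] at h1
      -- Either √p z ≤ 1 bounds z directly, or 1 - √p > 1 - δ/2 and comparing (1 - √p) z with (1 -
      -- δ)(1 + z) does.
      rcases le_or_gt (δ / 2) √p with h3 | h3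
      · nlinarith
      · nlinarith
    have hmz : m ≤ z * (1 + z) := by
      rw [hm, ← h, pow_one]
      exact mul_le_mul_of_nonneg_left hratio hz.le
    have hzδ' : z * δ ≤ 2 := (le_div_iff₀ hδ0).1 hzδ
    have : δ ^ 2 * m ≤ 6 := by
      have : δ ^ 2 * m ≤ δ ^ 2 * (z * (1 + z)) := mul_le_mul_of_nonneg_left hmz (by positivity)
      have h5 : 0 ≤ z * δ := by positivity
      nlinarith
    linarith
  · have hd2 : (2 : ℝ) ≤ d := by exact_mod_cast h
    rcases le_or_gt z 2 with h3 | h3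
    · have hb := field_mul_le hp hp1 hd hz hfix hz1 rfl
      set A := d * sens p z with hA
      have hA0 : 0 ≤ A := mul_nonneg (by linarith) hs
      have h4 : Real.exp (A * (1 + z)) ≤ 20.1 := by
        calc _ ≤ Real.exp (3 : ℕ) := Real.exp_le_exp.2 (by push_cast; nlinarith)
          _ = Real.exp 1 ^ 3 := by rw [← Real.exp_nat_mul]; simp
          _ ≤ 2.7182818286 ^ 3 := pow_le_pow_left₀ (Real.exp_pos _).le Real.exp_one_lt_d9.le 3
          _ ≤ 20.1 := by norm_num
      have h5 : (1 - p) * m ≤ A / d * (2 * (1 + 2) * 20.1) := by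
        refine hb.trans ?_
        gcongr
      -- Since δ ≤ 1 - A, the left side is at most (1 - A)² A, whose maximum on [0, 1] is 4/27, at A
      -- = 1/3.
      have h6 : δ ^ 2 * A ≤ 4 / 27 := by
        have : δ ^ 2 * A ≤ (1 - A) ^ 2 * A := by gcongr; linarith
        nlinarith [mul_nonneg hA0 (sq_nonneg (A - 1 / 3)), sq_nonneg (A - 1 / 3)]
      have h7 : (1 - p) * r ≤ δ ^ 2 / 64 * (A / d * (2 * (1 + 2) * 20.1)) := by
        calc (1 - p) * r ≤ (1 - p) * (δ ^ 2 / 64 * m) :=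
              mul_le_mul_of_nonneg_left hrm (by linarith)
          _ = δ ^ 2 / 64 * ((1 - p) * m) := by ring
          _ ≤ _ := mul_le_mul_of_nonneg_left h5 (by positivity)
      have h8 : (d + 1 : ℝ) * (A / d) ≤ 3 / 2 * A := by
        rw [mul_div_assoc', div_le_iff₀ (by linarith)]
        nlinarith
      calc (d + 1) * sens p r ≤ (d + 1) * (δ ^ 2 / 64 * (A / d * (2 * (1 + 2) * 20.1))) :=
            mul_le_mul_of_nonneg_left (hsr.trans h7) (by linarith)
        _ = δ ^ 2 / 64 * ((d + 1) * (A / d)) * (2 * (1 + 2) * 20.1) := by ring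
        _ ≤ δ ^ 2 / 64 * (3 / 2 * A) * (2 * (1 + 2) * 20.1) := by gcongr
        _ = δ ^ 2 * A * (3 / 2 / 64 * (2 * (1 + 2) * 20.1)) := by ring
        _ ≤ 4 / 27 * (3 / 2 / 64 * (2 * (1 + 2) * 20.1)) := by gcongr
        _ ≤ _ := by norm_num
    -- Here √p < 1/2 gives sens p z > 1/3, which leaves only d = 2. Then δ ≤ 1/3 and √p ≥ 1/4, so z
    -- ≤ 4 and m ≤ 4 * 5².
    · have hq2 : √p < 1 / 2 := by nlinarith
      rw [div_le_iff₀ (by linarith)] at h1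
      have h4 : (1 - √p) * 2 ≤ sens p z * 3 := by
        have h5 : 0 ≤ (1 - √p) * (z - 2) := mul_nonneg (by linarith) (by linarith)
        refine le_of_mul_le_mul_right (a := 1 + z) ?_ (by linarith)
        linarith
      have hdlt : d < 3 := by
        have h5 : 1 / 3 < sens p z := by linarith
        have : (d : ℝ) * (1 / 3) < 1 := by
          calc (d : ℝ) * (1 / 3) < d * sens p z := mul_lt_mul_of_pos_left h5 (by linarith)
            _ ≤ 1 := by linarith
        exact_mod_cast (by linarith : (d : ℝ) < 3)
      have hde : d = 2 := by omega
      subst hde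
      push_cast at hu ⊢
      have hδ3 : δ ≤ 1 / 3 := by linarith
      have hq4 : 1 / 4 ≤ √p := by linarith
      have hz4 : z ≤ 4 := by
        have := mul_le_mul_of_nonneg_right hq4 hz.le
        linarith
      have hmz : m ≤ 100 := by
        rw [hm]
        have : ((1 + z) / (1 + p * z)) ^ 2 ≤ (1 + 4) ^ 2 :=
          pow_le_pow_left₀ (by positivity) (hratio.trans (by linarith)) 2
        calc _ ≤ 4 * (1 + 4) ^ 2 := mul_le_mul hz4 this (by positivity) (by norm_num)
          _ = (100 : ℝ) := by norm_num
      have hm0 : 0 ≤ m := by rw [hm]; positivity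
      have : δ ^ 2 ≤ (1 / 3) ^ 2 := pow_le_pow_left₀ hδ0.le hδ3 2
      have : δ ^ 2 / 64 * m ≤ (1 / 3) ^ 2 / 64 * 100 := by gcongr
      linarith

end field

/-! ### Uniqueness in normalized form -/

/-- The good direction at a vertex of degree `D` is `+1`. -/
def PlusDir (β γ lam : ℝ) (D : ℕ) : Prop := β = 0 ∨ lam ≤ (γ / β) ^ ((D : ℝ) / 2)

section params

variable {β γ lam δ : ℝ}

theorem AntiFerro.mul_nonneg (h : AntiFerro β γ lam) : 0 ≤ β * γ :=
  _root_.mul_nonneg h.beta_nonneg h.gamma_pos.le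

/-- Squaring removes the half-integer exponent. The polynomial form also covers β = 0, where β^D = 0
because D ≥ 1. -/
theorem plusDir_iff (h : AntiFerro β γ lam) {D : ℕ} (hD : 1 ≤ D) :
    PlusDir β γ lam D ↔ lam ^ 2 * β ^ D ≤ γ ^ D := by
  unfold PlusDir
  rcases h.beta_nonneg.eq_or_lt with hβ | hβ
  · rw [← hβ]
    simp [show D ≠ 0 by omega, pow_nonneg h.gamma_pos.le D]
  have hγ := h.gamma_pos
  have hl := h.lam_pos
  have hx : 0 ≤ (γ / β) ^ ((D : ℝ) / 2) := by positivity
  have h2 : ((γ / β) ^ ((D : ℝ) / 2)) ^ 2 = γ ^ D / β ^ D := by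
    rw [← Real.rpow_natCast, ← Real.rpow_mul (by positivity)]
    rw [show (D : ℝ) / 2 * (2 : ℕ) = D by push_cast; ring, Real.rpow_natCast, div_pow]
  rw [← pow_le_pow_iff_left₀ hl.le hx two_ne_zero, h2, le_div_iff₀ (by positivity)]
  simp [hβ.ne']

theorem PlusDir.mono (h : AntiFerro β γ lam) {D D' : ℕ} (hD : 1 ≤ D) (hDD' : D ≤ D')
    (hp : PlusDir β γ lam D) : PlusDir β γ lam D' := by
  rw [plusDir_iff h hD] at hp
  rw [plusDir_iff h (hD.trans hDD')]
  obtain ⟨k, rfl⟩ := Nat.exists_eq_add_of_le hDD'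
  rw [pow_add, pow_add, ← mul_assoc]
  exact mul_le_mul hp (pow_le_pow_left₀ h.beta_nonneg h.beta_le_gamma k)
    (pow_nonneg h.beta_nonneg k) (pow_nonneg h.gamma_pos.le D)

theorem beta_pos_of_not_plusDir (h : AntiFerro β γ lam) {D : ℕ} (hp : ¬ PlusDir β γ lam D) :
    0 < β :=
  lt_of_le_of_ne h.beta_nonneg fun hb => hp (Or.inl hb.symm)

/-- The substitution x = γz absorbs γ into the field. At a fixed point the ordinary and the
logarithmic derivative of F_d agree, so F_d' = -d * sens. -/
theorem DUnique.normalized (h : AntiFerro β γ lam) {d : ℕ} (hd : DUnique β γ lam d δ) :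
    ∃ z, 0 < z ∧ lam / γ ^ (d + 1) * msg (β * γ) z ^ d = z ∧ d * sens (β * γ) z ≤ 1 - δ := by
  obtain ⟨x, hx, hfix, hder⟩ := hd
  have hγ := h.gamma_pos
  have hβ := h.beta_nonneg
  have hl := h.lam_pos
  obtain ⟨z, rfl⟩ : ∃ z, x = γ * z := ⟨x / γ, by field_simp⟩
  have hz : 0 < z := pos_of_mul_pos_right hx hγ.le
  have hmsg : (β * (γ * z) + 1) / (γ * z + γ) = msg (β * γ) z / γ := by
    unfold msg
    field_simp
    ring
  have hfix' : lam * (msg (β * γ) z / γ) ^ d = γ * z := by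
    rw [← hmsg]; exact hfix
  refine ⟨z, hz, ?_, ?_⟩
  · rw [div_pow] at hfix'
    rw [pow_succ]
    field_simp at hfix' ⊢
    linarith
  · have hb : HasDerivAt (fun x : ℝ => (β * x + 1) / (x + γ))
        ((β * γ - 1) / (γ * z + γ) ^ 2) (γ * z) := by
      have := (((hasDerivAt_id (γ * z)).const_mul β).add_const 1).div
        ((hasDerivAt_id (γ * z)).add_const γ) (by simp; positivity)
      refine this.congr_deriv ?_
      simp
      field_simp
      ring
    have hF : HasDerivAt (treeRec β γ lam d) (-(d * sens (β * γ) z)) (γ * z) := by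
      refine ((hb.pow d).const_mul lam).congr_deriv ?_
      rcases d with _ | d
      · simp
      rw [hmsg]
      have h1 : lam * (msg (β * γ) z / γ) ^ d = γ * z / (msg (β * γ) z / γ) := by
        have : msg (β * γ) z / γ ≠ 0 := (div_pos (msg_pos h.mul_nonneg hz.le) hγ).ne'
        rw [eq_div_iff this, ← hfix']
        ring
      have h2 : lam * (((d + 1 : ℕ) : ℝ) * (msg (β * γ) z / γ) ^ (d + 1 - 1) *
          ((β * γ - 1) / (γ * z + γ) ^ 2)) = ((d + 1 : ℕ) : ℝ) *
          ((β * γ - 1) / (γ * z + γ) ^ 2) * (lam * (msg (β * γ) z / γ) ^ d) := by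
        rw [Nat.add_sub_cancel]; ring
      rw [h2, h1]
      unfold msg sens
      have : 1 + β * γ * z ≠ 0 := by positivity
      field_simp
      ring
    rw [hF.deriv, abs_neg] at hder
    exact (le_abs_self _).trans hder

/-- With t = (1 + z)/(1 + pz), m² p^(d+1) = (pz²)(pt²)^d. Since (1 + pz)² - p(1 + z)² = (1 - p)(1 -
pz²), both pz² and pt² lie on the same side of 1, hence so does the product. The converse direction
below uses the same identity. -/
theorem fixedPoint_sq_le_one {p : ℝ} (hp : 0 ≤ p) (hp1 : p < 1) {d : ℕ} {m z : ℝ} (hz : 0 < z)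
    (hfix : m * msg p z ^ d = z) (hm : m ^ 2 * p ^ (d + 1) ≤ 1) : p * z ^ 2 ≤ 1 := by
  by_contra! hcon
  have h1 : 1 ≤ ((1 + z) / (1 + p * z)) ^ 2 * p := by
    rw [div_pow, div_mul_eq_mul_div, le_div_iff₀ (by positivity)]
    nlinarith
  have h2 : m ^ 2 * p ^ (d + 1) = z ^ 2 * p * (((1 + z) / (1 + p * z)) ^ 2 * p) ^ d := by
    rw [field_eq hp hz hfix]
    generalize (1 + z) / (1 + p * z) = t
    ring
  have := one_le_pow₀ h1 (n := d)
  rw [h2] at hm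
  nlinarith

theorem one_le_fixedPoint_sq {p : ℝ} (hp : 0 ≤ p) (hp1 : p < 1) {d : ℕ} {m z : ℝ} (hz : 0 < z)
    (hfix : m * msg p z ^ d = z) (hm : 1 < m ^ 2 * p ^ (d + 1)) : 1 ≤ p * z ^ 2 := by
  by_contra! hcon
  have h1 : ((1 + z) / (1 + p * z)) ^ 2 * p ≤ 1 := by
    rw [div_pow, div_mul_eq_mul_div, div_le_one (by positivity)]
    nlinarith
  have h2 : m ^ 2 * p ^ (d + 1) = z ^ 2 * p * (((1 + z) / (1 + p * z)) ^ 2 * p) ^ d := by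
    rw [field_eq hp hz hfix]
    generalize (1 + z) / (1 + p * z) = t
    ring
  have h3 := pow_le_one₀ (n := d) (by positivity) h1
  rw [h2] at hm
  nlinarith [mul_nonneg hp (sq_nonneg z)]

/-- A vertex of degree d + 1 has d children besides its parent. For its field, m² p^(d+1) ≤ 1 is
precisely the polynomial form of the good direction at degree d + 1. -/
theorem DUnique.exists_fixedPoint (h : AntiFerro β γ lam) {d : ℕ} (hd : DUnique β γ lam d δ) :
    ∃ z, 0 < z ∧ lam / γ ^ (d + 1) * msg (β * γ) z ^ d = z ∧ d * sens (β * γ) z ≤ 1 - δ ∧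
      (PlusDir β γ lam (d + 1) → β * γ * z ^ 2 ≤ 1) ∧
      (¬ PlusDir β γ lam (d + 1) → 1 ≤ β * γ * z ^ 2) := by
  obtain ⟨z, hz, hfix, hu⟩ := hd.normalized h
  have hγ := h.gamma_pos
  have heq : (lam / γ ^ (d + 1)) ^ 2 * (β * γ) ^ (d + 1) =
      lam ^ 2 * β ^ (d + 1) / γ ^ (d + 1) := by
    rw [mul_pow]; field_simp
  refine ⟨z, hz, hfix, hu, fun hpl => ?_, fun hpl => ?_⟩
  · refine fixedPoint_sq_le_one h.mul_nonneg h.beta_mul_gamma_lt_one hz hfix ?_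
    rw [heq, div_le_one (by positivity)]
    exact (plusDir_iff h (by omega)).1 hpl
  · refine one_le_fixedPoint_sq h.mul_nonneg h.beta_mul_gamma_lt_one hz hfix ?_
    rw [heq, one_lt_div (by positivity)]
    exact not_le.1 fun hle => hpl ((plusDir_iff h (by omega)).2 hle)

/-! ### Sensitivities of the vertices of a graph -/

open Classical in
/-- The set of allowed normalized fields at a vertex of degree `D`: those in the good direction
from `c * lam / γ ^ D`, where `c ≤ 1`. -/
def FieldOK (β γ lam c : ℝ) (D : ℕ) (m : ℝ) : Prop :=
  if PlusDir β γ lam D then 0 ≤ m ∧ c⁻¹ * m ≤ lam / γ ^ D else lam / γ ^ D ≤ c * m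

open Classical in
/-- The bound `cap D` on the sensitivity of a non-root vertex of degree `D`. -/
def cap (β γ lam : ℝ) (D : ℕ) : ℝ :=
  min ((1 - √(β * γ)) / (1 + √(β * γ)))
    ((1 - β * γ) * if PlusDir β γ lam D then lam / γ ^ D else 1 / (lam * β ^ D))

theorem sqrt_lt_one (h : AntiFerro β γ lam) : √(β * γ) < 1 := by
  rw [Real.sqrt_lt' one_pos]; simpa using h.beta_mul_gamma_lt_one

theorem cap_le_one (β γ lam : ℝ) (D : ℕ) : cap β γ lam D ≤ 1 := by
  refine (min_le_left _ _).trans ?_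
  have := Real.sqrt_nonneg (β * γ)
  rw [div_le_one (by linarith)]
  linarith

theorem cap_le_one_sub (h : AntiFerro β γ lam) (D : ℕ) : cap β γ lam D ≤ 1 - β * γ := by
  refine (min_le_left _ _).trans ?_
  have h0 := Real.sqrt_nonneg (β * γ)
  have h1 := sqrt_lt_one h
  have h2 := Real.sq_sqrt h.mul_nonneg
  rw [div_le_iff₀ (by linarith)]
  nlinarith

theorem cap_nonneg (h : AntiFerro β γ lam) (D : ℕ) : 0 ≤ cap β γ lam D := by
  have h0 := Real.sqrt_nonneg (β * γ)
  have h1 := sqrt_lt_one h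
  have h2 := h.beta_mul_gamma_lt_one
  have hβ := h.beta_nonneg
  have hγ := h.gamma_pos
  have hl := h.lam_pos
  refine le_min (div_nonneg (by linarith) (by linarith)) (_root_.mul_nonneg (by linarith) ?_)
  split_ifs <;> positivity

/-- In the direction +1 only r ≤ m is needed. In the direction -1 the mirrored bound needs r from
below: D - 1 messages, each at least p, give p * (λ/γ^D) * p^(D-1) = λβ^D. -/
theorem sens_le_cap (h : AntiFerro β γ lam) {D : ℕ} (hD : 1 ≤ D) {m : ℝ}
    (hm : FieldOK β γ lam 1 D m) {r : ℝ} (hr : m * (β * γ) ^ (D - 1) ≤ r) (hrm : r ≤ m) :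
    sens (β * γ) r ≤ cap β γ lam D := by
  have hp := h.mul_nonneg
  have hp1 := h.beta_mul_gamma_lt_one
  have hγ := h.gamma_pos
  have hl := h.lam_pos
  unfold FieldOK at hm
  have hm0 : 0 ≤ m := by
    split_ifs at hm
    · exact hm.1
    · have : 0 ≤ lam / γ ^ D := by positivity
      linarith
  have hr0 : 0 ≤ r := le_trans (by positivity) hr
  refine le_min (sens_le_sqrt hp hp1 hr0) ?_
  split_ifs at hm ⊢ with hpl
  · refine (sens_le hp hp1 hr0).trans (mul_le_mul_of_nonneg_left ?_ (by linarith))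
    linarith [hm.2]
  · have hβ := beta_pos_of_not_plusDir h hpl
    have hmpos : 0 < m := by
      have : 0 < lam / γ ^ D := by positivity
      linarith
    have hrpos : 0 < r := lt_of_lt_of_le (by positivity) hr
    refine (sens_le_inv (by positivity) hp1 hrpos).trans ?_
    rw [div_eq_mul_one_div]
    refine mul_le_mul_of_nonneg_left ?_ (by linarith)
    refine one_div_le_one_div_of_le (by positivity) ?_
    obtain ⟨d, rfl⟩ : ∃ d, D = d + 1 := ⟨D - 1, by omega⟩
    rw [Nat.add_sub_cancel] at hr
    calc lam * β ^ (d + 1) = β * γ * (lam / γ ^ (d + 1) * (β * γ) ^ d) := by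
          rw [mul_pow, pow_succ, pow_succ]; field_simp
      _ ≤ β * γ * (m * (β * γ) ^ d) := by
          rw [one_mul] at hm
          gcongr
      _ ≤ _ := by gcongr

/-- `field_bound` is applied at z in the direction +1, and otherwise at 1/(pz), whose field is
1/(λβ^D). The first alternative stays separate because it bounds the caps of all degrees at once. -/
theorem cap_or (h : AntiFerro β γ lam) {D : ℕ} (hD : 2 ≤ D)
    (hu : DUnique β γ lam (D - 1) δ) (hδ : 0 ≤ δ) :
    (1 - √(β * γ)) / (1 + √(β * γ)) ≤ 2 / (D - 1 : ℝ) ∨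
      (PlusDir β γ lam D ∧ (1 - β * γ) * (lam / γ ^ D) ≤ 30 / (D - 1 : ℝ)) ∨
      (¬ PlusDir β γ lam D ∧ (1 - β * γ) * (1 / (lam * β ^ D)) ≤ 30 / (D - 1 : ℝ)) := by
  obtain ⟨d, rfl⟩ : ∃ d, D = d + 1 := ⟨D - 1, by omega⟩
  rw [Nat.add_sub_cancel] at hu
  have hp := h.mul_nonneg
  have hp1 := h.beta_mul_gamma_lt_one
  have hγ := h.gamma_pos
  have hl := h.lam_pos
  have hcast : ((d + 1 : ℕ) : ℝ) - 1 = d := by push_cast; ring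
  rw [hcast]
  obtain ⟨z, hz, hfix, hu, hplus, hminus⟩ := hu.exists_fixedPoint h
  by_cases hpl : PlusDir β γ lam (d + 1)
  · rcases field_bound hp hp1 (d := d) (by omega) hz hfix (hplus hpl) (by linarith) with h1 | h1
    · exact Or.inl h1
    · exact Or.inr (Or.inl ⟨hpl, h1⟩)
  · have hβ := beta_pos_of_not_plusDir h hpl
    have hp' : 0 < β * γ := by positivity
    have hmsg := msg_pos hp hz.le
    have hfix' : 1 / (lam * β ^ (d + 1)) * msg (β * γ) (1 / (β * γ * z)) ^ d =
        1 / (β * γ * z) := by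
      rw [msg_inv hp' hz, div_pow]
      have : β * γ * z = β * γ * (lam / γ ^ (d + 1) * msg (β * γ) z ^ d) := by rw [hfix]
      rw [this]
      field_simp
      ring
    rcases field_bound hp hp1 (d := d) (by omega) (z := 1 / (β * γ * z)) (by positivity) hfix'
      (by
        have : β * γ * (1 / (β * γ * z)) ^ 2 = 1 / (β * γ * z ^ 2) := by field_simp
        rw [this]
        exact (div_le_one (by positivity)).2 (hminus hpl))
      (by rw [sens_inv hp' hz]; linarith) with h1 | h1
    · exact Or.inl h1
    · exact Or.inr (Or.inr ⟨hpl, h1⟩)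

theorem cap_le (h : AntiFerro β γ lam) {D : ℕ} (hD : 2 ≤ D)
    (hu : DUnique β γ lam (D - 1) δ) (hδ : 0 ≤ δ) : cap β γ lam D ≤ 30 / (D - 1 : ℝ) := by
  have hD' : (2 : ℝ) ≤ D := by exact_mod_cast hD
  unfold cap
  rcases cap_or h hD hu hδ with h1 | h1 | h1
  · refine (min_le_left _ _).trans (h1.trans ?_)
    exact div_le_div_of_nonneg_right (by norm_num) (by linarith)
  · rw [if_pos h1.1]
    exact (min_le_right _ _).trans h1.2
  · rw [if_neg h1.1]
    exact (min_le_right _ _).trans h1.2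

theorem cap_le_of_plusDir {D : ℕ} (hpl : PlusDir β γ lam D) :
    cap β γ lam D ≤ (1 - β * γ) * (lam / γ ^ D) := by
  unfold cap
  rw [if_pos hpl]
  exact min_le_right _ _

theorem cap_le_of_not_plusDir {D : ℕ} (hpl : ¬ PlusDir β γ lam D) :
    cap β γ lam D ≤ (1 - β * γ) * (1 / (lam * β ^ D)) := by
  unfold cap
  rw [if_neg hpl]
  exact min_le_right _ _

/-- If the bound for degree `E` comes from the good direction `-1`, then it dominates all smaller
degrees. -/
theorem cap_le_of_le_not_plusDir (h : AntiFerro β γ lam) (hβ1 : β ≤ 1) {D E : ℕ} (hD : 1 ≤ D)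
    (hDE : D ≤ E) (hE : ¬ PlusDir β γ lam E) {B : ℝ}
    (hB : (1 - β * γ) * (1 / (lam * β ^ E)) ≤ B) : cap β γ lam D ≤ B := by
  have hβ := beta_pos_of_not_plusDir h hE
  have hl := h.lam_pos
  refine (cap_le_of_not_plusDir fun hpl => hE (hpl.mono h hD hDE)).trans (le_trans ?_ hB)
  refine mul_le_mul_of_nonneg_left ?_ (by linarith [h.beta_mul_gamma_lt_one])
  refine one_div_le_one_div_of_le (by positivity) ?_
  exact mul_le_mul_of_nonneg_left (pow_le_pow_of_le_one hβ.le hβ1 hDE) hl.le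

/-- By monotonicity in the degree, the direction is -1 already at degree 1. -/
theorem lt_lam_sq_of_not_plusDir (h : AntiFerro β γ lam) {D : ℕ} (hD : 1 ≤ D)
    (hpl : ¬ PlusDir β γ lam D) : γ < lam ^ 2 * β := by
  by_contra! hcon
  exact hpl (PlusDir.mono h le_rfl hD ((plusDir_iff h le_rfl).2 (by simpa using hcon)))

/-- Two degrees occur because the vertex maximizing deg * √cap and the one maximizing √cap may
differ. If γ ≤ 1, uniqueness at the maximal degree Δ bounds every cap by O(1/Δ). If γ > 1 and the
direction is +1, the cap at E may be as large as a multiple of λ/γ; the product of fields λ²/γ^(D+1)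
is then compared with the squared field at half the degree, where uniqueness applies. -/
theorem cap_mul_cap_le (h : AntiFerro β γ lam) {Δ : ℕ} (hΔ : 3 ≤ Δ) (hδ : 0 ≤ δ)
    (hU : UpToUnique β γ lam Δ δ) {D E : ℕ} (hD : 1 ≤ D) (hDΔ : D ≤ Δ) (hE : 1 ≤ E)
    (hEΔ : E ≤ Δ) : (D : ℝ) ^ 2 * (cap β γ lam D * cap β γ lam E) ≤ 72 ^ 2 := by
  have hp := h.mul_nonneg
  have hp1 := h.beta_mul_gamma_lt_one
  have hγ := h.gamma_pos
  have hl := h.lam_pos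
  have hβ0 := h.beta_nonneg
  have hp1' : 0 ≤ 1 - β * γ := by linarith
  have hu : ∀ F, 2 ≤ F → F ≤ Δ → DUnique β γ lam (F - 1) δ := fun F h1 h2 =>
    hU (F - 1) (by omega) (by omega)
  have fin : ∀ B : ℝ, 0 ≤ B → cap β γ lam D ≤ B → cap β γ lam E ≤ B → D * B ≤ 72 →
      (D : ℝ) ^ 2 * (cap β γ lam D * cap β γ lam E) ≤ 72 ^ 2 := by
    intro B hB h1 h2 h3
    calc (D : ℝ) ^ 2 * (cap β γ lam D * cap β γ lam E) ≤ (D : ℝ) ^ 2 * (B * B) := by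
          gcongr
          exact cap_nonneg h E
      _ = (D * B) ^ 2 := by ring
      _ ≤ 72 ^ 2 := pow_le_pow_left₀ (by positivity) h3 2
  have hc2 : ∀ F : ℕ, cap β γ lam F ≤ (1 - √(β * γ)) / (1 + √(β * γ)) := fun F => min_le_left _ _
  rcases le_or_gt γ 1 with hγ1 | hγ1
  · have hΔ' : (3 : ℝ) ≤ Δ := by exact_mod_cast hΔ
    have hDR : (D : ℝ) ≤ Δ := by exact_mod_cast hDΔ
    have hall : ∀ F, 1 ≤ F → F ≤ Δ → cap β γ lam F ≤ 30 / (Δ - 1 : ℝ) := by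
      intro F hF hFΔ
      rcases cap_or h (by omega) (hu Δ (by omega) le_rfl) hδ with h1 | ⟨h1, h2⟩ | ⟨h1, h2⟩
      · refine (hc2 F).trans (h1.trans ?_)
        exact div_le_div_of_nonneg_right (by norm_num) (by linarith)
      · refine le_trans ?_ h2
        by_cases hpl : PlusDir β γ lam F
        · refine (cap_le_of_plusDir hpl).trans (mul_le_mul_of_nonneg_left ?_ hp1')
          exact div_le_div_of_nonneg_left hl.le (by positivity)
            (pow_le_pow_of_le_one hγ.le hγ1 hFΔ)
        -- The direction -1 at F gives λ²β > γ ≥ β, hence λ > 1 ≥ γ^Δ, and the trivial bound 1 - p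
        -- suffices.
        · refine (cap_le_one_sub h F).trans (le_mul_of_one_le_right hp1' ?_)
          rw [one_le_div (by positivity)]
          have h3 := lt_lam_sq_of_not_plusDir h hF hpl
          have hβ := beta_pos_of_not_plusDir h hpl
          have h4 : 1 < lam ^ 2 := by
            have := h.beta_le_gamma
            by_contra! hcon
            nlinarith
          exact (pow_le_one₀ hγ.le hγ1).trans (by nlinarith)
      · exact cap_le_of_le_not_plusDir h (h.beta_le_gamma.trans hγ1) hF hFΔ h1 h2
    refine fin _ (div_nonneg (by norm_num) (by linarith)) (hall D hD hDΔ) (hall E hE hEΔ) ?_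
    rw [mul_div_assoc', div_le_iff₀ (by linarith)]
    linarith
  · have hβ1 : β ≤ 1 := by nlinarith
    rcases le_or_gt D 72 with hD72 | hD72
    · refine fin 1 zero_le_one (cap_le_one β γ lam D) (cap_le_one β γ lam E) ?_
      rw [mul_one]
      exact_mod_cast hD72
    -- This choice gives 2(d + 1) ≤ D + 1 for the comparison of fields, and D ≤ 2d + 2 with d ≥ 36,
    -- so that 30 D ≤ 72 d.
    set d := (D - 1) / 2 with hd
    have hd36 : (36 : ℝ) ≤ d := by
      have : 36 ≤ d := by omega
      exact_mod_cast this
    have hDd : (D : ℝ) ≤ 2 * d + 2 := by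
      have : D ≤ 2 * d + 2 := by omega
      exact_mod_cast this
    have hcast : ((d + 1 : ℕ) : ℝ) - 1 = d := by push_cast; ring
    have hd0 : (0 : ℝ) < d := by linarith
    have hD30 : (D : ℝ) * (30 / d) ≤ 72 := by
      rw [mul_div_assoc', div_le_iff₀ hd0]
      linarith
    have := cap_or h (D := d + 1) (by omega) (hu (d + 1) (by omega) (by omega)) hδ
    rw [hcast] at this
    rcases this with h1 | ⟨h1, h2⟩ | ⟨h1, h2⟩
    · refine fin (2 / d) (by positivity) ((hc2 D).trans h1) ((hc2 E).trans h1) ?_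
      refine le_trans ?_ hD30
      gcongr
      norm_num
    · have hplD : PlusDir β γ lam D := h1.mono h (by omega) (by omega)
      have hcD := cap_le_of_plusDir hplD
      have hcE : cap β γ lam E ≤ (1 - β * γ) * (lam / γ) := by
        by_cases hpl : PlusDir β γ lam E
        · refine (cap_le_of_plusDir hpl).trans (mul_le_mul_of_nonneg_left ?_ hp1')
          exact div_le_div_of_nonneg_left hl.le hγ (le_self_pow₀ hγ1.le (by omega))
        · refine (cap_le_one_sub h E).trans (le_mul_of_one_le_right hp1' ?_)
          rw [one_le_div hγ]
          have h3 := lt_lam_sq_of_not_plusDir h hE hpl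
          have h4 : γ ^ 2 < lam ^ 2 := by
            have h5 : γ * γ < lam ^ 2 * β * γ := mul_lt_mul_of_pos_right h3 hγ
            have h6 : lam ^ 2 * (β * γ) ≤ lam ^ 2 := mul_le_of_le_one_right (sq_nonneg _) hp1.le
            linarith
          exact (lt_of_pow_lt_pow_left₀ 2 hl.le h4).le
      have hprod : cap β γ lam D * cap β γ lam E ≤ ((1 - β * γ) * (lam / γ ^ (d + 1))) ^ 2 := by
        calc cap β γ lam D * cap β γ lam E ≤
            ((1 - β * γ) * (lam / γ ^ D)) * ((1 - β * γ) * (lam / γ)) :=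
              mul_le_mul hcD hcE (cap_nonneg h E) (by positivity)
          _ = ((1 - β * γ) * lam) ^ 2 * (1 / γ ^ (D + 1)) := by rw [pow_succ]; field_simp; ring
          _ ≤ ((1 - β * γ) * lam) ^ 2 * (1 / γ ^ (2 * (d + 1))) := by
              gcongr
              · exact hγ1.le
              · omega
          _ = _ := by rw [pow_mul']; field_simp
      calc (D : ℝ) ^ 2 * (cap β γ lam D * cap β γ lam E) ≤
          (D : ℝ) ^ 2 * ((1 - β * γ) * (lam / γ ^ (d + 1))) ^ 2 := by gcongr
        _ ≤ (D : ℝ) ^ 2 * (30 / d) ^ 2 := by gcongr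
        _ = (D * (30 / d)) ^ 2 := by ring
        _ ≤ _ := pow_le_pow_left₀ (by positivity) hD30 2
    · have hall : ∀ F, 1 ≤ F → F ≤ Δ → cap β γ lam F ≤ 30 / d := by
        intro F hF hFΔ
        rcases le_or_gt F (d + 1) with hle | hgt
        · exact cap_le_of_le_not_plusDir h hβ1 hF hle h1 h2
        · refine (cap_le h (by omega) (hu F (by omega) hFΔ) hδ).trans ?_
          have : ((d + 1 : ℕ) : ℝ) ≤ F := by exact_mod_cast hgt.le
          refine div_le_div_of_nonneg_left (by norm_num) hd0 ?_
          push_cast at this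
          linarith
      exact fin _ (by positivity) (hall D hD hDΔ) (hall E hE hEΔ) hD30

/-- One-step contraction at a vertex of degree `#s + 1` whose field is in the good direction. -/
theorem FieldOK.contraction (h : AntiFerro β γ lam) {ι : Type*} (s : Finset ι) (b : ι → ℝ)
    (hb : ∀ i ∈ s, β * γ ≤ b i ∧ b i ≤ 1) {m : ℝ} (hm : FieldOK β γ lam 1 (s.card + 1) m)
    (hδ0 : 0 ≤ δ) (hδ1 : δ ≤ 1) (hu : s.Nonempty → DUnique β γ lam s.card δ) :
    sens (β * γ) (m * ∏ i ∈ s, b i) * (∑ i ∈ s, √(msgSens (β * γ) (b i))) ^ 2 ≤ 1 - δ := by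
  rcases s.eq_empty_or_nonempty with rfl | hs
  · simpa using hδ1
  obtain ⟨z, hz, hfix, hu, hplus, hminus⟩ := (hu hs).exists_fixedPoint h
  have hγ := h.gamma_pos
  have hl := h.lam_pos
  unfold FieldOK at hm
  split_ifs at hm with hpl
  · rw [inv_one, one_mul] at hm
    exact contraction_of_field_le h.mul_nonneg h.beta_mul_gamma_lt_one s b hb hm.1 hm.2 hz hfix
      (hplus hpl) hu (by linarith)
  · have hβ := beta_pos_of_not_plusDir h hpl
    rw [one_mul] at hm
    exact contraction_of_le_field (by positivity) h.beta_mul_gamma_lt_one s b hb (by positivity)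
      hm hz hfix (hminus hpl) hu (by linarith)

/-- In the direction -1 the small-field estimate is applied to the mirrored ratio 1/(pr): raising m
by 64/δ² shrinks the mirrored field by δ²/64. -/
theorem FieldOK.sens_small (h : AntiFerro β γ lam) {d : ℕ} (hd : 1 ≤ d) {m r : ℝ} (hδ0 : 0 < δ)
    (hm : FieldOK β γ lam (δ ^ 2 / 64) (d + 1) m) (hu : DUnique β γ lam d δ)
    (hr : m * (β * γ) ^ d ≤ r) (hrm : r ≤ m) : (d + 1) * sens (β * γ) r ≤ 9 / 16 := by
  obtain ⟨z, hz, hfix, hu, hplus, hminus⟩ := hu.exists_fixedPoint h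
  have hγ := h.gamma_pos
  have hl := h.lam_pos
  have hp := h.mul_nonneg
  have hp1 := h.beta_mul_gamma_lt_one
  unfold FieldOK at hm
  split_ifs at hm with hpl
  · have hr0 : 0 ≤ r := le_trans (_root_.mul_nonneg hm.1 (pow_nonneg hp d)) hr
    refine sens_small_field hp hp1 hd hδ0 hz hfix (hplus hpl) hu hr0 (hrm.trans ?_)
    exact (inv_mul_le_iff₀ (by positivity)).1 hm.2
  · have hβ := beta_pos_of_not_plusDir h hpl
    have hp' : 0 < β * γ := by positivity
    have hm0 : 0 < m := by
      have : 0 < δ ^ 2 / 64 * m := lt_of_lt_of_le (by positivity) hm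
      exact pos_of_mul_pos_right this (by positivity)
    have hr0 : 0 < r := lt_of_lt_of_le (by positivity) hr
    have hmsg := msg_pos hp hz.le
    rw [← sens_inv hp' hr0]
    refine sens_small_field hp hp1 hd hδ0 (z := 1 / (β * γ * z)) (m := 1 / (lam * β ^ (d + 1)))
      (by positivity) ?_ ?_ (by rw [sens_inv hp' hz]; exact hu) (by positivity) ?_
    · rw [msg_inv hp' hz, div_pow]
      have : β * γ * z = β * γ * (lam / γ ^ (d + 1) * msg (β * γ) z ^ d) := by rw [hfix]
      rw [this]
      field_simp
      ring
    · have : β * γ * (1 / (β * γ * z)) ^ 2 = 1 / (β * γ * z ^ 2) := by field_simp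
      rw [this]
      exact (div_le_one (by positivity)).2 (hminus hpl)
    · rw [mul_one_div, div_le_div_iff₀ (by positivity) (by positivity), one_mul]
      calc lam * β ^ (d + 1) = β * γ * (lam / γ ^ (d + 1) * (β * γ) ^ d) := by
            rw [mul_pow, pow_succ, pow_succ]; field_simp
        _ ≤ β * γ * (δ ^ 2 / 64 * m * (β * γ) ^ d) := by gcongr
        _ = δ ^ 2 / 64 * (β * γ * (m * (β * γ) ^ d)) := by ring
        _ ≤ _ := by gcongr

end params

/-! ### The soft hard-core model on a set of vertices -/

section model

variable {V : Type*} [Fintype V] [DecidableEq V] (G : SimpleGraph V) [DecidableRel G.Adj]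

/-- The number of edges with both endpoints in `S`. -/
def innerEdges (S : Finset V) : ℕ := (G.edgeFinset.filter (fun e => ∀ v ∈ e, v ∈ S)).card

theorem innerEdges_empty : innerEdges G ∅ = 0 := by
  unfold innerEdges
  rw [Finset.card_eq_zero, Finset.filter_eq_empty_iff]
  intro e _
  induction e with
  | _ a b =>
    intro h
    exact absurd (h a (by simp)) (by simp)

theorem innerEdges_insert {u : V} {S : Finset V} (hu : u ∉ S) :
    innerEdges G (insert u S) = innerEdges G S + (G.neighborFinset u ∩ S).card := by
  unfold innerEdges
  have hinj : Set.InjOn (fun v => s(u, v)) (G.neighborFinset u ∩ S : Finset V) := by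
    intro a _ b _ hab
    exact Sym2.congr_right.1 hab
  rw [← Finset.card_image_of_injOn hinj, ← Finset.card_union_of_disjoint]
  · congr 1
    ext e
    induction e with
    | _ a b =>
      simp only [Finset.mem_filter, SimpleGraph.mem_edgeFinset, SimpleGraph.mem_edgeSet,
        Sym2.mem_iff, forall_eq_or_imp, forall_eq, Finset.mem_insert, Finset.mem_union,
        Finset.mem_image, Finset.mem_inter, SimpleGraph.mem_neighborFinset, Sym2.eq_iff]
      constructor
      · rintro ⟨hab, rfl | ha, rfl | hb⟩
        · exact absurd hab (G.loopless.irrefl _)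
        · exact Or.inr ⟨b, ⟨hab, hb⟩, Or.inl ⟨rfl, rfl⟩⟩
        · exact Or.inr ⟨a, ⟨hab.symm, ha⟩, Or.inr ⟨rfl, rfl⟩⟩
        · exact Or.inl ⟨hab, ha, hb⟩
      · rintro (⟨hab, ha, hb⟩ | ⟨c, ⟨hc, hcS⟩, ⟨rfl, rfl⟩ | ⟨rfl, rfl⟩⟩)
        · exact ⟨hab, Or.inr ha, Or.inr hb⟩
        · exact ⟨hc, Or.inl rfl, Or.inr hcS⟩
        · exact ⟨hc.symm, Or.inr hcS, Or.inl rfl⟩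
  · rw [Finset.disjoint_left]
    intro e he he'
    obtain ⟨v, -, rfl⟩ := Finset.mem_image.1 he'
    exact hu ((Finset.mem_filter.1 he).2 u (by simp))

/-- The weight of the configuration with set `S` of `+1` spins, for the fields `m`. -/
def wt (p : ℝ) (m : V → ℝ) (S : Finset V) : ℝ := p ^ innerEdges G S * ∏ v ∈ S, m v

/-- The fields `m`, multiplied by `p` on `T`. -/
def dampOn (p : ℝ) (m : V → ℝ) (T : Finset V) : V → ℝ := fun v => if v ∈ T then p * m v else m v

/-- The sum of `f` over the configurations on `U`. -/
def psum (p : ℝ) (m : V → ℝ) (U : Finset V) (f : Finset V → ℝ) : ℝ :=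
  ∑ S ∈ U.powerset, wt G p m S * f S

/-- The partition function. -/
def part (p : ℝ) (m : V → ℝ) (U : Finset V) : ℝ := psum G p m U fun _ => 1

/-- The probability that `v` has spin `+1`. -/
def marg (p : ℝ) (m : V → ℝ) (U : Finset V) (v : V) : ℝ :=
  (psum G p m U fun S => if v ∈ S then 1 else 0) / part G p m U

/-- The ratio of the probabilities of the spins of `u` in the model on `insert u U`. -/
def ratio (p : ℝ) (m : V → ℝ) (U : Finset V) (u : V) : ℝ :=
  m u * (part G p (dampOn p m (G.neighborFinset u)) U / part G p m U)

/-- The influence of `u` on `v ∈ U` in the model on `insert u U`. -/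
def infl (p : ℝ) (m : V → ℝ) (U : Finset V) (u v : V) : ℝ :=
  marg G p (dampOn p m (G.neighborFinset u)) U v - marg G p m U v

/-- The total weighted influence of `u` in the model on `insert u U`. -/
def totalInfl (p : ℝ) (w : V → ℝ) (m : V → ℝ) (U : Finset V) (u : V) : ℝ :=
  w u + ∑ v ∈ U, w v * |infl G p m U u v|

variable {G} {p : ℝ} {m : V → ℝ}

omit [Fintype V] in
theorem dampOn_nonneg (hp : 0 ≤ p) (hm : ∀ v, 0 ≤ m v) (T : Finset V) (v : V) :
    0 ≤ dampOn p m T v := by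
  unfold dampOn
  split_ifs
  · exact mul_nonneg hp (hm v)
  · exact hm v

theorem wt_empty : wt G p m ∅ = 1 := by simp [wt, innerEdges_empty]

theorem wt_nonneg (hp : 0 ≤ p) (hm : ∀ v, 0 ≤ m v) (S : Finset V) : 0 ≤ wt G p m S :=
  mul_nonneg (pow_nonneg hp _) (Finset.prod_nonneg fun v _ => hm v)

theorem wt_congr {m' : V → ℝ} {S : Finset V} (h : ∀ v ∈ S, m v = m' v) :
    wt G p m S = wt G p m' S := by
  unfold wt
  rw [Finset.prod_congr rfl h]

/-- Giving u the spin +1 leaves a model of the same kind in which each neighbor of u pays one more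
factor p; conditioning only changes fields. -/
theorem wt_insert {u : V} {S : Finset V} (hu : u ∉ S) :
    wt G p m (insert u S) = m u * wt G p (dampOn p m (G.neighborFinset u)) S := by
  have : ∏ v ∈ S, dampOn p m (G.neighborFinset u) v =
      p ^ (G.neighborFinset u ∩ S).card * ∏ v ∈ S, m v := by
    have h : ∀ v ∈ S, dampOn p m (G.neighborFinset u) v =
        (if v ∈ G.neighborFinset u then p else 1) * m v := by
      intro v _
      unfold dampOn
      split_ifs <;> simp
    rw [Finset.prod_congr rfl h, Finset.prod_mul_distrib, Finset.prod_ite, Finset.prod_const,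
      Finset.prod_const_one, mul_one, Finset.filter_mem_eq_inter, Finset.inter_comm]
  unfold wt
  rw [this, innerEdges_insert G hu, Finset.prod_insert hu, pow_add]
  ring

theorem psum_congr {m' : V → ℝ} {U : Finset V} (h : ∀ v ∈ U, m v = m' v)
    (f : Finset V → ℝ) : psum G p m U f = psum G p m' U f :=
  Finset.sum_congr rfl fun S hS => by
    rw [wt_congr fun v hv => h v (Finset.mem_powerset.1 hS hv)]

theorem psum_insert {u : V} {U : Finset V} (hu : u ∉ U) (f : Finset V → ℝ) :
    psum G p m (insert u U) f = psum G p m U f +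
      m u * psum G p (dampOn p m (G.neighborFinset u)) U fun S => f (insert u S) := by
  unfold psum
  rw [Finset.sum_powerset_insert hu, Finset.mul_sum]
  congr 1
  refine Finset.sum_congr rfl fun S hS => ?_
  rw [wt_insert fun h => hu (Finset.mem_powerset.1 hS h), mul_assoc]

theorem part_pos (hp : 0 ≤ p) (hm : ∀ v, 0 ≤ m v) (U : Finset V) : 0 < part G p m U := by
  unfold part psum
  refine lt_of_lt_of_le one_pos ?_
  have := Finset.single_le_sum (f := fun S => wt G p m S * 1)
    (fun S _ => by simpa using wt_nonneg hp hm S) (Finset.empty_mem_powerset U)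
  simpa [wt_empty] using this

theorem ratio_nonneg (hp : 0 ≤ p) (hm : ∀ v, 0 ≤ m v) (U : Finset V) (u : V) :
    0 ≤ ratio G p m U u :=
  mul_nonneg (hm u) (div_nonneg (part_pos hp (dampOn_nonneg hp hm _) U).le (part_pos hp hm U).le)

/-- A and C are the total weight and the weight of the event when the vertex has spin -1, B and D
those when it has spin +1, and x is its field. Both quotients are mixtures of C/A and D/B, and
damping x by p shifts the mixing weight by `sens`. -/
theorem marg_diff_aux {A B C D x : ℝ} (hA : 0 < A) (hB : 0 < B) (hx : 0 ≤ x) (hp : 0 ≤ p) :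
    (C + p * x * D) / (A + p * x * B) - (C + x * D) / (A + x * B) =
      -(sens p (x * (B / A)) * (D / B - C / A)) := by
  unfold sens
  have h1 : 0 < A + p * x * B := by positivity
  have h2 : 0 < A + x * B := by positivity
  have h3 : 1 + p * (x * (B / A)) = (A + p * x * B) / A := by field_simp
  have h4 : 1 + x * (B / A) = (A + x * B) / A := by field_simp
  rw [h3, h4]
  field_simp
  ring

/-- Multiplying the field of one vertex `a` by `p`. -/
theorem damp_one (hp : 0 ≤ p) (hm : ∀ v, 0 ≤ m v) {m' : V → ℝ} {a : V} {W : Finset V}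
    (ha : a ∉ W) (hm' : ∀ v ∈ W, m' v = m v) (hma : m' a = p * m a) {w : V → ℝ} :
    part G p m' (insert a W) = part G p m (insert a W) * msg p (ratio G p m W a) ∧
    ∑ v ∈ insert a W, w v * |marg G p m' (insert a W) v - marg G p m (insert a W) v| =
      |sens p (ratio G p m W a)| * totalInfl G p w m W a := by
  set N := G.neighborFinset a
  have hA := part_pos (G := G) hp hm W
  have hB := part_pos (G := G) hp (dampOn_nonneg hp hm N) W
  have hx := hm a
  have hsum : ∀ f, psum G p m' (insert a W) f = psum G p m W f +
      p * m a * psum G p (dampOn p m N) W fun S => f (insert a S) := by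
    intro f
    rw [psum_insert ha, hma, psum_congr hm']
    congr 2
    refine psum_congr (fun v hv => ?_) _
    simp only [dampOn, hm' v hv, N]
  have hpart' : part G p m' (insert a W) = part G p m W + p * m a * part G p (dampOn p m N) W :=
    hsum _
  have hpart : part G p m (insert a W) = part G p m W + m a * part G p (dampOn p m N) W :=
    psum_insert ha _
  have hdiff : ∀ v ∈ W, marg G p m' (insert a W) v - marg G p m (insert a W) v =
      -(sens p (ratio G p m W a) * infl G p m W a v) := by
    intro v hv
    have hva : v ≠ a := fun h => ha (h ▸ hv)
    have h1 : ∀ S : Finset V, (if v ∈ insert a S then (1 : ℝ) else 0) = if v ∈ S then 1 else 0 := by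
      intro S
      simp [hva]
    unfold marg infl ratio marg
    rw [hpart', hpart, hsum, psum_insert ha]
    simp only [h1]
    exact marg_diff_aux hA hB hx hp
  have hdiffa : marg G p m' (insert a W) a - marg G p m (insert a W) a =
      -(sens p (ratio G p m W a) * 1) := by
    have h1 : ∀ S : Finset V, (if a ∈ insert a S then (1 : ℝ) else 0) = 1 := by simp
    have h0 : (psum G p m W fun S => if a ∈ S then (1 : ℝ) else 0) = 0 := by
      refine Finset.sum_eq_zero fun S hS => ?_
      have h2 : a ∉ S := fun h => ha (Finset.mem_powerset.1 hS h)
      simp [h2]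
    have h2 := marg_diff_aux (C := 0) (D := part G p (dampOn p m N) W) hA hB hx hp
    rw [zero_div, sub_zero, div_self hB.ne'] at h2
    unfold marg
    rw [hpart', hpart, hsum, psum_insert ha]
    simp only [h1, h0]
    exact h2
  constructor
  · rw [hpart', hpart]
    unfold msg ratio
    have h2 : 0 < part G p m W + m a * part G p (dampOn p m N) W := by positivity
    have h4 : 1 + m a * (part G p (dampOn p m N) W / part G p m W) =
      (part G p m W + m a * part G p (dampOn p m N) W) / part G p m W := by field_simp
    rw [h4]
    field_simp
    rfl
  · rw [Finset.sum_insert ha, hdiffa]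
    unfold totalInfl
    rw [mul_add, Finset.mul_sum]
    congr 1
    · rw [mul_one, abs_neg, mul_comm]
    · refine Finset.sum_congr rfl fun v hv => ?_
      rw [hdiff v hv, abs_neg, abs_mul]
      ring

/-- Multiplying the fields on `T` by `p`, one vertex at a time. -/
theorem damp_many (hp : 0 ≤ p) (hp1 : p < 1) (hm : ∀ v, 0 ≤ m v) {w : V → ℝ}
    (hw : ∀ v, 0 ≤ w v) {K : ℝ} {U : Finset V} (T : Finset V) (hT : T ⊆ U)
    (H : ∀ T' ⊆ T, ∀ a ∈ T, a ∉ T' → totalInfl G p w (dampOn p m T') (U.erase a) a *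
      √(sens p (ratio G p (dampOn p m T') (U.erase a) a)) ≤ K) :
    ∃ x : V → ℝ, (∀ a ∈ T, 0 ≤ x a ∧
        ∃ T' ⊆ T, a ∉ T' ∧ x a = ratio G p (dampOn p m T') (U.erase a) a) ∧
      part G p (dampOn p m T) U = part G p m U * ∏ a ∈ T, msg p (x a) ∧
      ∑ v ∈ U, w v * |marg G p (dampOn p m T) U v - marg G p m U v| ≤
        K * ∑ a ∈ T, √(sens p (x a)) := by
  induction T using Finset.induction_on with
  | empty =>
    have : dampOn p m ∅ = m := by ext v; simp [dampOn]
    exact ⟨fun _ => 0, by simp, by simp [this], by simp [this]⟩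
  | insert a T haT ih =>
    obtain ⟨x, hx, hpart, hsum⟩ := ih ((Finset.subset_insert a T).trans hT)
      fun T' hT' c hc hcT' => H T' (hT'.trans (Finset.subset_insert a T)) c
        (Finset.mem_insert_of_mem hc) hcT'
    have haU : a ∈ U := hT (Finset.mem_insert_self a T)
    set mT := dampOn p m T with hmT
    have hmT0 : ∀ v, 0 ≤ mT v := dampOn_nonneg hp hm T
    set r := ratio G p mT (U.erase a) a with hr
    have hr0 : 0 ≤ r := ratio_nonneg hp hmT0 _ _
    obtain ⟨h1, h2⟩ := damp_one (G := G) hp hmT0 (m' := dampOn p m (insert a T)) (w := w)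
      (Finset.notMem_erase a U)
      (fun v hv => by
        have : v ≠ a := Finset.ne_of_mem_erase hv
        simp [hmT, dampOn, this])
      (by simp [hmT, dampOn, haT])
    rw [Finset.insert_erase haU] at h1 h2
    have hxup : ∀ c ∈ T, Function.update x a r c = x c := fun c hc =>
      Function.update_of_ne (by rintro rfl; exact haT hc) _ _
    refine ⟨Function.update x a r, ?_, ?_, ?_⟩
    · intro c hc
      rcases Finset.mem_insert.1 hc with rfl | hc
      · rw [Function.update_self]
        exact ⟨hr0, T, Finset.subset_insert c T, haT, rfl⟩
      · rw [hxup c hc]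
        obtain ⟨h3, T', hT', h4⟩ := hx c hc
        exact ⟨h3, T', hT'.trans (Finset.subset_insert a T), h4⟩
    · rw [h1, hpart, Finset.prod_insert haT, Function.update_self]
      rw [Finset.prod_congr rfl fun c hc => congrArg (msg p) (hxup c hc)]
      ring
    · rw [Finset.sum_insert haT, Function.update_self]
      rw [Finset.sum_congr rfl fun c hc => congrArg (fun y => √(sens p y)) (hxup c hc)]
      -- One factor √sens is spent on the hypothesis that gives K; the other stays in the sum over
      -- the children.
      have h3 : |sens p r| * totalInfl G p w mT (U.erase a) a ≤ K * √(sens p r) := by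
        have h4 := H T (Finset.subset_insert a T) a (Finset.mem_insert_self a T) haT
        have h5 := sens_nonneg hp hp1 hr0
        rw [abs_of_nonneg h5]
        calc sens p r * totalInfl G p w mT (U.erase a) a
            = (totalInfl G p w mT (U.erase a) a * √(sens p r)) * √(sens p r) := by
              rw [mul_assoc, Real.mul_self_sqrt h5, mul_comm]
          _ ≤ _ := mul_le_mul_of_nonneg_right h4 (Real.sqrt_nonneg _)
      have h6 : ∑ v ∈ U, w v * |marg G p (dampOn p m (insert a T)) U v - marg G p m U v| ≤
          ∑ v ∈ U, w v * |marg G p (dampOn p m (insert a T)) U v - marg G p mT U v| +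
          ∑ v ∈ U, w v * |marg G p mT U v - marg G p m U v| := by
        rw [← Finset.sum_add_distrib]
        refine Finset.sum_le_sum fun v _ => ?_
        rw [← mul_add]
        exact mul_le_mul_of_nonneg_left (abs_sub_le _ _ _) (hw v)
      rw [h2] at h6
      linarith

/-- The contraction property of a vertex with neighbors `s` (excluding its parent) and field `ℓ`:
it holds for all possible messages of the neighbors. -/
def Contracts (p κ g : ℝ) (s : Finset V) (ℓ : ℝ) : Prop :=
  ∀ b : V → ℝ, (∀ v ∈ s, p ≤ b v ∧ b v ≤ 1) →
    √(sens p (ℓ * ∏ v ∈ s, b v)) * ∑ v ∈ s, √(msgSens p (b v)) ≤ κ ∧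
      √(sens p (ℓ * ∏ v ∈ s, b v)) ≤ g

-- A removed neighbor behaves like one sending a constant message: p if its spin is +1 (the set J),
-- 1 otherwise. Since `Contracts` quantifies over all messages in [p, 1], it passes to every such
-- submodel.
omit [Fintype V] in
theorem Contracts.restrict (hp1 : p < 1) {κ g ℓ : ℝ} {s t J : Finset V}
    (h : Contracts p κ g s ℓ) (ht : t ⊆ s) (hJ : J ⊆ s) (htJ : Disjoint t J) :
    Contracts p κ g t (p ^ J.card * ℓ) := by
  intro b hb
  set c : V → ℝ := fun v => if v ∈ t then b v else if v ∈ J then p else 1 with hc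
  have hcs : ∀ v ∈ s, p ≤ c v ∧ c v ≤ 1 := by
    intro v _
    simp only [hc]
    split_ifs with h1 h2
    · exact hb v h1
    · exact ⟨le_rfl, hp1.le⟩
    · exact ⟨hp1.le, le_rfl⟩
  have hct : ∀ v ∈ t, c v = b v := fun v hv => by simp only [hc, if_pos hv]
  have hprod : ℓ * ∏ v ∈ s, c v = p ^ J.card * ℓ * ∏ v ∈ t, b v := by
    rw [← Finset.prod_sdiff ht, Finset.prod_congr rfl hct]
    have : ∏ v ∈ s \ t, c v = p ^ J.card := by
      have hJs : J ⊆ s \ t := fun v hv => Finset.mem_sdiff.2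
        ⟨hJ hv, fun h => (Finset.disjoint_left.1 htJ h hv)⟩
      rw [← Finset.prod_sdiff hJs, Finset.prod_eq_one, one_mul, ← Finset.prod_const]
      · refine Finset.prod_congr rfl fun v hv => ?_
        simp only [hc, if_neg (Finset.disjoint_right.1 htJ hv), if_pos hv]
      · intro v hv
        rw [Finset.mem_sdiff, Finset.mem_sdiff] at hv
        simp only [hc, if_neg hv.1.2, if_neg hv.2]
    rw [this]
    ring
  obtain ⟨h1, h2⟩ := h c hcs
  rw [hprod] at h1 h2
  refine ⟨le_trans (mul_le_mul_of_nonneg_left ?_ (Real.sqrt_nonneg _)) h1, h2⟩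
  rw [← Finset.sum_congr rfl fun v hv => congrArg (fun y => √(msgSens p y)) (hct v hv)]
  exact Finset.sum_le_sum_of_subset_of_nonneg ht fun _ _ _ => Real.sqrt_nonneg _

/-- The ratio at `u` and the total influence of `u` in terms of the children of `u`. -/
theorem exists_children (hp : 0 ≤ p) (hp1 : p < 1) (hm : ∀ v, 0 ≤ m v) {w : V → ℝ}
    (hw : ∀ v, 0 ≤ w v) {K : ℝ} {U : Finset V} {u : V}
    (H : ∀ T' ⊆ G.neighborFinset u ∩ U, ∀ a ∈ G.neighborFinset u ∩ U, a ∉ T' →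
      totalInfl G p w (dampOn p m T') (U.erase a) a *
      √(sens p (ratio G p (dampOn p m T') (U.erase a) a)) ≤ K) :
    ∃ x : V → ℝ, (∀ a ∈ G.neighborFinset u ∩ U, 0 ≤ x a ∧ ∃ T' ⊆ G.neighborFinset u ∩ U,
        a ∉ T' ∧ x a = ratio G p (dampOn p m T') (U.erase a) a) ∧
      ratio G p m U u = m u * ∏ a ∈ G.neighborFinset u ∩ U, msg p (x a) ∧
      totalInfl G p w m U u ≤ w u + K * ∑ a ∈ G.neighborFinset u ∩ U, √(sens p (x a)) := by
  obtain ⟨x, hx, hpart, hsum⟩ := damp_many hp hp1 hm hw (G.neighborFinset u ∩ U)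
    Finset.inter_subset_right H
  have hcongr : ∀ f, psum G p (dampOn p m (G.neighborFinset u)) U f =
      psum G p (dampOn p m (G.neighborFinset u ∩ U)) U f := fun f =>
    psum_congr (fun v hv => by simp [dampOn, hv]) f
  refine ⟨x, hx, ?_, ?_⟩
  · unfold ratio
    rw [show part G p (dampOn p m (G.neighborFinset u)) U =
      part G p (dampOn p m (G.neighborFinset u ∩ U)) U from hcongr _, hpart,
      mul_div_cancel_left₀ _ (part_pos hp hm U).ne']
  · unfold totalInfl
    refine add_le_add le_rfl (le_trans (le_of_eq ?_) hsum)
    refine Finset.sum_congr rfl fun v _ => ?_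
    unfold infl marg part
    rw [hcongr, hcongr]

omit [Fintype V] [DecidableEq V] in
theorem sum_sqrt_sens_eq (hp : 0 ≤ p) (hp1 : p < 1) {s : Finset V} {x : V → ℝ}
    (hx : ∀ a ∈ s, 0 ≤ x a) :
    ∑ a ∈ s, √(msgSens p (msg p (x a))) = ∑ a ∈ s, √(sens p (x a)) :=
  Finset.sum_congr rfl fun a ha => by rw [msgSens_msg hp hp1 (hx a ha)]

/-- Conditions inherited by the model in which a vertex `u` is removed. -/
theorem contracts_step (hp1 : p < 1) {κ : ℝ} {g : V → ℝ} {U T' : Finset V} {u a : V}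
    (hu : u ∉ U) (ha : a ∈ G.neighborFinset u ∩ U) (haT' : a ∉ T')
    (hT' : T' ⊆ G.neighborFinset u ∩ U)
    (H : ∀ v ∈ U, ∀ c ∈ G.neighborFinset v ∩ insert u U,
      Contracts p κ (g v) ((G.neighborFinset v ∩ insert u U).erase c) (m v)) :
    Contracts p κ (g a) (G.neighborFinset a ∩ U.erase a) (dampOn p m T' a) ∧
    ∀ v ∈ U.erase a, ∀ c ∈ G.neighborFinset v ∩ insert a (U.erase a),
      Contracts p κ (g v) ((G.neighborFinset v ∩ insert a (U.erase a)).erase c)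
        (dampOn p m T' v) := by
  obtain ⟨hau, haU⟩ := Finset.mem_inter.1 ha
  rw [SimpleGraph.mem_neighborFinset] at hau
  rw [Finset.insert_erase haU]
  constructor
  -- The removed vertex u acts as the parent of a; this excluded neighbor keeps the number of
  -- children below the degree.
  · have h1 := H a haU u (by simp [hau.symm])
    have h2 : (G.neighborFinset a ∩ insert u U).erase u = G.neighborFinset a ∩ U.erase a := by
      ext v
      simp only [Finset.mem_erase, Finset.mem_inter, SimpleGraph.mem_neighborFinset,
        Finset.mem_insert]
      constructor
      · rintro ⟨h1, h2, h3⟩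
        exact ⟨h2, h2.ne', h3.resolve_left h1⟩
      · rintro ⟨h2, -, h3⟩
        exact ⟨fun h => hu (h ▸ h3), h2, Or.inr h3⟩
    rw [h2] at h1
    simpa [dampOn, haT'] using h1
  · intro v hv c hc
    have hvU := Finset.mem_of_mem_erase hv
    obtain ⟨hc1, hc2⟩ := Finset.mem_inter.1 hc
    have h1 := H v hvU c (Finset.mem_inter.2 ⟨hc1, Finset.mem_insert_of_mem hc2⟩)
    have hsub : (G.neighborFinset v ∩ U).erase c ⊆
        (G.neighborFinset v ∩ insert u U).erase c :=
      Finset.erase_subset_erase _ (Finset.inter_subset_inter_left (Finset.subset_insert _ _))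
    by_cases hvT : v ∈ T'
    · have hvu := (Finset.mem_inter.1 (hT' hvT)).1
      rw [SimpleGraph.mem_neighborFinset] at hvu
      have h2 := h1.restrict hp1 (J := {u}) hsub
        (by
          rw [Finset.singleton_subset_iff, Finset.mem_erase, Finset.mem_inter,
            SimpleGraph.mem_neighborFinset]
          exact ⟨fun h => hu (h ▸ hc2), hvu.symm, Finset.mem_insert_self _ _⟩)
        (by
          rw [Finset.disjoint_singleton_right]
          intro h
          exact hu (Finset.mem_inter.1 (Finset.mem_of_mem_erase h)).2)
      simpa [dampOn, hvT] using h2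
    · have h2 := h1.restrict hp1 (J := ∅) hsub (Finset.empty_subset _)
        (Finset.disjoint_empty_right _)
      simpa [dampOn, hvT] using h2

/-- The total influence of a vertex whose parent has been removed. -/
theorem totalInfl_mul_sqrt_le (hp : 0 ≤ p) (hp1 : p < 1) {w g : V → ℝ} (hw : ∀ v, 0 ≤ w v)
    {κ M K : ℝ} (hK : 0 ≤ K) (hM : ∀ v, w v * g v ≤ M) (hMK : M + K * κ ≤ K) (n : ℕ) :
    ∀ (U : Finset V) (u : V) (m : V → ℝ), U.card = n → u ∉ U → (∀ v, 0 ≤ m v) →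
      Contracts p κ (g u) (G.neighborFinset u ∩ U) (m u) →
      (∀ v ∈ U, ∀ c ∈ G.neighborFinset v ∩ insert u U,
        Contracts p κ (g v) ((G.neighborFinset v ∩ insert u U).erase c) (m v)) →
      totalInfl G p w m U u * √(sens p (ratio G p m U u)) ≤ K ∧
        √(sens p (ratio G p m U u)) ≤ g u := by
  induction n with
  | zero =>
    intro U u m hU hu hm hroot _
    rw [Finset.card_eq_zero] at hU
    subst hU
    have h1 := hroot (fun _ => 1) (by simp)
    have h2 : ratio G p m ∅ u = m u := by simp [ratio, part, psum, wt_empty]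
    simp only [Finset.inter_empty, Finset.prod_empty, mul_one, Finset.sum_empty, mul_zero] at h1
    rw [h2]
    refine ⟨?_, h1.2⟩
    simp only [totalInfl, Finset.sum_empty, add_zero]
    have h3 := mul_le_mul_of_nonneg_left h1.2 (hw u)
    have h4 : 0 ≤ K * κ := mul_nonneg hK h1.1
    linarith [hM u]
  | succ n ih =>
    intro U u m hU hu hm hroot hrest
    have hstep : ∀ T' ⊆ G.neighborFinset u ∩ U, ∀ a ∈ G.neighborFinset u ∩ U, a ∉ T' →
        totalInfl G p w (dampOn p m T') (U.erase a) a *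
          √(sens p (ratio G p (dampOn p m T') (U.erase a) a)) ≤ K ∧
        √(sens p (ratio G p (dampOn p m T') (U.erase a) a)) ≤ g a := by
      intro T' hT' a ha haT'
      obtain ⟨h1, h2⟩ := contracts_step hp1 hu ha haT' hT' hrest
      refine ih (U.erase a) a (dampOn p m T') ?_ (Finset.notMem_erase a U)
        (dampOn_nonneg hp hm T') h1 h2
      rw [Finset.card_erase_of_mem (Finset.mem_inter.1 ha).2, hU, Nat.add_sub_cancel]
    obtain ⟨x, hx, hratio, htotal⟩ := exists_children hp hp1 hm hw
      fun T' hT' a ha haT' => (hstep T' hT' a ha haT').1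
    obtain ⟨h1, h2⟩ := hroot (fun v => msg p (x v)) fun v hv =>
      ⟨le_msg hp1 (hx v hv).1, msg_le_one hp1 (hx v hv).1⟩
    rw [sum_sqrt_sens_eq hp hp1 fun a ha => (hx a ha).1, ← hratio] at h1
    rw [← hratio] at h2
    refine ⟨?_, h2⟩
    set t := √(sens p (ratio G p m U u))
    have ht : 0 ≤ t := Real.sqrt_nonneg _
    -- `Contracts` bounds t times the sum over the children by κ. The recursion K ↦ M + Kκ then
    -- closes by the choice of K.
    calc _ ≤ (w u + K * ∑ a ∈ G.neighborFinset u ∩ U, √(sens p (x a))) * t :=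
          mul_le_mul_of_nonneg_right htotal ht
      _ = w u * t + K * (t * ∑ a ∈ G.neighborFinset u ∩ U, √(sens p (x a))) := by ring
      _ ≤ w u * g u + K * κ := by
          gcongr
          exact hw u
      _ ≤ K := by linarith [hM u]

/-- The total influence of an arbitrary vertex. -/
theorem sum_infl_le (hp : 0 ≤ p) (hp1 : p < 1) {w g : V → ℝ} (hw : ∀ v, 0 ≤ w v)
    {κ M K B : ℝ} (hK : 0 ≤ K) (hM : ∀ v, w v * g v ≤ M) (hMK : M + K * κ ≤ K)
    (hB : ∀ v, g v ≤ B) (hB0 : 0 ≤ B) {U : Finset V} {u : V} (hm : ∀ v, 0 ≤ m v) (hu : u ∉ U)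
    (H : ∀ v ∈ U, ∀ c ∈ G.neighborFinset v ∩ insert u U,
        Contracts p κ (g v) ((G.neighborFinset v ∩ insert u U).erase c) (m v)) :
    ∑ v ∈ U, w v * |infl G p m U u v| ≤ K * (G.degree u * B) := by
  have hstep : ∀ T' ⊆ G.neighborFinset u ∩ U, ∀ a ∈ G.neighborFinset u ∩ U, a ∉ T' →
      totalInfl G p w (dampOn p m T') (U.erase a) a *
        √(sens p (ratio G p (dampOn p m T') (U.erase a) a)) ≤ K ∧
      √(sens p (ratio G p (dampOn p m T') (U.erase a) a)) ≤ g a := by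
    intro T' hT' a ha haT'
    obtain ⟨h1, h2⟩ := contracts_step hp1 hu ha haT' hT' H
    exact totalInfl_mul_sqrt_le hp hp1 hw hK hM hMK _ (U.erase a) a (dampOn p m T') rfl
      (Finset.notMem_erase a U) (dampOn_nonneg hp hm T') h1 h2
  obtain ⟨x, hx, -, htotal⟩ := exists_children hp hp1 hm hw
    fun T' hT' a ha haT' => (hstep T' hT' a ha haT').1
  have h1 : ∑ v ∈ U, w v * |infl G p m U u v| ≤
      K * ∑ a ∈ G.neighborFinset u ∩ U, √(sens p (x a)) := by
    unfold totalInfl at htotal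
    linarith
  -- The starting vertex has no parent, so contraction is not available there; each neighbor is
  -- bounded by B instead.
  refine h1.trans (mul_le_mul_of_nonneg_left ?_ hK)
  have h2 : ∀ a ∈ G.neighborFinset u ∩ U, √(sens p (x a)) ≤ B := by
    intro a ha
    obtain ⟨-, T', hT', haT', hxa⟩ := hx a ha
    rw [hxa]
    exact (hstep T' hT' a ha haT').2.trans (hB a)
  refine (Finset.sum_le_card_nsmul _ _ B h2).trans ?_
  rw [nsmul_eq_mul, ← SimpleGraph.card_neighborFinset_eq_degree]
  refine mul_le_mul_of_nonneg_right ?_ hB0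
  exact_mod_cast Finset.card_le_card Finset.inter_subset_left

end model

/-! ### Two-spin systems as soft hard-core models -/

section representation

variable {V : Type*} [Fintype V] [DecidableEq V] {G : SimpleGraph V} [DecidableRel G.Adj]

/-- The degree sum over S counts edges leaving S once and edges inside S twice. The additive form
avoids subtraction in ℕ. -/
theorem innerEdges_compl (S : Finset V) :
    innerEdges G Sᶜ + ∑ v ∈ S, G.degree v = G.edgeFinset.card + innerEdges G S := by
  induction S using Finset.induction_on with
  | empty =>
    simp only [innerEdges, Finset.compl_empty, Finset.mem_univ, implies_true,
      Finset.filter_true, Finset.sum_empty, add_zero, Finset.notMem_empty, Nat.left_eq_add,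
      Finset.card_eq_zero, Finset.filter_eq_empty_iff]
    exact fun e _ h => h _ (Sym2.out_fst_mem e)
  | insert u S hu ih =>
    have h1 : Sᶜ = insert u (insert u S)ᶜ := by
      ext v
      by_cases hv : v = u <;> simp [hv, hu]
    have h2 := innerEdges_insert G (u := u) (S := (insert u S)ᶜ) (by simp)
    rw [← h1] at h2
    have h3 : (G.neighborFinset u ∩ (insert u S)ᶜ).card + (G.neighborFinset u ∩ S).card =
        G.degree u := by
      rw [← SimpleGraph.card_neighborFinset_eq_degree, ← Finset.card_union_of_disjoint]
      · congr 1
        ext v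
        simp only [Finset.mem_union, Finset.mem_inter, SimpleGraph.mem_neighborFinset,
          Finset.mem_compl, Finset.mem_insert]
        constructor
        · rintro (h | h) <;> exact h.1
        · intro h
          by_cases hv : v ∈ S
          · exact Or.inr ⟨h, hv⟩
          · exact Or.inl ⟨h, fun h' => h'.elim (fun h' => h.ne' h') hv⟩
      · rw [Finset.disjoint_left]
        intro v hv hv'
        simp only [Finset.mem_inter, Finset.mem_compl, Finset.mem_insert] at hv hv'
        exact hv.2 (Or.inr hv'.2)
    rw [Finset.sum_insert hu, innerEdges_insert G hu]
    omega

theorem units_eq_neg_one_iff (c : ℤˣ) : c = -1 ↔ c ≠ 1 := by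
  rcases Int.units_eq_one_or c with rfl | rfl <;> decide

/-- By `innerEdges_compl`, the exponent of γ is |E| minus the degrees over S plus the edges inside
S: the degrees go into the fields and the inner edges turn β into βγ. -/
theorem weight_eq {β γ lam : ℝ} (hγ : 0 < γ) (σ : Config V) :
    weight G β γ lam σ = γ ^ G.edgeFinset.card *
      wt G (β * γ) (fun v => lam / γ ^ G.degree v) (Finset.univ.filter fun v => σ v = 1) := by
  set S := Finset.univ.filter fun v => σ v = 1 with hS
  have h1 : monoEdges G σ 1 = innerEdges G S := by
    unfold monoEdges innerEdges
    simp [hS]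
  have h2 : monoEdges G σ (-1) = innerEdges G Sᶜ := by
    unfold monoEdges innerEdges
    simp [hS, units_eq_neg_one_iff]
  have h3 := innerEdges_compl (G := G) S
  unfold weight wt
  rw [h1, h2, Finset.prod_div_distrib, Finset.prod_const, Finset.prod_pow_eq_pow_sum,
    show numPlus σ = S.card from rfl, mul_pow]
  have h4 : γ ^ innerEdges G Sᶜ * γ ^ ∑ v ∈ S, G.degree v =
      γ ^ G.edgeFinset.card * γ ^ innerEdges G S := by
    rw [← pow_add, ← pow_add, h3]
  have h5 : γ ^ ∑ v ∈ S, G.degree v ≠ 0 := (pow_pos hγ _).ne'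
  field_simp
  linear_combination β ^ innerEdges G S * lam ^ S.card * h4

/-- The set of vertices on which the configuration agrees with `χ`. -/
def agreeSet (χ σ : Config V) : Finset V := Finset.univ.filter fun v => σ v = χ v

omit [DecidableEq V] in
theorem mem_agreeSet {χ σ : Config V} {v : V} : v ∈ agreeSet χ σ ↔ σ v = χ v := by
  simp [agreeSet]

/-- `ρ` is proportional to the soft hard-core model with parameters `p` and `m`, with the spins
`+1` of the model being the spins that agree with `χ`. -/
def IsModel (G : SimpleGraph V) [DecidableRel G.Adj] (p : ℝ) (m : V → ℝ) (χ : Config V)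
    (ρ : Config V → ℝ) : Prop :=
  ∃ c : ℝ, 0 < c ∧ ∀ σ, ρ σ = c * wt G p m (agreeSet χ σ)

omit [Fintype V] [DecidableEq V] in
theorem units_mul_eq_one_iff (a b : ℤˣ) : a * b = 1 ↔ a = b := by
  rw [mul_eq_one_iff_eq_inv, Int.units_inv_eq_self]

/-- Where χ v = -1, spin +1 of the flipped distribution is spin -1 of the model, so φ v acts as the
field (φ v)⁻¹ up to a constant; A collects these constants. -/
theorem isModel_magnetize {β γ lam : ℝ} (h : AntiFerro β γ lam) (χ : Config V) {φ : V → ℝ}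
    (hφ : ∀ v, 0 < φ v) :
    IsModel G (β * γ) (fun v => (if χ v = 1 then φ v else (φ v)⁻¹) * (lam / γ ^ G.degree v)) χ
      (magnetize (flip (gibbs G β γ lam) χ) φ) := by
  set A := ∏ v, (if χ v = 1 then 1 else φ v) with hA
  have hApos : 0 < A := Finset.prod_pos fun v _ => by
    split_ifs
    · exact one_pos
    · exact hφ v
  have hprod : ∀ σ : Config V, ∏ v ∈ Finset.univ.filter (fun v => σ v = 1), φ v =
      A * ∏ v ∈ agreeSet χ σ, (if χ v = 1 then φ v else (φ v)⁻¹) := by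
    intro σ
    unfold agreeSet
    rw [Finset.prod_filter, Finset.prod_filter, hA, ← Finset.prod_mul_distrib]
    refine Finset.prod_congr rfl fun v _ => ?_
    have := (hφ v).ne'
    rcases Int.units_eq_one_or (σ v) with h1 | h1 <;> rcases Int.units_eq_one_or (χ v) with h2 | h2
      <;> simp [h1, h2, this]
  have hS : ∀ σ : Config V, (Finset.univ.filter fun v => (σ * χ) v = 1) = agreeSet χ σ := by
    intro σ
    ext v
    simp [agreeSet, units_mul_eq_one_iff]
  set μ := flip (gibbs G β γ lam) χ with hμ
  have hmem := flip_mem_stdSimplex (gibbs_mem_stdSimplex G h) χ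
  have hmem2 := magnetize_mem_stdSimplex hmem hφ
  set Z1 := ∑ τ, weight G β γ lam τ with hZ1
  set Z2 := ∑ τ, μ τ * ∏ v ∈ Finset.univ.filter (fun v => τ v = 1), φ v with hZ2
  have hnn1 : ∀ τ, 0 ≤ weight G β γ lam τ := fun τ => by
    have hβ := h.beta_nonneg
    have hγ := h.gamma_pos
    have hl := h.lam_pos
    unfold weight
    positivity
  have hZ1pos : 0 < Z1 := by
    refine lt_of_le_of_ne (Finset.sum_nonneg fun τ _ => hnn1 τ) fun h0 => ?_
    have h1 := (gibbs_mem_stdSimplex G h).2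
    simp [gibbs, normalize, ← hZ1, ← h0] at h1
  have hZ2pos : 0 < Z2 := by
    refine lt_of_le_of_ne (Finset.sum_nonneg fun τ _ => mul_nonneg (hmem.1 τ)
      (Finset.prod_nonneg fun v _ => (hφ v).le)) fun h0 => ?_
    have h1 : ∑ σ, magnetize μ φ σ = 1 := hmem2.2
    have h2 : ∀ σ, magnetize μ φ σ = 0 := fun σ => by
      change _ / Z2 = 0
      rw [← h0, div_zero]
    simp [h2] at h1
  have hγ := h.gamma_pos
  refine ⟨γ ^ G.edgeFinset.card * A / (Z1 * Z2), by positivity, fun σ => ?_⟩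
  have h1 : magnetize μ φ σ = weight G β γ lam (σ * χ) / Z1 *
      (∏ v ∈ Finset.univ.filter (fun v => σ v = 1), φ v) / Z2 := rfl
  rw [h1, hprod, weight_eq hγ, hS]
  unfold wt
  rw [Finset.prod_mul_distrib]
  field_simp

/-! ### Pinnings -/

/-- Pinned +1 vertices damp each free neighbor by one factor p, so a pinned model is again a model
with smaller fields. -/
theorem wt_union {p : ℝ} (P S : Finset V) (hPS : Disjoint P S) : ∀ m : V → ℝ,
    wt G p m (P ∪ S) = wt G p m P *
      wt G p (fun v => p ^ (G.neighborFinset v ∩ P).card * m v) S := by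
  induction P using Finset.induction_on with
  | empty => intro m; simp [wt_empty]
  | insert u P hu ih =>
    intro m
    obtain ⟨huS, hPS⟩ := Finset.disjoint_insert_left.1 hPS
    rw [Finset.insert_union, wt_insert (by simp [hu, huS]), ih hPS, wt_insert hu, mul_assoc]
    congr 2
    refine wt_congr fun v hv => ?_
    unfold dampOn
    simp only [SimpleGraph.mem_neighborFinset]
    by_cases huv : G.Adj u v
    · rw [if_pos huv, Finset.inter_insert_of_mem (by simpa using huv.symm),
        Finset.card_insert_of_notMem (by simp [hu]), pow_succ]
      ring
    · rw [if_neg huv, Finset.inter_insert_of_notMem (by simpa using fun h => huv h.symm)]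

/-- The pinned vertices whose spin agrees with `χ`. -/
def pinnedPlus (χ : Config V) (Λ : Finset V) (σ : Λ → ℤˣ) : Finset V :=
  Finset.univ.filter fun v => ∃ h : v ∈ Λ, σ ⟨v, h⟩ = χ v

/-- The configuration with boundary condition `σ` on `Λ` that agrees with `χ` on `S` and disagrees
elsewhere. -/
def extend (χ : Config V) (Λ : Finset V) (σ : Λ → ℤˣ) (S : Finset V) : Config V :=
  fun v => if h : v ∈ Λ then σ ⟨v, h⟩ else if v ∈ S then χ v else -χ v

omit [Fintype V] in
theorem units_ne_iff (a b : ℤˣ) : a ≠ b ↔ a = -b := by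
  rcases Int.units_eq_one_or a with rfl | rfl <;> rcases Int.units_eq_one_or b with rfl | rfl <;>
    decide

theorem units_neg_ne (a : ℤˣ) : -a ≠ a := by
  rcases Int.units_eq_one_or a with rfl | rfl <;> decide

variable {χ : Config V} {Λ : Finset V} {σ : Λ → ℤˣ}

theorem agreeSet_extend {S : Finset V} (hS : S ⊆ Λᶜ) :
    agreeSet χ (extend χ Λ σ S) = pinnedPlus χ Λ σ ∪ S := by
  ext v
  simp only [mem_agreeSet, extend, pinnedPlus, Finset.mem_filter, Finset.mem_univ, true_and,
    Finset.mem_union]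
  by_cases hv : v ∈ Λ
  · have hvS : v ∉ S := fun h => by simpa [hv] using hS h
    simp [hv, hvS]
  · by_cases hvS : v ∈ S
    · simp [hv, hvS]
    · simp [hv, hvS]

theorem disjoint_pinnedPlus {S : Finset V} (hS : S ⊆ Λᶜ) : Disjoint (pinnedPlus χ Λ σ) S := by
  rw [Finset.disjoint_left]
  intro v hv hvS
  obtain ⟨h, -⟩ := (Finset.mem_filter.1 hv).2
  simpa [h] using hS hvS

theorem sum_agree (F : Config V → ℝ) :
    ∑ τ ∈ Finset.univ.filter (fun τ : Config V => ∀ v : Λ, τ v = σ v), F τ =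
      ∑ S ∈ (Λᶜ).powerset, F (extend χ Λ σ S) := by
  symm
  refine Finset.sum_bij' (fun S _ => extend χ Λ σ S) (fun τ _ => agreeSet χ τ ∩ Λᶜ) ?_ ?_ ?_ ?_ ?_
  · intro S _
    rw [Finset.mem_filter]
    exact ⟨Finset.mem_univ _, fun v => by simp [extend]⟩
  · intro τ _
    simp
  · intro S hS
    rw [Finset.mem_powerset] at hS
    rw [agreeSet_extend hS]
    ext v
    simp only [Finset.mem_inter, Finset.mem_union, pinnedPlus, Finset.mem_filter, Finset.mem_univ,
      true_and, Finset.mem_compl]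
    constructor
    · rintro ⟨⟨h, -⟩ | h, h'⟩
      · exact absurd h h'
      · exact h
    · intro h
      exact ⟨Or.inr h, by simpa using hS h⟩
  · intro τ hτ
    have hτ' := (Finset.mem_filter.1 hτ).2
    ext v : 1
    unfold extend
    split_ifs with h1 h2
    · exact (hτ' ⟨v, h1⟩).symm
    · simp only [mem_agreeSet, Finset.mem_inter] at h2
      exact h2.1.symm
    · simp only [mem_agreeSet, Finset.mem_inter, Finset.mem_compl, not_and, not_not] at h2
      exact ((units_ne_iff _ _).1 fun h => h1 (h2 h)).symm
  · intro S _
    rfl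

/-- The fields of the free vertices after pinning. -/
def pinnedField (G : SimpleGraph V) [DecidableRel G.Adj] (p : ℝ) (m : V → ℝ) (χ : Config V)
    (Λ : Finset V) (σ : Λ → ℤˣ) : V → ℝ :=
  fun v => p ^ (G.neighborFinset v ∩ pinnedPlus χ Λ σ).card * m v

theorem pinnedField_nonneg {p : ℝ} {m : V → ℝ} (hp : 0 ≤ p) (hm : ∀ v, 0 ≤ m v) (v : V) :
    0 ≤ pinnedField G p m χ Λ σ v := mul_nonneg (pow_nonneg hp _) (hm v)

/-- Expectations with respect to a pinned distribution. -/
theorem IsModel.sum_pin {p : ℝ} {m : V → ℝ} {ρ : Config V → ℝ} (h : IsModel G p m χ ρ)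
    (hf : Feasible ρ Λ σ) (F : Config V → ℝ) :
    ∑ τ, pin ρ Λ σ τ * F τ =
      (psum G p (pinnedField G p m χ Λ σ) Λᶜ fun S => F (extend χ Λ σ S)) /
        part G p (pinnedField G p m χ Λ σ) Λᶜ := by
  obtain ⟨c, hc, hρ⟩ := h
  set m' := pinnedField G p m χ Λ σ
  set P := pinnedPlus χ Λ σ
  have hsum : ∀ F : Config V → ℝ,
      ∑ τ ∈ Finset.univ.filter (fun τ : Config V => ∀ v : Λ, τ v = σ v), ρ τ * F τ =
        c * wt G p m P * psum G p m' Λᶜ fun S => F (extend χ Λ σ S) := by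
    intro F
    rw [sum_agree (χ := χ), psum, Finset.mul_sum]
    refine Finset.sum_congr rfl fun S hS => ?_
    rw [Finset.mem_powerset] at hS
    rw [hρ, agreeSet_extend hS, wt_union _ _ (disjoint_pinnedPlus hS)]
    change c * (wt G p m P * wt G p m' S) * _ = _
    ring
  have hmarg : marginal ρ Λ σ = c * wt G p m P * part G p m' Λᶜ := by
    have := hsum fun _ => 1
    simp only [mul_one] at this
    exact this
  have hne : c * wt G p m P * part G p m' Λᶜ ≠ 0 := hmarg ▸ hf
  have h1 : ∑ τ, pin ρ Λ σ τ * F τ =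
      (∑ τ ∈ Finset.univ.filter (fun τ : Config V => ∀ v : Λ, τ v = σ v), ρ τ * F τ) /
        marginal ρ Λ σ := by
    rw [Finset.sum_filter, Finset.sum_div]
    refine Finset.sum_congr rfl fun τ _ => ?_
    unfold pin
    split_ifs
    · ring
    · simp
  rw [h1, hsum, hmarg, mul_div_mul_left _ _ (left_ne_zero_of_mul hne)]

end representation

/-! ### Spectral radius of nonnegative matrices -/

/-- The row bound is read off at a coordinate of an eigenvector where ‖x i‖ / w i is maximal. -/
theorem spectralRadius_le_of_row_sums {ι : Type*} [Fintype ι] [DecidableEq ι]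
    (A : Matrix ι ι ℝ) {w : ι → ℝ} {η : ℝ} (hw : ∀ i, 0 < w i)
    (h : ∀ i, ∑ j, |A i j| * w j ≤ η * w i) :
    spectralRadius ℂ (A.map Complex.ofReal) ≤ ENNReal.ofReal η := by
  refine iSup₂_le fun k hk => ?_
  rw [← Matrix.spectrum_toLin', ← Module.End.hasEigenvalue_iff_mem_spectrum] at hk
  obtain ⟨x, hx⟩ := hk.exists_hasEigenvector
  have hmul : (A.map Complex.ofReal).mulVec x = k • x := by
    have := hx.apply_eq_smul
    rwa [Matrix.toLin'_apply] at this
  obtain ⟨i₀, hi₀⟩ : ∃ i, x i ≠ 0 := by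
    by_contra! hcon
    exact hx.2 (funext hcon)
  obtain ⟨i, -, hi⟩ := Finset.exists_max_image Finset.univ (fun i => ‖x i‖ / w i)
    ⟨i₀, Finset.mem_univ _⟩
  set t := ‖x i‖ / w i with ht
  have htpos : 0 < t := by
    have h1 : 0 < ‖x i₀‖ / w i₀ := div_pos (norm_pos_iff.2 hi₀) (hw i₀)
    exact h1.trans_le (hi i₀ (Finset.mem_univ _))
  have hxt : ∀ j, ‖x j‖ ≤ w j * t := fun j => by
    have := hi j (Finset.mem_univ _)
    rwa [div_le_iff₀ (hw j), mul_comm] at this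
  have hxi : ‖x i‖ = w i * t := by
    rw [ht]
    field_simp [(hw i).ne']
  have h1 : ‖k‖ * ‖x i‖ ≤ η * ‖x i‖ := by
    calc ‖k‖ * ‖x i‖ = ‖((A.map Complex.ofReal).mulVec x) i‖ := by
          rw [hmul, Pi.smul_apply, norm_smul]
      _ ≤ ∑ j, ‖(A i j : ℂ) * x j‖ := norm_sum_le _ _
      _ = ∑ j, |A i j| * ‖x j‖ := by simp
      _ ≤ ∑ j, |A i j| * (w j * t) := by
          gcongr with j
          exact hxt j
      _ = (∑ j, |A i j| * w j) * t := by
          rw [Finset.sum_mul]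
          exact Finset.sum_congr rfl fun j _ => by ring
      _ ≤ η * w i * t := by gcongr; exact h i
      _ = η * ‖x i‖ := by rw [hxi]; ring
  have h2 : ‖k‖ ≤ η := le_of_mul_le_mul_right h1 (by rw [hxi]; exact mul_pos (hw i) htpos)
  rw [← ENNReal.ofReal_coe_nnreal]
  exact ENNReal.ofReal_le_ofReal h2

/-! ### Influence matrices -/

section influence

variable {V : Type*} [Fintype V] [DecidableEq V] {G : SimpleGraph V} [DecidableRel G.Adj]
  {p : ℝ} {m : V → ℝ} {χ : Config V} {ρ : Config V → ℝ} {Λ : Finset V} {σ : Λ → ℤˣ}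

theorem sum_units (f : ℤˣ → ℝ) (c : ℤˣ) : ∑ s, f s = f c + f (-c) := by
  have huniv : (Finset.univ : Finset ℤˣ) = {1, -1} := rfl
  rw [huniv, Finset.sum_pair (by decide)]
  rcases Int.units_eq_one_or c with rfl | rfl
  · rfl
  · rw [neg_neg, add_comm]

theorem dTV_eq {a b : ℤˣ → ℝ} (c : ℤˣ) (ha : a c + a (-c) = 1) (hb : b c + b (-c) = 1) :
    dTV a b = |a c - b c| := by
  have h1 : a (-c) - b (-c) = -(a c - b c) := by linarith
  unfold dTV
  rw [sum_units _ c, h1, abs_neg]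
  ring

theorem vertexMarginal_eq_sum (μ : Config V → ℝ) (u : V) (c : ℤˣ) :
    vertexMarginal μ u c = ∑ τ, μ τ * if τ u = c then 1 else 0 := by
  unfold vertexMarginal
  rw [Finset.sum_filter]
  exact Finset.sum_congr rfl fun τ _ => by split_ifs <;> simp

theorem vertexMarginal_pinVertex (μ : Config V → ℝ) (u v : V) (c d : ℤˣ) :
    vertexMarginal (pinVertex μ u c) v d =
      (∑ τ, μ τ * if τ u = c ∧ τ v = d then 1 else 0) / vertexMarginal μ u c := by
  rw [vertexMarginal_eq_sum, Finset.sum_div]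
  refine Finset.sum_congr rfl fun τ _ => ?_
  unfold pinVertex
  by_cases h1 : τ u = c <;> by_cases h2 : τ v = d <;> simp [h1, h2]

theorem vertexMarginal_pinVertex_add (μ : Config V → ℝ) (u v : V) {c : ℤˣ} (d : ℤˣ)
    (hc : vertexMarginal μ u c ≠ 0) :
    vertexMarginal (pinVertex μ u c) v d + vertexMarginal (pinVertex μ u c) v (-d) = 1 := by
  rw [vertexMarginal_pinVertex, vertexMarginal_pinVertex, ← add_div, ← Finset.sum_add_distrib,
    div_eq_one_iff_eq hc, vertexMarginal_eq_sum]
  refine Finset.sum_congr rfl fun τ _ => ?_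
  rw [← mul_add]
  congr 1
  by_cases h1 : τ u = c
  · by_cases h2 : τ v = d
    · simp [h1, h2, (units_neg_ne d).symm]
    · simp [h1, (units_ne_iff _ _).1 h2]
  · simp [h1]

/-- The marginal at `v` given the spin at `u`. -/
theorem IsModel.vertexMarginal_pinVertex_pin (hρ : IsModel G p m χ ρ) (hp : 0 ≤ p)
    (hm : ∀ v, 0 ≤ m v) (hf : Feasible ρ Λ σ) {u v : V} (hu : u ∉ Λ) (hv : v ∉ Λ) (huv : u ≠ v)
    {c : ℤˣ} (hc : vertexMarginal (pin ρ Λ σ) u c ≠ 0) :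
    vertexMarginal (pinVertex (pin ρ Λ σ) u c) v (χ v) =
      marg G p (if c = χ u then dampOn p (pinnedField G p m χ Λ σ) (G.neighborFinset u)
        else pinnedField G p m χ Λ σ) (Λᶜ.erase u) v := by
  have hm' : ∀ v, 0 ≤ pinnedField G p m χ Λ σ v := pinnedField_nonneg hp hm
  set m' := pinnedField G p m χ Λ σ with hm'def
  set W := Λᶜ.erase u
  have hW : insert u W = Λᶜ := Finset.insert_erase (by simpa using hu)
  have huW : u ∉ W := Finset.notMem_erase u _
  have hZ := part_pos (G := G) hp hm' Λᶜ
  have hin : ∀ S, extend χ Λ σ S u = χ u ↔ u ∈ S := fun S => by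
    simp only [extend, dif_neg hu]
    split_ifs with h <;> simp [h]
  have hinv : ∀ S, extend χ Λ σ S v = χ v ↔ v ∈ S := fun S => by
    simp only [extend, dif_neg hv]
    split_ifs with h <;> simp [h]
  have hsub : ∀ S ∈ W.powerset, u ∉ S := fun S hS h => huW (Finset.mem_powerset.1 hS h)
  rw [vertexMarginal_pinVertex]
  rw [vertexMarginal_eq_sum] at hc ⊢
  rw [hρ.sum_pin hf] at hc
  rw [hρ.sum_pin hf, hρ.sum_pin hf, div_div_div_cancel_right₀ hZ.ne']
  rw [← hm'def, ← hW] at hc ⊢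
  by_cases hcu : c = χ u
  · subst hcu
    rw [if_pos rfl]
    simp only [hin, hinv] at hc ⊢
    have key : ∀ f : Finset V → ℝ, (∀ S ∈ W.powerset, f S = 0) →
        psum G p m' (insert u W) f = m' u * psum G p (dampOn p m' (G.neighborFinset u)) W
          fun S => f (insert u S) := by
      intro f hf0
      rw [psum_insert huW, psum, Finset.sum_eq_zero, zero_add]
      intro S hS
      rw [hf0 S hS, mul_zero]
    rw [key _ fun S hS => by simp [hsub S hS]] at hc
    rw [key _ fun S hS => by simp [hsub S hS], key _ fun S hS => by simp [hsub S hS]]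
    have hmu : m' u ≠ 0 := by
      intro h0
      rw [h0, zero_mul, zero_div] at hc
      exact hc rfl
    rw [mul_div_mul_left _ _ hmu]
    unfold marg part
    congr 1
    · congr 1
      ext S
      simp [huv.symm]
    · congr 1
      ext S
      simp
  · rw [if_neg hcu]
    have hcu' : ∀ s : ℤˣ, s = c ↔ s ≠ χ u := fun s => by
      rw [(units_ne_iff _ _).1 hcu, units_ne_iff]
    simp only [hcu', hin, hinv, ne_eq] at hc ⊢
    have key : ∀ f : Finset V → ℝ, (∀ S, u ∈ S → f S = 0) →
        psum G p m' (insert u W) f = psum G p m' W f := by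
      intro f hf0
      rw [psum_insert huW]
      simp [psum, hf0]
    rw [key _ fun S hS => by simp [hS], key _ fun S hS => by simp [hS]]
    unfold marg part psum
    congr 1
    · refine Finset.sum_congr rfl fun S hS => ?_
      simp [hsub S hS]
    · refine Finset.sum_congr rfl fun S hS => ?_
      simp [hsub S hS]

/-- Total variation on two spins is the difference of one probability, so each feasible pair
contributes 0 or |`infl`|. When the spin of u is forced only trivial pairs remain, hence an
inequality. -/
theorem IsModel.abs_influence_le (hρ : IsModel G p m χ ρ) (hp : 0 ≤ p)
    (hm : ∀ v, 0 ≤ m v) (hf : Feasible ρ Λ σ) (u v : {v // v ∉ Λ}) (huv : u ≠ v) :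
    |influence ρ Λ σ u v| ≤ |infl G p (pinnedField G p m χ Λ σ) (Λᶜ.erase u) u v| := by
  have huv' : (u : V) ≠ v := fun h => huv (Subtype.ext h)
  unfold influence
  rw [if_neg huv, abs_of_nonneg (Real.iSup_nonneg fun q => by unfold dTV; positivity)]
  refine Real.iSup_le (fun q => ?_) (abs_nonneg _)
  obtain ⟨⟨c, c'⟩, hc, hc'⟩ := q
  simp only at hc hc' ⊢
  rw [dTV_eq (χ v) (vertexMarginal_pinVertex_add _ _ _ _ hc)
    (vertexMarginal_pinVertex_add _ _ _ _ hc'),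
    hρ.vertexMarginal_pinVertex_pin hp hm hf u.2 v.2 huv' hc,
    hρ.vertexMarginal_pinVertex_pin hp hm hf u.2 v.2 huv' hc']
  by_cases h1 : c = χ u <;> by_cases h2 : c' = χ u
  · simp [h1, h2]
  · rw [if_pos h1, if_neg h2]
    exact le_rfl
  · rw [if_neg h1, if_pos h2, abs_sub_comm]
    exact le_rfl
  · simp [h1, h2]

/-- Pinned neighbors of v are the removed ones in `Contracts.restrict`; the parent c is free and
hence not among them. -/
theorem pinnedField_contracts (hp1 : p < 1) {κ g : ℝ} {v c : V}
    (hc : c ∈ G.neighborFinset v ∩ Λᶜ)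
    (H : Contracts p κ g ((G.neighborFinset v).erase c) (m v)) :
    Contracts p κ g ((G.neighborFinset v ∩ Λᶜ).erase c) (pinnedField G p m χ Λ σ v) := by
  have hdisj := disjoint_pinnedPlus (χ := χ) (Λ := Λ) (σ := σ) (Finset.Subset.refl _)
  refine H.restrict hp1 (J := G.neighborFinset v ∩ pinnedPlus χ Λ σ)
    (Finset.erase_subset_erase _ Finset.inter_subset_left) ?_ ?_
  · intro a ha
    obtain ⟨ha1, ha2⟩ := Finset.mem_inter.1 ha
    refine Finset.mem_erase.2 ⟨?_, ha1⟩
    rintro rfl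
    exact Finset.disjoint_left.1 hdisj ha2 (Finset.mem_inter.1 hc).2
  · rw [Finset.disjoint_left]
    intro a ha ha'
    exact Finset.disjoint_left.1 hdisj (Finset.mem_inter.1 ha').2
      (Finset.mem_inter.1 (Finset.mem_of_mem_erase ha)).2

theorem IsModel.sum_influence_le (hρ : IsModel G p m χ ρ) (hp : 0 ≤ p)
    (hm : ∀ v, 0 ≤ m v) (hf : Feasible ρ Λ σ) {w : V → ℝ} (hw : ∀ v, 0 < w v)
    (u : {v // v ∉ Λ}) :
    ∑ j, |influence ρ Λ σ u j| * w j ≤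
      ∑ v ∈ Λᶜ.erase (u : V), w v * |infl G p (pinnedField G p m χ Λ σ) (Λᶜ.erase u) u v| := by
  have huΛ : (u : V) ∈ Λᶜ := by simpa using u.2
  set I : V → ℝ := fun v => |infl G p (pinnedField G p m χ Λ σ) (Λᶜ.erase u) u v|
  have h2 : ∑ j, |influence ρ Λ σ u j| * w j ≤
      ∑ j : {v // v ∉ Λ}, if (j : V) = u then 0 else w j * I j := by
    refine Finset.sum_le_sum fun j _ => ?_
    split_ifs with hj
    · have : u = j := Subtype.ext hj.symm
      rw [influence, if_pos this, abs_zero, zero_mul]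
    · rw [mul_comm]
      exact mul_le_mul_of_nonneg_left
        (hρ.abs_influence_le hp hm hf u j fun h => hj (congrArg _ h.symm)) (hw j).le
  refine h2.trans (le_of_eq ?_)
  rw [← Finset.sum_subtype (Λᶜ) (fun v => by simp) fun v => if v = (u : V) then 0 else w v * I v]
  rw [← Finset.sum_erase_add _ _ huΛ, if_pos rfl, add_zero]
  exact Finset.sum_congr rfl fun v hv => if_neg (Finset.ne_of_mem_erase hv)

/-- Spectral independence from one-step contraction at every vertex. -/
theorem IsModel.spectrallyIndependent (hρ : IsModel G p m χ ρ) (hp : 0 ≤ p) (hp1 : p < 1)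
    (hm : ∀ v, 0 ≤ m v) {w g : V → ℝ} (hw : ∀ v, 0 < w v) {κ M K B η : ℝ} (hK : 0 ≤ K)
    (hM : ∀ v, w v * g v ≤ M) (hMK : M + K * κ ≤ K) (hB : ∀ v, g v ≤ B) (hB0 : 0 ≤ B)
    (H : ∀ v, ∀ c ∈ G.neighborFinset v, Contracts p κ (g v) ((G.neighborFinset v).erase c) (m v))
    (hη : ∀ u, K * (G.degree u * B) ≤ η * w u) : SpectrallyIndependent η ρ := by
  intro Λ σ hf
  refine spectralRadius_le_of_row_sums (influence ρ Λ σ) (w := fun v => w v) (fun v => hw v)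
    fun u => ?_
  have huΛ : (u : V) ∈ Λᶜ := by simpa using u.2
  refine (hρ.sum_influence_le hp hm hf hw u).trans (le_trans ?_ (hη u))
  refine sum_infl_le hp hp1 (fun v => (hw v).le) hK hM hMK hB hB0
    (pinnedField_nonneg hp hm) (Finset.notMem_erase _ _) fun v hv c hc => ?_
  rw [Finset.insert_erase huΛ] at hc ⊢
  exact pinnedField_contracts hp1 hc (H v c (Finset.mem_inter.1 hc).1)

end influence

/-! ### Complete spectral independence -/

section complete

variable {V : Type*} [Fintype V] [DecidableEq V] {G : SimpleGraph V} [DecidableRel G.Adj]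
  {β γ lam δ : ℝ}

omit [DecidableEq V] in
theorem goodDirection_eq_one_iff (v : V) :
    goodDirection G β γ lam v = 1 ↔ PlusDir β γ lam (G.degree v) := by
  unfold goodDirection PlusDir
  split_ifs with h <;> simp [h]

/-- The normalized fields of the system with local fields `φ` in the good direction. -/
def goodField (G : SimpleGraph V) [DecidableRel G.Adj] (β γ lam : ℝ) (φ : V → ℝ) (v : V) : ℝ :=
  (if goodDirection G β γ lam v = 1 then φ v else (φ v)⁻¹) * (lam / γ ^ G.degree v)

omit [DecidableEq V] in
theorem goodField_nonneg (h : AntiFerro β γ lam) {φ : V → ℝ} (hφ : ∀ v, 0 < φ v) (v : V) :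
    0 ≤ goodField G β γ lam φ v := by
  have hγ := h.gamma_pos
  have hl := h.lam_pos
  have := hφ v
  unfold goodField
  split_ifs <;> positivity

omit [DecidableEq V] in
theorem goodField_fieldOK (h : AntiFerro β γ lam) {φ : V → ℝ} {c : ℝ} (hc : 0 < c)
    (hφ : ∀ v, 0 < φ v) (hφc : ∀ v, φ v ≤ c) (v : V) :
    FieldOK β γ lam c (G.degree v) (goodField G β γ lam φ v) := by
  have hγ := h.gamma_pos
  have hl := h.lam_pos
  have h1 := hφ v
  have h2 := hφc v
  unfold FieldOK goodField
  by_cases hpl : PlusDir β γ lam (G.degree v)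
  · rw [if_pos hpl, if_pos ((goodDirection_eq_one_iff v).2 hpl)]
    refine ⟨by positivity, ?_⟩
    rw [← mul_assoc]
    refine mul_le_of_le_one_left (by positivity) ?_
    rw [inv_mul_le_iff₀ hc]
    linarith
  · rw [if_neg hpl, if_neg (mt (goodDirection_eq_one_iff v).1 hpl), ← mul_assoc]
    refine le_mul_of_one_le_left (by positivity) ?_
    rw [← div_eq_mul_inv, one_le_div h1]
    exact h2

theorem sqrt_one_sub_le (hδ : δ ≤ 2) : √(1 - δ) ≤ 1 - δ / 2 := by
  rw [Real.sqrt_le_left (by linarith)]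
  nlinarith [sq_nonneg δ]

/-- The parent c leaves deg v - 1 < Δ children, so uniqueness applies. Square roots turn the
two-level factor 1 - δ into √(1 - δ) ≤ 1 - δ/2. -/
theorem goodField_contracts (h : AntiFerro β γ lam) (hδ0 : 0 < δ) (hδ1 : δ < 1)
    (hU : UpToUnique β γ lam G.maxDegree δ) {φ : V → ℝ} (hφ : ∀ v, 0 < φ v)
    (hφ1 : ∀ v, φ v ≤ 1) (v c : V) (hc : c ∈ G.neighborFinset v) :
    Contracts (β * γ) (1 - δ / 2) (√(cap β γ lam (G.degree v))) ((G.neighborFinset v).erase c)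
      (goodField G β γ lam φ v) := by
  intro b hb
  have hp := h.mul_nonneg
  have hcard : ((G.neighborFinset v).erase c).card + 1 = G.degree v := by
    rw [Finset.card_erase_add_one hc, SimpleGraph.card_neighborFinset_eq_degree]
  have hOK := goodField_fieldOK (G := G) h one_pos hφ hφ1 v
  have hm := goodField_nonneg (G := G) h hφ v
  set m := goodField G β γ lam φ v
  set s := (G.neighborFinset v).erase c
  have hprod1 : (β * γ) ^ s.card ≤ ∏ w ∈ s, b w := by
    rw [← Finset.prod_const]
    exact Finset.prod_le_prod (fun _ _ => hp) fun w hw => (hb w hw).1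
  have hprod2 : ∏ w ∈ s, b w ≤ 1 :=
    Finset.prod_le_one (fun w hw => hp.trans (hb w hw).1) fun w hw => (hb w hw).2
  have hle := G.degree_le_maxDegree v
  have hR : 0 ≤ m * ∏ w ∈ s, b w := mul_nonneg hm ((pow_nonneg hp _).trans hprod1)
  constructor
  · have h1 := FieldOK.contraction h s b hb (δ := δ) (m := m) (by rw [hcard]; exact hOK) hδ0.le
      hδ1.le fun hs => hU s.card hs.card_pos (by omega)
    refine le_trans ?_ (sqrt_one_sub_le (by linarith))
    refine Real.le_sqrt_of_sq_le ?_
    rw [mul_pow, Real.sq_sqrt (sens_nonneg hp h.beta_mul_gamma_lt_one hR)]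
    exact h1
  · refine Real.sqrt_le_sqrt (sens_le_cap h (m := m) (by omega) hOK ?_ ?_)
    · rw [show G.degree v - 1 = s.card by omega]
      exact mul_le_mul_of_nonneg_left hprod1 hm
    · exact mul_le_of_le_one_right hm hprod2

/-- The geometric series gives K = M/(1 - κ) = 2M/δ, and the starting vertex adds deg u * B, which
its weight absorbs. `cap_mul_cap_le` gives M * B ≤ 72, hence 144/δ. -/
theorem completelySpectrallyIndependent (h : AntiFerro β γ lam) (hδ0 : 0 < δ) (hδ1 : δ < 1)
    (hΔ : 3 ≤ G.maxDegree) (hU : UpToUnique β γ lam G.maxDegree δ) :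
    CompletelySpectrallyIndependent (144 / δ)
      (flip (gibbs G β γ lam) (goodDirection G β γ lam)) := by
  intro φ hφ
  have hne : Nonempty V := by
    by_contra hcon
    rw [not_nonempty_iff] at hcon
    have := G.maxDegree_of_subsingleton
    omega
  -- Isolated vertices get weight 1 to keep w positive and g = 0 so as not to affect the maxima; the
  -- cap estimate needs degree at least 1.
  set w : V → ℝ := fun v => if G.degree v = 0 then 1 else G.degree v with hw
  set g : V → ℝ := fun v => if G.degree v = 0 then 0 else √(cap β γ lam (G.degree v)) with hg
  have hw0 : ∀ v, 0 < w v := fun v => by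
    simp only [hw]
    split_ifs with h0
    · exact one_pos
    · exact_mod_cast Nat.pos_of_ne_zero h0
  have hg0 : ∀ v, 0 ≤ g v := fun v => by
    simp only [hg]
    split_ifs
    · exact le_rfl
    · exact Real.sqrt_nonneg _
  obtain ⟨a, -, ha⟩ := Finset.exists_max_image Finset.univ (fun v => w v * g v)
    Finset.univ_nonempty
  obtain ⟨b, -, hb⟩ := Finset.exists_max_image Finset.univ g Finset.univ_nonempty
  have hM0 : 0 ≤ w a * g a := mul_nonneg (hw0 a).le (hg0 a)
  have hab : w a * g a * g b ≤ 72 := by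
    simp only [hw, hg]
    split_ifs with h1 h2
    · simp
    · simp
    · simp
    · refine abs_le_of_sq_le_sq' ?_ (by norm_num) |>.2
      rw [mul_pow, mul_pow, Real.sq_sqrt (cap_nonneg h _), Real.sq_sqrt (cap_nonneg h _), mul_assoc]
      exact cap_mul_cap_le h hΔ hδ0.le hU (by omega) (G.degree_le_maxDegree a) (by omega)
        (G.degree_le_maxDegree b)
  refine (isModel_magnetize h _ fun v => (hφ v).1).spectrallyIndependent h.mul_nonneg
    h.beta_mul_gamma_lt_one (w := w) (g := g) (κ := 1 - δ / 2) (M := w a * g a)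
    (K := 2 * (w a * g a) / δ) (B := g b) (goodField_nonneg h fun v => (hφ v).1) hw0
    (by positivity) (fun v => ha v (Finset.mem_univ v)) (le_of_eq ?_)
    (fun v => hb v (Finset.mem_univ v)) (hg0 b) ?_ ?_
  · field_simp
    ring
  · intro v c hc
    have hdeg : G.degree v ≠ 0 := by
      rw [← SimpleGraph.card_neighborFinset_eq_degree]
      exact (Finset.card_pos.2 ⟨c, hc⟩).ne'
    have h1 := goodField_contracts h hδ0 hδ1 hU (fun v => (hφ v).1) (fun v => (hφ v).2) v c hc
    simp only [hg, if_neg hdeg]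
    exact h1
  · intro u
    have hu : (G.degree u : ℝ) ≤ w u := by
      simp only [hw]
      split_ifs with h0
      · simp [h0]
      · exact le_rfl
    calc 2 * (w a * g a) / δ * (G.degree u * g b) = 2 / δ * (w a * g a * g b) * G.degree u := by
          ring
      _ ≤ 2 / δ * 72 * w u := by gcongr
      _ = 144 / δ * w u := by ring

end complete

/-! ### Second eigenvalue of a reversible matrix -/

/-- Reversibility makes P similar to a symmetric matrix through diag(√d). An eigenvector for an
eigenvalue above B must be a multiple of √d, and two orthogonal vectors cannot both be nonzero
multiples of it. -/
theorem charpoly_roots_getD_one_le {ι : Type*} [Fintype ι] [DecidableEq ι] (P : Matrix ι ι ℝ)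
    {d : ι → ℝ} (hd : ∀ i, 0 < d i) (hrev : ∀ i j, d i * P i j = d j * P j i) {B : ℝ}
    (hB : 0 ≤ B)
    (hconst : ∀ (k : ℝ) (f : ι → ℝ), B < k → P.mulVec f = k • f → ∀ i j, f i = f j) :
    (P.charpoly.roots.sort (· ≥ ·)).getD 1 0 ≤ B := by
  by_contra! hcon
  set s : ι → ℝ := fun i => √(d i) with hs
  have hs0 : ∀ i, 0 < s i := fun i => Real.sqrt_pos.2 (hd i)
  have hss : ∀ i, s i * s i = d i := fun i => Real.mul_self_sqrt (hd i).le
  set S : Matrix ι ι ℝ := Matrix.diagonal s * P * Matrix.diagonal (fun i => (s i)⁻¹) with hS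
  have hSij : ∀ i j, S i j = s i * P i j * (s j)⁻¹ := fun i j => by
    simp [hS, Matrix.mul_diagonal, Matrix.diagonal_mul]
  have hcp : S.charpoly = P.charpoly := by
    rw [hS, Matrix.charpoly_mul_comm, ← Matrix.mul_assoc, Matrix.diagonal_mul_diagonal]
    have : (fun i => (s i)⁻¹ * s i) = fun _ => 1 := by
      ext i
      exact inv_mul_cancel₀ (hs0 i).ne'
    rw [this, Matrix.diagonal_one, Matrix.one_mul]
  have hherm : S.IsHermitian := by
    ext i j
    rw [Matrix.conjTranspose_apply, star_trivial, hSij, hSij]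
    have h1 := hrev i j
    rw [← hss, ← hss] at h1
    have h2 := (hs0 i).ne'
    have h3 := (hs0 j).ne'
    field_simp
    linarith
  rw [← hcp] at hcon
  have hcard : 1 < (Finset.univ.filter fun i => B < hherm.eigenvalues i).card := by
    have hroots : S.charpoly.roots = Multiset.map hherm.eigenvalues Finset.univ.val :=
      hherm.roots_charpoly_eq_eigenvalues
    have h1 : (Finset.univ.filter fun i => B < hherm.eigenvalues i).card =
        (S.charpoly.roots.filter (B < ·)).card := by
      rw [hroots, Multiset.filter_map, Multiset.card_map]
      rfl
    rw [h1]
    have hsort := Multiset.sort_eq S.charpoly.roots (· ≥ ·)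
    have hpair := Multiset.pairwise_sort S.charpoly.roots (· ≥ ·)
    revert hcon hsort hpair
    generalize S.charpoly.roots.sort (· ≥ ·) = L
    intro hcon hsort hpair
    rw [← hsort]
    -- Lists with fewer than two entries return the default 0, which is not above B.
    rcases L with _ | ⟨a, _ | ⟨b, t⟩⟩
    · exact absurd hB (not_le.2 (by simpa using hcon))
    · exact absurd hB (not_le.2 (by simpa using hcon))
    · have hb : B < b := by simpa using hcon
      have ha : B < a := hb.trans_le ((List.pairwise_cons.1 hpair).1 b (by simp))
      simp [ha, hb]
  obtain ⟨i, hi, j, hj, hij⟩ := Finset.one_lt_card.1 hcard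
  have key : ∀ i, i ∈ Finset.univ.filter (fun i => B < hherm.eigenvalues i) →
      ∃ c : ℝ, ∀ x, hherm.eigenvectorBasis i x = c * s x := by
    intro i hi
    have hi := (Finset.mem_filter.1 hi).2
    set v : ι → ℝ := fun x => hherm.eigenvectorBasis i x with hv
    have hev : S.mulVec v = hherm.eigenvalues i • v := hherm.mulVec_eigenvectorBasis i
    have := hconst (hherm.eigenvalues i) (fun x => (s x)⁻¹ * v x) hi (by
      ext x
      have h1 := congrFun hev x
      simp only [Matrix.mulVec, dotProduct, Pi.smul_apply, smul_eq_mul, hSij] at h1 ⊢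
      have h2 : ∑ y, s x * P x y * (s y)⁻¹ * v y = s x * ∑ y, P x y * ((s y)⁻¹ * v y) := by
        rw [Finset.mul_sum]
        exact Finset.sum_congr rfl fun y _ => by ring
      rw [h2] at h1
      have h3 := (hs0 x).ne'
      refine mul_left_cancel₀ h3 (h1.trans ?_)
      field_simp)
    refine ⟨(s i)⁻¹ * v i, fun x => ?_⟩
    rw [← this x i]
    have h3 := (hs0 x).ne'
    field_simp
    rfl
  obtain ⟨c, hc⟩ := key i hi
  obtain ⟨c', hc'⟩ := key j hj
  have horth := hherm.eigenvectorBasis.inner_eq_zero hij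
  have hne : ∀ (l : ι) (a : ℝ), (∀ x, hherm.eigenvectorBasis l x = a * s x) → a ≠ 0 := by
    rintro l a ha rfl
    have h0 : hherm.eigenvectorBasis l = 0 := by
      ext x
      rw [ha x, zero_mul]
      rfl
    have := hherm.eigenvectorBasis.norm_eq_one l
    rw [h0, norm_zero] at this
    exact zero_ne_one this
  have hsum : c' * c * ∑ x, d x = 0 := by
    rw [← horth, PiLp.inner_apply, Finset.mul_sum]
    refine Finset.sum_congr rfl fun x _ => ?_
    rw [hc, hc', ← hss]
    simp
    ring
  have hpos : 0 < ∑ x, d x := Finset.sum_pos (fun x _ => hd x) ⟨i, Finset.mem_univ _⟩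
  rcases mul_eq_zero.1 hsum with h | h
  · exact (mul_ne_zero (hne j c' hc') (hne i c hc)) h
  · exact hpos.ne' h

/-! ### Glauber dynamics -/

section glauber

variable {V : Type*} [Fintype V] [DecidableEq V]

/-- The average of `F` after resampling the spin of `v`. -/
def heatBath (ρ : Config V → ℝ) (v : V) (F : Config V → ℝ) (σ : Config V) : ℝ :=
  (∑ c : ℤˣ, ρ (Function.update σ v c) * F (Function.update σ v c)) /
    ∑ c : ℤˣ, ρ (Function.update σ v c)

/-- The probability that `v` gets a spin different from that of `base` when it is resampled. -/
def flipProb (ρ : Config V → ℝ) (base : Config V) (v : V) (σ : Config V) : ℝ :=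
  ρ (Function.update σ v (-base v)) / ∑ c : ℤˣ, ρ (Function.update σ v c)

omit [Fintype V] in
theorem sum_update_pos {ρ : Config V → ℝ} (hρ : ∀ σ, 0 ≤ ρ σ) {σ : Config V} (hσ : ρ σ ≠ 0)
    (v : V) : 0 < ∑ c : ℤˣ, ρ (Function.update σ v c) :=
  Finset.sum_pos' (fun c _ => hρ _) ⟨σ v, Finset.mem_univ _, by
    rw [Function.update_eq_self]
    exact lt_of_le_of_ne (hρ σ) hσ.symm⟩

omit [Fintype V] in
theorem heatBath_eq {ρ : Config V → ℝ} (hρ : ∀ σ, 0 ≤ ρ σ) {σ : Config V} (hσ : ρ σ ≠ 0)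
    (base : Config V) (v : V) (F : Config V → ℝ) :
    heatBath ρ v F σ = flipProb ρ base v σ * F (Function.update σ v (-base v)) +
      (1 - flipProb ρ base v σ) * F (Function.update σ v (base v)) := by
  have h1 := sum_update_pos hρ hσ v
  unfold heatBath flipProb
  rw [sum_units _ (base v)] at h1 ⊢
  rw [sum_units _ (base v)]
  field_simp
  ring

omit [Fintype V] in
theorem flipProb_mem {ρ : Config V → ℝ} (hρ : ∀ σ, 0 ≤ ρ σ) {σ : Config V} (hσ : ρ σ ≠ 0)
    (base : Config V) (v : V) : 0 ≤ flipProb ρ base v σ ∧ flipProb ρ base v σ ≤ 1 := by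
  have h1 := sum_update_pos hρ hσ v
  unfold flipProb
  refine ⟨div_nonneg (hρ _) h1.le, ?_⟩
  rw [div_le_one h1]
  exact Finset.single_le_sum (f := fun c => ρ (Function.update σ v c)) (fun c _ => hρ _)
    (Finset.mem_univ _)

omit [Fintype V] in
theorem agree_off_iff (σ τ : Config V) (v : V) :
    (∀ w, w ≠ v → τ w = σ w) ↔ ∃ c, Function.update σ v c = τ := by
  constructor
  · intro h
    refine ⟨τ v, ?_⟩
    ext w
    by_cases hw : w = v
    · subst hw; simp
    · simp [hw, h w hw]
  · rintro ⟨c, rfl⟩ w hw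
    simp [hw]

theorem sum_agree_off (σ : Config V) (v : V) (H : Config V → ℝ) :
    ∑ τ, (if ∀ w, w ≠ v → τ w = σ w then H τ else 0) =
      ∑ c : ℤˣ, H (Function.update σ v c) := by
  rw [← Finset.sum_filter]
  symm
  refine Finset.sum_bij' (fun c _ => Function.update σ v c) (fun τ _ => τ v) ?_ ?_ ?_ ?_ ?_
  · intro c _
    exact Finset.mem_filter.2 ⟨Finset.mem_univ _, (agree_off_iff _ _ _).2 ⟨c, rfl⟩⟩
  · intro τ _
    exact Finset.mem_univ _
  · intro c _
    simp
  · intro τ hτ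
    obtain ⟨c, rfl⟩ := (agree_off_iff _ _ _).1 (Finset.mem_filter.1 hτ).2
    simp
  · intro c _
    rfl

open Classical in
theorem sum_eq_sum_supp {ρ g : Config V → ℝ} (hg : ∀ τ, ρ τ = 0 → g τ = 0) :
    ∑ τ, g τ = ∑ τ : Supp ρ, g τ.1 := by
  rw [← Finset.sum_subtype (Finset.univ.filter fun τ => ρ τ ≠ 0) (fun τ => by simp) g]
  refine (Finset.sum_subset (Finset.subset_univ _) fun τ _ hτ => hg τ ?_).symm
  simpa using hτ

open Classical in
theorem glauber_mulVec {ρ : Config V → ℝ} {f : Supp ρ → ℝ} {F : Config V → ℝ}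
    (hF : ∀ σ : Supp ρ, F σ.1 = f σ) (σ : Supp ρ) :
    (glauber ρ).mulVec f σ = 1 / (Fintype.card V : ℝ) * ∑ v, heatBath ρ v F σ.1 := by
  simp only [Matrix.mulVec, dotProduct, glauber, mul_assoc, ← Finset.mul_sum]
  congr 1
  simp only [Finset.sum_mul]
  rw [Finset.sum_comm]
  refine Finset.sum_congr rfl fun v _ => ?_
  unfold heatBath
  set D := ∑ c : ℤˣ, ρ (Function.update σ.1 v c)
  rw [← sum_agree_off σ.1 v fun τ => ρ τ * F τ, Finset.sum_div]
  rw [sum_eq_sum_supp (ρ := ρ)]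
  · refine Finset.sum_congr rfl fun τ _ => ?_
    split_ifs
    · rw [hF]; ring
    · simp
  · intro τ hτ
    simp [hτ]

theorem glauber_reversible (ρ : Config V → ℝ) (σ τ : Supp ρ) :
    ρ σ.1 * glauber ρ σ τ = ρ τ.1 * glauber ρ τ σ := by
  unfold glauber
  rw [mul_left_comm, mul_left_comm (ρ τ.1)]
  congr 1
  rw [Finset.mul_sum, Finset.mul_sum]
  refine Finset.sum_congr rfl fun v _ => ?_
  have hsymm : (∀ w, w ≠ v → τ.1 w = σ.1 w) ↔ ∀ w, w ≠ v → σ.1 w = τ.1 w :=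
    ⟨fun h w hw => (h w hw).symm, fun h w hw => (h w hw).symm⟩
  by_cases h : ∀ w, w ≠ v → τ.1 w = σ.1 w
  · rw [if_pos h, if_pos (hsymm.1 h)]
    obtain ⟨c, hc⟩ := (agree_off_iff _ _ _).1 h
    rw [← hc]
    simp only [Function.update_idem]
    ring
  · rw [if_neg h, if_neg (mt hsymm.2 h), mul_zero, mul_zero]

omit [Fintype V] in
/-- One-step path coupling for a weighted Lipschitz function. -/
theorem abs_heatBath_sub_le {ρ : Config V → ℝ} (hρ : ∀ σ, 0 ≤ ρ σ) {base : Config V}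
    (hbase : ∀ σ, ρ σ ≠ 0 → ∀ v, ρ (Function.update σ v (base v)) ≠ 0) {w : V → ℝ} {L : ℝ}
    {F : Config V → ℝ}
    (hL : ∀ σ, ρ σ ≠ 0 → ∀ v, |F σ - F (Function.update σ v (base v))| ≤ L * w v)
    {σ : Config V} (hσ : ρ σ ≠ 0) {u v : V} (huv : v ≠ u) :
    |heatBath ρ v F σ - heatBath ρ v F (Function.update σ u (base u))| ≤ L * w u +
      |flipProb ρ base v σ - flipProb ρ base v (Function.update σ u (base u))| * (L * w v) := by
  set τ := Function.update σ u (base u) with hτ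
  have hτ0 : ρ τ ≠ 0 := hbase σ hσ u
  rw [heatBath_eq hρ hσ base, heatBath_eq hρ hτ0 base]
  obtain ⟨hq0, hq1⟩ := flipProb_mem hρ hσ base v
  have hcomm : ∀ c, Function.update τ v c = Function.update (Function.update σ v c) u (base u) :=
    fun c => Function.update_comm huv.symm _ _ _
  -- The Lipschitz bound holds only on the support; an update that would leave the support has flip
  -- probability zero.
  have hzero : ∀ σ', flipProb ρ base v σ' ≠ 0 → ρ (Function.update σ' v (-base v)) ≠ 0 := by
    intro σ' h h0
    exact h (by rw [flipProb, h0, zero_div])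
  set q := flipProb ρ base v σ with hq
  set q' := flipProb ρ base v τ with hq'
  have h1 : |q * (F (Function.update σ v (-base v)) - F (Function.update τ v (-base v)))| ≤
      q * (L * w u) := by
    rw [abs_mul, abs_of_nonneg hq0]
    rcases eq_or_ne q 0 with h0 | h0
    · rw [h0, zero_mul, zero_mul]
    · rw [hcomm]
      exact mul_le_mul_of_nonneg_left (hL _ (hzero σ h0) u) hq0
  have h2 : |(1 - q) * (F (Function.update σ v (base v)) - F (Function.update τ v (base v)))| ≤
      (1 - q) * (L * w u) := by
    rw [abs_mul, abs_of_nonneg (sub_nonneg.2 hq1), hcomm]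
    exact mul_le_mul_of_nonneg_left (hL _ (hbase σ hσ v) u) (by linarith)
  have h3 : |(q - q') * (F (Function.update τ v (-base v)) - F (Function.update τ v (base v)))| ≤
      |q - q'| * (L * w v) := by
    rw [abs_mul]
    rcases eq_or_ne q q' with h0 | h0
    · rw [h0, sub_self, abs_zero, zero_mul, zero_mul]
    · have hne : ρ (Function.update τ v (-base v)) ≠ 0 := by
        rcases eq_or_ne q 0 with h4 | h4
        · exact hzero τ fun h5 => h0 (h4.trans h5.symm)
        · rw [hcomm]
          exact hbase _ (hzero σ h4) u
      have := hL _ hne v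
      rw [Function.update_idem] at this
      exact mul_le_mul_of_nonneg_left this (abs_nonneg _)
  have hsplit : q * F (Function.update σ v (-base v)) + (1 - q) * F (Function.update σ v (base v)) -
      (q' * F (Function.update τ v (-base v)) + (1 - q') * F (Function.update τ v (base v))) =
      q * (F (Function.update σ v (-base v)) - F (Function.update τ v (-base v))) +
      (1 - q) * (F (Function.update σ v (base v)) - F (Function.update τ v (base v))) +
      (q - q') * (F (Function.update τ v (-base v)) - F (Function.update τ v (base v))) := by ring
  rw [hsplit]
  refine (abs_add_three _ _ _).trans ?_
  linarith

open Classical in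
/-- Eigenfunctions of the Glauber dynamics with large eigenvalue are constant. -/
theorem glauber_eigenfunction_const {ρ : Config V → ℝ} (hρ : ∀ σ, 0 ≤ ρ σ) {base : Config V}
    (hbase : ∀ σ, ρ σ ≠ 0 → ∀ v, ρ (Function.update σ v (base v)) ≠ 0) {w : V → ℝ}
    (hw : ∀ v, 0 < w v) {ε : ℝ}
    (H : ∀ σ, ρ σ ≠ 0 → ∀ u, σ u ≠ base u → ∑ v ∈ Finset.univ.erase u,
      |flipProb ρ base v σ - flipProb ρ base v (Function.update σ u (base u))| * w v ≤
        (1 - ε) * w u)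
    {k : ℝ} {f : Supp ρ → ℝ} (hk : 1 - ε / Fintype.card V < k)
    (hf : (glauber ρ).mulVec f = k • f) (σ τ : Supp ρ) : f σ = f τ := by
  set F : Config V → ℝ := fun σ => if h : ρ σ ≠ 0 then f ⟨σ, h⟩ else 0 with hFdef
  have hF : ∀ σ : Supp ρ, F σ.1 = f σ := fun σ => by
    simp only [hFdef]
    rw [dif_pos σ.2]
  -- Take the largest weighted discrepancy L over single-site moves to the base spin. One Glauber
  -- step shrinks it by 1 - ε/n while the eigenvalue scales it by k > 1 - ε/n, so L = 0.
  have hstep : ∀ σ, ρ σ ≠ 0 → ∀ u, F (Function.update σ u (base u)) = F σ := by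
    rcases isEmpty_or_nonempty V with hV | hV
    · intro σ _ u
      exact hV.elim u
    obtain ⟨⟨σ₀, u₀⟩, -, hmax⟩ := Finset.exists_max_image
      (Finset.univ : Finset (Supp ρ × V))
      (fun x => |F x.1.1 - F (Function.update x.1.1 x.2 (base x.2))| / w x.2)
      ⟨(σ, hV.some), Finset.mem_univ _⟩
    set L := |F σ₀.1 - F (Function.update σ₀.1 u₀ (base u₀))| / w u₀ with hLdef
    have hL : ∀ σ, ρ σ ≠ 0 → ∀ v, |F σ - F (Function.update σ v (base v))| ≤ L * w v := by
      intro σ hσ v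
      have := hmax (⟨σ, hσ⟩, v) (Finset.mem_univ _)
      exact (div_le_iff₀ (hw v)).1 this
    have hL0 : 0 ≤ L := div_nonneg (abs_nonneg _) (hw _).le
    have hn : (0 : ℝ) < Fintype.card V := by exact_mod_cast Fintype.card_pos
    have hLzero : L ≤ 0 := by
      by_contra! hLpos
      have hne : σ₀.1 u₀ ≠ base u₀ := by
        intro h
        rw [hLdef, ← h, Function.update_eq_self, sub_self, abs_zero, zero_div] at hLpos
        exact lt_irrefl _ hLpos
      set τ₀ : Supp ρ := ⟨Function.update σ₀.1 u₀ (base u₀), hbase _ σ₀.2 u₀⟩ with hτ₀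
      have hev : ∀ x : Supp ρ, k * F x.1 = 1 / (Fintype.card V : ℝ) *
          ∑ v, heatBath ρ v F x.1 := by
        intro x
        rw [← glauber_mulVec hF, hf, Pi.smul_apply, smul_eq_mul, hF]
      have h1 : |∑ v, heatBath ρ v F σ₀.1 - ∑ v, heatBath ρ v F τ₀.1| ≤
          (Fintype.card V - ε) * (L * w u₀) := by
        rw [← Finset.sum_sub_distrib, ← Finset.add_sum_erase _ _ (Finset.mem_univ u₀)]
        -- Resampling the vertex of disagreement erases the disagreement; this is the source of the
        -- contraction.
        have h0 : heatBath ρ u₀ F σ₀.1 - heatBath ρ u₀ F τ₀.1 = 0 := by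
          simp [heatBath, hτ₀]
        rw [h0, zero_add]
        calc _ ≤ ∑ v ∈ Finset.univ.erase u₀, |heatBath ρ v F σ₀.1 - heatBath ρ v F τ₀.1| :=
              Finset.abs_sum_le_sum_abs _ _
          _ ≤ ∑ v ∈ Finset.univ.erase u₀, (L * w u₀ +
              |flipProb ρ base v σ₀.1 - flipProb ρ base v τ₀.1| * (L * w v)) :=
              Finset.sum_le_sum fun v hv =>
                abs_heatBath_sub_le hρ hbase hL σ₀.2 (Finset.ne_of_mem_erase hv)
          _ = (Fintype.card V - 1) * (L * w u₀) + L * ∑ v ∈ Finset.univ.erase u₀,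
              |flipProb ρ base v σ₀.1 - flipProb ρ base v τ₀.1| * w v := by
              rw [Finset.sum_add_distrib, Finset.sum_const, nsmul_eq_mul,
                Finset.card_erase_of_mem (Finset.mem_univ _), Finset.card_univ,
                Nat.cast_sub Fintype.card_pos, Nat.cast_one, Finset.mul_sum]
              congr 1
              exact Finset.sum_congr rfl fun v _ => by ring
          _ ≤ (Fintype.card V - 1) * (L * w u₀) + L * ((1 - ε) * w u₀) := by
              gcongr
              exact H σ₀.1 σ₀.2 u₀ hne
          _ = _ := by ring
      have h2 : |F σ₀.1 - F τ₀.1| = L * w u₀ := (div_eq_iff (hw u₀).ne').1 hLdef.symm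
      have hLw : 0 < L * w u₀ := mul_pos hLpos (hw u₀)
      have h3 : k * (L * w u₀) ≤ (1 - ε / Fintype.card V) * (L * w u₀) := by
        calc k * (L * w u₀) ≤ |k| * |F σ₀.1 - F τ₀.1| := by
              rw [h2]
              exact mul_le_mul_of_nonneg_right (le_abs_self k) hLw.le
          _ = |1 / (Fintype.card V : ℝ) *
              (∑ v, heatBath ρ v F σ₀.1 - ∑ v, heatBath ρ v F τ₀.1)| := by
              rw [← abs_mul, mul_sub, mul_sub, hev, hev]
          _ = 1 / (Fintype.card V : ℝ) *
              |∑ v, heatBath ρ v F σ₀.1 - ∑ v, heatBath ρ v F τ₀.1| := by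
              rw [abs_mul, abs_of_pos (by positivity)]
          _ ≤ 1 / (Fintype.card V : ℝ) * ((Fintype.card V - ε) * (L * w u₀)) := by gcongr
          _ = _ := by field_simp
      exact absurd (le_of_mul_le_mul_right h3 hLw) (not_le.2 hk)
    intro σ hσ u
    have h1 := hL σ hσ u
    have h2 : L * w u ≤ 0 := mul_nonpos_of_nonpos_of_nonneg hLzero (hw u).le
    exact (sub_eq_zero.1 (abs_nonpos_iff.1 (h1.trans h2))).symm
  -- Setting the vertices to their base spins one at a time joins every supported configuration to
  -- `base` inside the support.
  have hall : ∀ σ, ρ σ ≠ 0 → F σ = F base := by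
    intro σ hσ
    have : ∀ T : Finset V, ρ (T.piecewise base σ) ≠ 0 ∧ F (T.piecewise base σ) = F σ := by
      intro T
      induction T using Finset.induction_on with
      | empty => simpa using hσ
      | insert a T _ ih =>
        rw [Finset.piecewise_insert]
        exact ⟨hbase _ ih.1 a, (hstep _ ih.1 a).trans ih.2⟩
    have h := (this Finset.univ).2
    rw [Finset.piecewise_univ] at h
    exact h.symm
  rw [← hF, ← hF, hall _ σ.2, hall _ τ.2]

/-- Dobrushin's condition implies a spectral gap. -/
theorem le_glauberGap {ρ : Config V → ℝ} (hρ : ∀ σ, 0 ≤ ρ σ) {base : Config V}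
    (hbase : ∀ σ, ρ σ ≠ 0 → ∀ v, ρ (Function.update σ v (base v)) ≠ 0) {w : V → ℝ}
    (hw : ∀ v, 0 < w v) {ε : ℝ} (hε0 : 0 ≤ ε) (hε1 : ε ≤ 1)
    (H : ∀ σ, ρ σ ≠ 0 → ∀ u, σ u ≠ base u → ∑ v ∈ Finset.univ.erase u,
      |flipProb ρ base v σ - flipProb ρ base v (Function.update σ u (base u))| * w v ≤
        (1 - ε) * w u) :
    ε / Fintype.card V ≤ glauberGap ρ := by
  classical
  have hB : 0 ≤ 1 - ε / Fintype.card V := by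
    rw [sub_nonneg]
    rcases Nat.eq_zero_or_pos (Fintype.card V) with h | h
    · simp [h]
    · have h1 : (1 : ℝ) ≤ Fintype.card V := by exact_mod_cast h
      exact (div_le_self hε0 h1).trans hε1
  have := charpoly_roots_getD_one_le (glauber ρ) (d := fun σ => ρ σ.1)
    (fun σ => lt_of_le_of_ne (hρ _) σ.2.symm) (glauber_reversible ρ) hB
    fun k f hk hf => glauber_eigenfunction_const hρ hbase hw H hk hf
  unfold glauberGap
  have h2 : ε / Fintype.card V ≤
    1 - ((glauber ρ).charpoly.roots.sort (· ≥ ·)).getD 1 0 := by linarith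
  convert h2

end glauber

/-! ### Glauber dynamics of the soft hard-core model -/

section modelGlauber

variable {V : Type*} [Fintype V] [DecidableEq V] {G : SimpleGraph V} [DecidableRel G.Adj]
  {p : ℝ} {m : V → ℝ} {χ : Config V} {ρ : Config V → ℝ} {Λ : Finset V} {σ : Λ → ℤˣ}

theorem wt_insert_eq {v : V} {S : Finset V} (hv : v ∉ S) :
    wt G p m (insert v S) = m v * p ^ (G.neighborFinset v ∩ S).card * wt G p m S := by
  unfold wt
  rw [innerEdges_insert G hv, Finset.prod_insert hv, pow_add]
  ring

theorem agreeSet_update_self (τ : Config V) (v : V) :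
    agreeSet χ (Function.update τ v (χ v)) = insert v ((agreeSet χ τ).erase v) := by
  ext w
  by_cases hw : w = v
  · subst hw; simp [mem_agreeSet]
  · simp [mem_agreeSet, hw]

theorem agreeSet_update_neg (τ : Config V) (v : V) :
    agreeSet χ (Function.update τ v (-χ v)) = (agreeSet χ τ).erase v := by
  ext w
  by_cases hw : w = v
  · subst hw; simp [mem_agreeSet]
  · simp [mem_agreeSet, hw]

theorem pin_ne_zero_agree {τ : Config V} (h : pin ρ Λ σ τ ≠ 0) (v : Λ) : τ v = σ v := by
  by_contra hcon
  refine h ?_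
  unfold pin
  rw [if_neg fun h' => hcon (h' v), zero_div]

omit [Fintype V] in
theorem agree_update {τ : Config V} (h : ∀ v : Λ, τ v = σ v) {v : V} (hv : v ∉ Λ) (c : ℤˣ) :
    ∀ w : Λ, Function.update τ v c w = σ w := by
  intro w
  rw [Function.update_of_ne, h w]
  intro h'
  exact hv (h' ▸ w.2)

/-- The pinned weight at configurations with the correct boundary condition. -/
theorem IsModel.exists_pin_eq (hρ : IsModel G p m χ ρ) (hf : Feasible ρ Λ σ) :
    ∃ c : ℝ, c ≠ 0 ∧ ∀ τ : Config V, (∀ v : Λ, τ v = σ v) →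
      pin ρ Λ σ τ = c * wt G p m (agreeSet χ τ) := by
  obtain ⟨c, hc, hρ⟩ := hρ
  refine ⟨c / marginal ρ Λ σ, div_ne_zero hc.ne' hf, fun τ hτ => ?_⟩
  unfold pin
  rw [if_pos hτ, hρ]
  ring

/-- Setting a spin to its base value stays in the support. -/
theorem IsModel.pin_update_ne_zero (hρ : IsModel G p m χ ρ) (hf : Feasible ρ Λ σ) {τ : Config V}
    (hτ : pin ρ Λ σ τ ≠ 0) (v : V) :
    pin ρ Λ σ (Function.update τ v (extend χ Λ σ ∅ v)) ≠ 0 := by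
  have hagree := pin_ne_zero_agree hτ
  by_cases hv : v ∈ Λ
  · have : extend χ Λ σ ∅ v = τ v := by
      simp only [extend, dif_pos hv]
      exact (hagree ⟨v, hv⟩).symm
    rw [this, Function.update_eq_self]
    exact hτ
  · have : extend χ Λ σ ∅ v = -χ v := by simp [extend, hv]
    rw [this]
    obtain ⟨c, hc, hpin⟩ := hρ.exists_pin_eq hf
    rw [hpin τ hagree] at hτ
    rw [hpin _ (agree_update hagree hv _), agreeSet_update_neg]
    refine mul_ne_zero hc fun h0 => right_ne_zero_of_mul hτ ?_
    by_cases hvS : v ∈ agreeSet χ τ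
    · rw [← Finset.insert_erase hvS, wt_insert_eq (Finset.notMem_erase _ _), h0, mul_zero]
    · rwa [Finset.erase_eq_of_notMem hvS] at h0

theorem flipProb_of_mem (τ : Config V) {v : V} (hv : v ∈ Λ) :
    flipProb (pin ρ Λ σ) (extend χ Λ σ ∅) v τ = 0 := by
  unfold flipProb
  rw [div_eq_zero_iff]
  left
  by_contra hcon
  have := pin_ne_zero_agree hcon ⟨v, hv⟩
  simp [extend, hv] at this

theorem IsModel.flipProb_of_notMem (hρ : IsModel G p m χ ρ) (hp : 0 ≤ p) (hm : ∀ v, 0 ≤ m v)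
    (hf : Feasible ρ Λ σ) {τ : Config V} (hτ : pin ρ Λ σ τ ≠ 0) {v : V} (hv : v ∉ Λ) :
    flipProb (pin ρ Λ σ) (extend χ Λ σ ∅) v τ =
      m v * p ^ (G.neighborFinset v ∩ agreeSet χ τ).card /
        (1 + m v * p ^ (G.neighborFinset v ∩ agreeSet χ τ).card) := by
  have hagree := pin_ne_zero_agree hτ
  have hb : extend χ Λ σ ∅ v = -χ v := by simp [extend, hv]
  have h0 := hρ.pin_update_ne_zero hf hτ v
  obtain ⟨c, hc, hpin⟩ := hρ.exists_pin_eq hf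
  have hN : G.neighborFinset v ∩ (agreeSet χ τ).erase v = G.neighborFinset v ∩ agreeSet χ τ := by
    ext w
    simp only [Finset.mem_inter, SimpleGraph.mem_neighborFinset, Finset.mem_erase]
    exact ⟨fun h => ⟨h.1, h.2.2⟩, fun h => ⟨h.1, h.1.ne', h.2⟩⟩
  have h1 := hpin _ (agree_update hagree hv (-χ v))
  have h2 := hpin _ (agree_update hagree hv (χ v))
  rw [agreeSet_update_neg] at h1
  rw [agreeSet_update_self, wt_insert_eq (Finset.notMem_erase _ _), hN] at h2
  rw [hb, h1] at h0
  unfold flipProb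
  rw [sum_units _ (χ v), hb, neg_neg, h1, h2]
  set W := wt G p m ((agreeSet χ τ).erase v)
  set r := m v * p ^ (G.neighborFinset v ∩ agreeSet χ τ).card
  have hr : 0 ≤ r := mul_nonneg (hm v) (pow_nonneg hp _)
  have hW : W ≠ 0 := right_ne_zero_of_mul h0
  have h3 : c * (r * W) + c * W = c * W * (1 + r) := by ring
  rw [h3]
  have h4 : 1 + r ≠ 0 := by positivity
  field_simp

/-- Dobrushin's condition for the soft hard-core model gives the spectral gap for all pinnings. -/
theorem IsModel.le_glauberGap_pin (hρ : IsModel G p m χ ρ) (hρ0 : ∀ τ, 0 ≤ ρ τ) (hp : 0 ≤ p)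
    (hp1 : p < 1) (hm : ∀ v, 0 ≤ m v) (hf : Feasible ρ Λ σ) {w : V → ℝ} (hw : ∀ v, 0 < w v)
    {ε : ℝ} (hε0 : 0 ≤ ε) (hε1 : ε ≤ 1)
    (H : ∀ u, ∀ r : V → ℝ,
      (∀ v ∈ G.neighborFinset u, m v * p ^ (G.degree v - 1) ≤ r v ∧ r v ≤ m v) →
      ∑ v ∈ G.neighborFinset u, sens p (r v) * w v ≤ (1 - ε) * w u) :
    ε / Fintype.card V ≤ glauberGap (pin ρ Λ σ) := by
  have hpin0 : ∀ τ, 0 ≤ pin ρ Λ σ τ := by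
    intro τ
    unfold pin
    refine div_nonneg ?_ (Finset.sum_nonneg fun τ _ => hρ0 τ)
    split_ifs
    · exact hρ0 τ
    · exact le_rfl
  refine le_glauberGap hpin0 (fun τ hτ v => hρ.pin_update_ne_zero hf hτ v) hw hε0 hε1 ?_
  intro τ hτ u hu
  have hagree := pin_ne_zero_agree hτ
  have huΛ : u ∉ Λ := fun h => hu (by
    rw [hagree ⟨u, h⟩]
    simp [extend, h])
  have hb : extend χ Λ σ ∅ u = -χ u := by simp [extend, huΛ]
  have hτ' := hρ.pin_update_ne_zero hf hτ u
  rw [hb] at hu hτ' ⊢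
  set S := agreeSet χ τ with hS
  have huS : u ∈ S := by
    rw [hS, mem_agreeSet]
    by_contra hcon
    exact hu ((units_ne_iff _ _).1 hcon)
  -- r v is the odds of v being +1 in the model when u is -1. Spin +1 at u multiplies it by p, which
  -- changes the flip probability by exactly sens p (r v).
  set r : V → ℝ := fun v => m v * p ^ (G.neighborFinset v ∩ S.erase u).card with hr
  have hterm : ∀ v ∈ Finset.univ.erase u,
      |flipProb (pin ρ Λ σ) (extend χ Λ σ ∅) v τ -
        flipProb (pin ρ Λ σ) (extend χ Λ σ ∅) v (Function.update τ u (-χ u))| * w v ≤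
      if v ∈ G.neighborFinset u then sens p (r v) * w v else 0 := by
    intro v hv
    have hr0 : 0 ≤ r v := mul_nonneg (hm v) (pow_nonneg hp _)
    by_cases hvΛ : v ∈ Λ
    · rw [flipProb_of_mem _ hvΛ, flipProb_of_mem _ hvΛ, sub_zero, abs_zero, zero_mul]
      split_ifs
      · exact mul_nonneg (sens_nonneg hp hp1 hr0) (hw v).le
      · exact le_rfl
    · rw [hρ.flipProb_of_notMem hp hm hf hτ hvΛ, hρ.flipProb_of_notMem hp hm hf hτ' hvΛ,
        agreeSet_update_neg, ← hS]
      split_ifs with huv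
      · rw [SimpleGraph.mem_neighborFinset] at huv
        have hcard : (G.neighborFinset v ∩ S).card =
            (G.neighborFinset v ∩ S.erase u).card + 1 := by
          rw [Finset.inter_erase, Finset.card_erase_add_one]
          exact Finset.mem_inter.2 ⟨by simpa using huv.symm, huS⟩
        have h1 : m v * p ^ (G.neighborFinset v ∩ S).card = p * r v := by
          rw [hcard, pow_succ]
          simp only [hr]
          ring
        rw [h1, show m v * p ^ (G.neighborFinset v ∩ S.erase u).card = r v from rfl]
        have h2 : p * r v / (1 + p * r v) - r v / (1 + r v) = -sens p (r v) := by
          unfold sens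
          field_simp
          ring
        rw [h2, abs_neg, abs_of_nonneg (sens_nonneg hp hp1 hr0)]
      · rw [SimpleGraph.mem_neighborFinset] at huv
        have : G.neighborFinset v ∩ S.erase u = G.neighborFinset v ∩ S := by
          rw [Finset.inter_erase, Finset.erase_eq_of_notMem]
          intro h
          exact huv ((by simpa using (Finset.mem_inter.1 h).1 : G.Adj v u).symm)
        rw [this, sub_self, abs_zero, zero_mul]
  refine (Finset.sum_le_sum hterm).trans (le_trans (le_of_eq ?_) (H u r ?_))
  · rw [← Finset.sum_filter]
    congr 1
    ext v
    simp only [Finset.mem_filter, Finset.mem_erase, Finset.mem_univ, and_true,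
      SimpleGraph.mem_neighborFinset]
    exact ⟨fun h => h.2, fun h => ⟨h.ne', h⟩⟩
  · intro v hv
    rw [SimpleGraph.mem_neighborFinset] at hv
    -- The neighbor u of v is erased from S, so at most deg v - 1 neighbors damp v.
    have hcard : (G.neighborFinset v ∩ S.erase u).card ≤ G.degree v - 1 := by
      rw [← SimpleGraph.card_neighborFinset_eq_degree,
        ← Finset.card_erase_of_mem (by simpa using hv.symm : u ∈ G.neighborFinset v)]
      refine Finset.card_le_card fun x hx => ?_
      obtain ⟨h1, h2⟩ := Finset.mem_inter.1 hx
      exact Finset.mem_erase.2 ⟨Finset.ne_of_mem_erase h2, h1⟩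
    exact ⟨mul_le_mul_of_nonneg_left (pow_le_pow_of_le_one hp hp1.le hcard) (hm v),
      mul_le_of_le_one_right (hm v) (pow_le_one₀ hp hp1.le)⟩

end modelGlauber

/-! ### The spectral gap for small fields -/

section smallField

variable {V : Type*} [Fintype V] [DecidableEq V] {G : SimpleGraph V} [DecidableRel G.Adj]
  {β γ lam δ : ℝ}

omit [DecidableEq V] in
/-- Dobrushin's condition for the magnetized distribution. -/
theorem dobrushin_goodField (h : AntiFerro β γ lam) (hδ0 : 0 < δ) (hδ1 : δ < 1)
    (hU : UpToUnique β γ lam G.maxDegree δ)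
    (hedge : ∀ u v : V, G.Adj u v → 2 ≤ G.degree u ∨ 2 ≤ G.degree v) (u : V) (r : V → ℝ)
    (hr : ∀ v ∈ G.neighborFinset u,
      goodField G β γ lam (fun _ => δ ^ 2 / 64) v * (β * γ) ^ (G.degree v - 1) ≤ r v ∧
        r v ≤ goodField G β γ lam (fun _ => δ ^ 2 / 64) v) :
    ∑ v ∈ G.neighborFinset u, sens (β * γ) (r v) *
        (if 2 ≤ G.degree v then (G.degree v : ℝ) else 3 / 4) ≤
      (1 - δ / 8) * if 2 ≤ G.degree u then (G.degree u : ℝ) else 3 / 4 := by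
  have hθ : 0 < δ ^ 2 / 64 := by positivity
  have hp := h.mul_nonneg
  have hp1 := h.beta_mul_gamma_lt_one
  have hbig : ∀ v ∈ G.neighborFinset u, 2 ≤ G.degree v →
      sens (β * γ) (r v) * (G.degree v : ℝ) ≤ 9 / 16 := by
    intro v hv hdeg
    obtain ⟨d, hd⟩ : ∃ d, G.degree v = d + 1 := ⟨G.degree v - 1, by omega⟩
    have hOK := goodField_fieldOK (G := G) h hθ (φ := fun _ => δ ^ 2 / 64) (fun _ => hθ)
      (fun _ => le_rfl) v
    obtain ⟨h1, h2⟩ := hr v hv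
    have hle := G.degree_le_maxDegree v
    rw [hd] at hOK h1 ⊢
    have := hOK.sens_small h (by omega) hδ0 (hU d (by omega) (by omega)) h1 h2
    push_cast
    linarith
  -- A leaf neighbor contributes at most 3/4, using only sens ≤ 1 since uniqueness says nothing for
  -- d = 0; other neighbors contribute at most 9/16. For deg u ≥ 2, 3/4 ≤ 1 - δ/8 suffices. A leaf u
  -- has weight only 3/4, but `hedge` makes its neighbor contribute 9/16 ≤ (1 - δ/8) * 3/4.
  by_cases hu : 2 ≤ G.degree u
  · have hterm : ∀ v ∈ G.neighborFinset u, sens (β * γ) (r v) *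
        (if 2 ≤ G.degree v then (G.degree v : ℝ) else 3 / 4) ≤ 3 / 4 := by
      intro v hv
      split_ifs with hdeg
      · exact (hbig v hv hdeg).trans (by norm_num)
      · have hm := goodField_nonneg (G := G) h (φ := fun _ => δ ^ 2 / 64) (fun _ => hθ) v
        have hr0 : 0 ≤ r v := le_trans (mul_nonneg hm (pow_nonneg hp _)) (hr v hv).1
        have := sens_le_one hp hr0
        linarith
    refine (Finset.sum_le_card_nsmul _ _ _ hterm).trans ?_
    rw [SimpleGraph.card_neighborFinset_eq_degree, nsmul_eq_mul, if_pos hu, mul_comm]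
    exact mul_le_mul_of_nonneg_right (by linarith) (Nat.cast_nonneg _)
  · have hterm : ∀ v ∈ G.neighborFinset u, sens (β * γ) (r v) *
        (if 2 ≤ G.degree v then (G.degree v : ℝ) else 3 / 4) ≤ 9 / 16 := by
      intro v hv
      have hdeg : 2 ≤ G.degree v :=
        (hedge u v ((G.mem_neighborFinset u v).1 hv)).resolve_left hu
      rw [if_pos hdeg]
      exact hbig v hv hdeg
    refine (Finset.sum_le_card_nsmul _ _ _ hterm).trans ?_
    have hu1 : (G.degree u : ℝ) ≤ 1 := by
      have : G.degree u ≤ 1 := by omega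
      exact_mod_cast this
    rw [SimpleGraph.card_neighborFinset_eq_degree, nsmul_eq_mul, if_neg hu]
    linarith

theorem le_minGap (h : AntiFerro β γ lam) (hδ0 : 0 < δ) (hδ1 : δ < 1)
    (hU : UpToUnique β γ lam G.maxDegree δ)
    (hedge : ∀ u v : V, G.Adj u v → 2 ≤ G.degree u ∨ 2 ≤ G.degree v) :
    1 / (8 / δ * (Fintype.card V : ℝ)) ≤
      minGap (magnetize (flip (gibbs G β γ lam) (goodDirection G β γ lam))
        (fun _ => δ ^ 2 / 64)) := by
  have hθ : 0 < δ ^ 2 / 64 := by positivity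
  have hmem := magnetize_mem_stdSimplex (φ := fun _ => δ ^ 2 / 64)
    (flip_mem_stdSimplex (gibbs_mem_stdSimplex G h) (goodDirection G β γ lam)) fun _ => hθ
  have hmodel := isModel_magnetize (G := G) h (goodDirection G β γ lam)
    (φ := fun _ => δ ^ 2 / 64) fun _ => hθ
  set ρ := magnetize (flip (gibbs G β γ lam) (goodDirection G β γ lam)) fun _ => δ ^ 2 / 64
  -- A lower bound for the infimum requires an admissible pinning; the empty one is always feasible.
  have hne : Nonempty ((Λ : Finset V) × {σ : Λ → ℤˣ // Feasible ρ Λ σ}) := by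
    refine ⟨⟨∅, ⟨fun _ => 1, ?_⟩⟩⟩
    have : marginal ρ ∅ (fun _ => 1) = 1 := by
      rw [← hmem.2]
      unfold marginal
      rw [Finset.filter_true_of_mem]
      intro τ _ v
      exact absurd v.2 (Finset.notMem_empty _)
    unfold Feasible
    rw [this]
    exact one_ne_zero
  refine le_ciInf fun q => ?_
  have heq : 1 / (8 / δ * (Fintype.card V : ℝ)) = δ / 8 / Fintype.card V := by
    rw [one_div, mul_inv, inv_div, ← div_eq_mul_inv]
  rw [heq]
  refine hmodel.le_glauberGap_pin hmem.1 h.mul_nonneg h.beta_mul_gamma_lt_one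
    (goodField_nonneg h fun _ => hθ) q.2.2
    (w := fun v => if 2 ≤ G.degree v then (G.degree v : ℝ) else 3 / 4) ?_ (by linarith)
    (by linarith) (dobrushin_goodField h hδ0 hδ1 hU hedge)
  intro v
  split_ifs with hv
  · have : 0 < G.degree v := by omega
    exact_mod_cast this
  · norm_num

end smallField

end TwoSpin

end

theorem theorem2p5 {V : Type*} [Fintype V] [DecidableEq V]
    (G : SimpleGraph V) [DecidableRel G.Adj] (β γ lam δ : ℝ)
    (hδ0 : 0 < δ) (hδ1 : δ < 1)
    (hI : TwoSpin.AntiFerro β γ lam)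
    (hΔ : 3 ≤ G.maxDegree)
    (hU : TwoSpin.UpToUnique β γ lam G.maxDegree δ) :
    TwoSpin.CompletelySpectrallyIndependent (144 / δ)
      (TwoSpin.flip (TwoSpin.gibbs G β γ lam) (TwoSpin.goodDirection G β γ lam)) ∧
    ((∀ u v : V, G.Adj u v → 2 ≤ G.degree u ∨ 2 ≤ G.degree v) →
      1 / (8 / δ * (Fintype.card V : ℝ)) ≤
        TwoSpin.minGap (TwoSpin.magnetize
          (TwoSpin.flip (TwoSpin.gibbs G β γ lam) (TwoSpin.goodDirection G β γ lam))
          (fun _ => δ ^ 2 / 64))) := by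
  exact ⟨TwoSpin.completelySpectrallyIndependent hI hδ0 hδ1 hΔ hU,
    TwoSpin.le_minGap hI hδ0 hδ1 hU⟩
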